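/- Let $G=(V,E)$ be a finite simple undirected graph on $n=|V|$ nodes, $0<\alpha<1$ a jump probability and $q$ a probability distribution on $V$. Write $\Gamma(v)$ for the set of neighbours of $v$. The $\alpha$-random walk on $G$ jumps, at each step, with probability $\alpha$ to a random node distributed as $q$, and otherwise moves to a uniformly random neighbour of its current node (it stays where it is if this node has no neighbours). The PageRank $\pi_v$ of $v$ is the mass of $v$ in the unique stationary distribution of this walk. In the deletion-model a strategy of a player $v\in V$ is a nonempty set $E_v\subseteq\Gamma(v)$; its payoff is the PageRank of $v$ in the graph obtained from $G$ by deleting the edges $vi$ with $i\in\Gamma(v)\setminus E_v$. The strategy is improving if this payoff is larger than the PageRank of $v$ in $G$. The graph $G$ is a Nash equilibrium in the deletion-model (for $\alpha$ and $q$) if no player has an improving strategy. Let $k=k(G)=1$ if $G$ is a tree, and otherwise let $k(G)$ be the maximum, over all biconnected components (maximal connected subgraphs without a cut vertex) $B$ of $G$ and all nodes $w$ of $B$, of the degree of $w$ in $B$. **Theorem.** There is an algorithm that, given $G$ (by its adjacency matrix), $\alpha$ and $q$, determines in $O(2^{k(G)}\,n^4)$ time whether $G$ is a Nash equilibrium in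 the deletion-model and, if it is not, outputs a player together with an improving strategy for that player. Here time is the number of elementary operations of a real random access machine, in which additions, subtractions, multiplications, divisions and comparisons of real numbers, additions, subtractions and comparisons of natural numbers, and accesses to array entries take one unit of time each, and $\alpha$ and the entries of $q$ are given as real numbers. The algorithm is a single program, and the constant in the $O$ is absolute. -/

import Mathlib

/-! # PageRank of undirected graphs -/

namespace PageRankGame

noncomputable section

section Graph

variable {V : Type*}

/-- A probability distribution on `V`. -/
def IsDistribution [Fintype V] (q : V → ℝ) : Prop :=
  (∀ v, 0 ≤ q v) ∧ ∑ v, q v = 1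

open Classical in
/-- Transition probabilities of the simple random walk on `G`: from `u` it moves to a uniformly
chosen neighbour of `u`. At a node without any link there is nowhere to go and the walk stays put
(until the next random jump). -/
def step (G : SimpleGraph V) (u w : V) : ℝ :=
  if (G.neighborSet u).ncard = 0 then (if u = w then 1 else 0)
  else if G.Adj u w then 1 / ((G.neighborSet u).ncard : ℝ) else 0

theorem step_nonneg (G : SimpleGraph V) (u w : V) : 0 ≤ step G u w := by
  unfold step
  split_ifs <;> positivity

/-- Transition probabilities of the `α`-random walk: with probability `α` it jumps to a random node
distributed as `q`, otherwise it makes a step of the simple random walk. -/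
def alphaStep (G : SimpleGraph V) (α : ℝ) (q : V → ℝ) (u w : V) : ℝ :=
  α * q w + (1 - α) * step G u w

variable [Fintype V]

/-- `π` is a stationary distribution of the `α`-random walk on `G`. -/
def IsStationary (G : SimpleGraph V) (α : ℝ) (q π : V → ℝ) : Prop :=
  IsDistribution π ∧ ∀ w, π w = ∑ u, π u * alphaStep G α q u w

open Classical in
/-- The PageRank vector: the stationary distribution of the `α`-random walk. It exists and is
unique for `0 < α < 1`, see `existsUnique_isStationary`; the value `0` outside this range is a
dummy. -/
def pageRank (G : SimpleGraph V) (α : ℝ) (q : V → ℝ) : V → ℝ :=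
  if h : ∃ π, IsStationary G α q π then h.choose else 0

theorem sum_step (G : SimpleGraph V) (u : V) : ∑ w, step G u w = 1 := by
  classical
  unfold step
  by_cases h : (G.neighborSet u).ncard = 0
  · simp [h]
  · simp only [h, if_false]
    rw [← Finset.sum_filter, Finset.sum_const, nsmul_eq_mul]
    have : (Finset.univ.filter fun w => G.Adj u w).card = (G.neighborSet u).ncard := by
      rw [← Set.ncard_coe_finset]
      congr 1
      ext w
      simp
    rw [this]
    field_simp

/-- The PageRank vector is well defined. -/
theorem existsUnique_isStationary (G : SimpleGraph V) {α : ℝ} (h0 : 0 < α) (h1 : α < 1)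
    {q : V → ℝ} (hq : IsDistribution q) : ∃! π, IsStationary G α q π := by
  classical
  -- the linear map `x ↦ x - (1 - α) x P` is injective, hence bijective
  let L : (V → ℝ) →ₗ[ℝ] (V → ℝ) :=
    { toFun := fun x w => x w - (1 - α) * ∑ u, x u * step G u w
      map_add' := by
        intro x y
        funext w
        simp only [Pi.add_apply, add_mul, Finset.sum_add_distrib]
        ring
      map_smul' := by
        intro c x
        funext w
        simp only [Pi.smul_apply, smul_eq_mul, RingHom.id_apply, mul_assoc, ← Finset.mul_sum]
        ring }
  have hLdef : ∀ x w, L x w = x w - (1 - α) * ∑ u, x u * step G u w := fun _ _ => rfl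
  have hsum : ∀ x : V → ℝ, ∑ w, ∑ u, x u * step G u w = ∑ u, x u := by
    intro x
    rw [Finset.sum_comm]
    exact Finset.sum_congr rfl fun u _ => by rw [← Finset.mul_sum, sum_step, mul_one]
  have habs : ∀ x : V → ℝ, α * ∑ w, |x w| ≤ ∑ w, |L x w| := by
    intro x
    have h : ∀ w, |x w| ≤ |L x w| + (1 - α) * ∑ u, |x u| * step G u w := by
      intro w
      have hx : x w = L x w + (1 - α) * ∑ u, x u * step G u w := by rw [hLdef]; ring
      calc |x w| = |L x w + (1 - α) * ∑ u, x u * step G u w| := by rw [← hx]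
        _ ≤ |L x w| + |(1 - α) * ∑ u, x u * step G u w| := abs_add_le _ _
        _ ≤ |L x w| + (1 - α) * ∑ u, |x u| * step G u w := by
          rw [abs_mul, abs_of_pos (sub_pos.2 h1)]
          have : |∑ u, x u * step G u w| ≤ ∑ u, |x u| * step G u w :=
            (Finset.abs_sum_le_sum_abs _ _).trans (Finset.sum_le_sum fun u _ => by
              rw [abs_mul, abs_of_nonneg (step_nonneg G u w)])
          have h2 : 0 ≤ 1 - α := by linarith
          gcongr
    have := Finset.sum_le_sum fun w (_ : w ∈ Finset.univ) => h w
    rw [Finset.sum_add_distrib, ← Finset.mul_sum, hsum (fun u => |x u|)] at this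
    linarith
  have hinj : Function.Injective L := by
    rw [← LinearMap.ker_eq_bot, LinearMap.ker_eq_bot']
    intro x hx
    have h := habs x
    simp only [hx, Pi.zero_apply, abs_zero, Finset.sum_const_zero] at h
    have h' : ∑ w, |x w| ≤ 0 := by nlinarith
    have h'' := (Finset.sum_eq_zero_iff_of_nonneg fun w _ => abs_nonneg (x w)).1
      (le_antisymm h' (Finset.sum_nonneg fun w _ => abs_nonneg (x w)))
    funext w
    simpa using h'' w (Finset.mem_univ w)
  have hiff : ∀ π : V → ℝ, ∑ v, π v = 1 →
      ((∀ w, π w = ∑ u, π u * alphaStep G α q u w) ↔ L π = fun w => α * q w) := by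
    intro π hπ
    rw [funext_iff]
    refine forall_congr' fun w => ?_
    have : ∑ u, π u * alphaStep G α q u w
        = α * q w + (1 - α) * ∑ u, π u * step G u w := by
      have h3 : ∀ u, π u * alphaStep G α q u w
          = π u * (α * q w) + (1 - α) * (π u * step G u w) := by
        intro u
        unfold alphaStep
        ring
      simp only [h3, Finset.sum_add_distrib]
      rw [← Finset.sum_mul, ← Finset.mul_sum, hπ, one_mul]
    rw [this, hLdef]
    constructor <;> intro h <;> linarith
  obtain ⟨π, hπ⟩ := (LinearMap.injective_iff_surjective.1 hinj) (fun w => α * q w)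
  have htot : ∑ v, π v = 1 := by
    have h : ∑ w, L π w = ∑ w, α * q w := by rw [hπ]
    simp only [hLdef, Finset.sum_sub_distrib, ← Finset.mul_sum, hsum, hq.2] at h
    have h4 : α * (∑ v, π v - 1) = 0 := by linarith
    have h5 := (mul_eq_zero.1 h4).resolve_left h0.ne'
    linarith
  have hnn : ∀ v, 0 ≤ π v := by
    have h := habs π
    have h6 : ∑ w, |L π w| = α := by
      rw [hπ]
      have : ∀ w, |α * q w| = α * q w := fun w => abs_of_nonneg (mul_nonneg h0.le (hq.1 w))
      simp only [this, ← Finset.mul_sum, hq.2, mul_one]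
    have h7 : ∑ w, (|π w| - π w) ≤ 0 := by
      rw [Finset.sum_sub_distrib, htot]
      nlinarith
    have h8 := (Finset.sum_eq_zero_iff_of_nonneg
      fun w _ => sub_nonneg.2 (le_abs_self (π w))).1
      (le_antisymm h7 (Finset.sum_nonneg fun w _ => sub_nonneg.2 (le_abs_self (π w))))
    intro v
    have h9 := h8 v (Finset.mem_univ v)
    have h10 := abs_nonneg (π v)
    linarith
  refine ⟨π, ⟨⟨hnn, htot⟩, (hiff π htot).2 hπ⟩, ?_⟩
  rintro ρ ⟨⟨_, hρ⟩, hs⟩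
  exact hinj (((hiff ρ hρ).1 hs).trans hπ.symm)

theorem pageRank_isStationary (G : SimpleGraph V) {α : ℝ} (h0 : 0 < α) (h1 : α < 1)
    {q : V → ℝ} (hq : IsDistribution q) : IsStationary G α q (pageRank G α q) := by
  have h := (existsUnique_isStationary G h0 h1 hq).exists
  unfold pageRank
  rw [dif_pos h]
  exact h.choose_spec

/-! # The deletion-model -/

/-- The graph after player `v` has deleted her links to all neighbours outside `E`. -/
def retain (G : SimpleGraph V) (v : V) (E : Set V) : SimpleGraph V :=
  G.deleteEdges {e | ∃ i ∈ G.neighborSet v \ E, e = s(v, i)}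

/-- A strategy of player `v` in the deletion-model: a nonempty set of neighbours to whom she keeps
her links. -/
def IsStrategy (G : SimpleGraph V) (v : V) (E : Set V) : Prop :=
  E ⊆ G.neighborSet v ∧ E.Nonempty

/-- Player `v` cannot increase her PageRank by any strategy of the deletion-model. -/
def IsBestResponse (G : SimpleGraph V) (α : ℝ) (q : V → ℝ) (v : V) : Prop :=
  ∀ E, IsStrategy G v E → pageRank (retain G v E) α q v ≤ pageRank G α q v

/-- Nash equilibrium in the deletion-model: every player is in best response. -/
def IsNash (G : SimpleGraph V) (α : ℝ) (q : V → ℝ) : Prop :=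
  ∀ v, IsBestResponse G α q v

/-- `E` is an improving strategy for player `v`. -/
def IsImproving (G : SimpleGraph V) (α : ℝ) (q : V → ℝ) (v : V) (E : Set V) : Prop :=
  IsStrategy G v E ∧ pageRank G α q v < pageRank (retain G v E) α q v

/-! # Biconnected components -/

/-- The subgraph induced by `B` is connected and has no cut vertex. -/
def IsBiconnected (G : SimpleGraph V) (B : Set V) : Prop :=
  (G.induce B).Connected ∧ ∀ w ∈ B, (G.induce (B \ {w})).Preconnected

/-- A biconnected component (block): a maximal biconnected set of nodes. -/
def IsBiconnectedComponent (G : SimpleGraph V) (B : Set V) : Prop :=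
  Maximal (IsBiconnected G) B

open Classical in
/-- The parameter `k(G)`: it is `1` for a tree, and otherwise the maximum, over all biconnected
components `B` of `G` and all nodes `w` of `B`, of the degree of `w` within `B`. -/
def blockDegree (G : SimpleGraph V) : ℕ :=
  if G.IsTree then 1
  else sSup {d | ∃ B, IsBiconnectedComponent G B ∧
    ∃ w ∈ B, d = (G.neighborSet w ∩ B).ncard}

end Graph

/-! # A real random access machine

Programs use finitely many integer variables, arrays of natural numbers and arrays of real numbers.
Natural numbers can be added, subtracted and compared and serve as array indices; real numbers can
be added, subtracted, multiplied, divided and compared. The only constants are natural numbers, and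
there is no way back from a real number to a natural number other than a comparison. Every
elementary operation takes one unit of time. -/

/-- The memory: `nat x` is the content of the integer variable number `x`, and `natArr a i`,
`realArr a i` are the `i`-th entries of the integer, respectively real, array number `a`. -/
structure Memory where
  nat : ℕ → ℕ
  natArr : ℕ → ℕ → ℕ
  realArr : ℕ → ℕ → ℝ

/-- Integer expressions. -/
inductive NatExpr where
  | const (c : ℕ)
  | var (x : ℕ)
  | get (a : ℕ) (i : NatExpr)
  | add (e f : NatExpr)
  | sub (e f : NatExpr)

/-- The number of operations in an integer expression. -/
def NatExpr.size : NatExpr → ℕ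
  | .const _ => 1
  | .var _ => 1
  | .get _ i => i.size + 1
  | .add e f => e.size + f.size + 1
  | .sub e f => e.size + f.size + 1

/-- The value of an integer expression; subtraction is truncated at `0`. -/
def NatExpr.eval (m : Memory) : NatExpr → ℕ
  | .const c => c
  | .var x => m.nat x
  | .get a i => m.natArr a (i.eval m)
  | .add e f => e.eval m + f.eval m
  | .sub e f => e.eval m - f.eval m

/-- Real expressions. -/
inductive RealExpr where
  | cast (e : NatExpr)
  | get (a : ℕ) (i : NatExpr)
  | add (e f : RealExpr)
  | sub (e f : RealExpr)
  | mul (e f : RealExpr)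
  | div (e f : RealExpr)

/-- The number of operations in a real expression. -/
def RealExpr.size : RealExpr → ℕ
  | .cast e => e.size + 1
  | .get _ i => i.size + 1
  | .add e f => e.size + f.size + 1
  | .sub e f => e.size + f.size + 1
  | .mul e f => e.size + f.size + 1
  | .div e f => e.size + f.size + 1

/-- The value of a real expression; a division by `0` returns `0`. -/
def RealExpr.eval (m : Memory) : RealExpr → ℝ
  | .cast e => (e.eval m : ℝ)
  | .get a i => m.realArr a (i.eval m)
  | .add e f => e.eval m + f.eval m
  | .sub e f => e.eval m - f.eval m
  | .mul e f => e.eval m * f.eval m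
  | .div e f => e.eval m / f.eval m

/-- Tests: comparisons of two integers or of two real numbers. -/
inductive Test where
  | natEq (e f : NatExpr)
  | natLt (e f : NatExpr)
  | realEq (e f : RealExpr)
  | realLt (e f : RealExpr)

/-- The number of operations in a test. -/
def Test.size : Test → ℕ
  | .natEq e f => e.size + f.size + 1
  | .natLt e f => e.size + f.size + 1
  | .realEq e f => e.size + f.size + 1
  | .realLt e f => e.size + f.size + 1

/-- The outcome of a test. -/
def Test.Holds (m : Memory) : Test → Prop
  | .natEq e f => e.eval m = f.eval m
  | .natLt e f => e.eval m < f.eval m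
  | .realEq e f => e.eval m = f.eval m
  | .realLt e f => e.eval m < f.eval m

/-- Programs. -/
inductive Program where
  /-- do nothing -/
  | nop
  /-- `x := e` -/
  | setNat (x : ℕ) (e : NatExpr)
  /-- `natArr a [i] := e` -/
  | storeNat (a : ℕ) (i e : NatExpr)
  /-- `realArr a [i] := e` -/
  | storeReal (a : ℕ) (i : NatExpr) (e : RealExpr)
  /-- first `p`, then `r` -/
  | seq (p r : Program)
  /-- if `b` then `p` else `r` -/
  | cond (b : Test) (p r : Program)
  /-- while `b` do `p` -/
  | loop (b : Test) (p : Program)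

/-- `m` after the assignment `x := c`. -/
def Memory.setNat (m : Memory) (x c : ℕ) : Memory :=
  { m with nat := Function.update m.nat x c }

/-- `m` after the assignment `natArr a [i] := c`. -/
def Memory.storeNat (m : Memory) (a i c : ℕ) : Memory :=
  { m with natArr := Function.update m.natArr a (Function.update (m.natArr a) i c) }

/-- `m` after the assignment `realArr a [i] := c`. -/
def Memory.storeReal (m : Memory) (a i : ℕ) (c : ℝ) : Memory :=
  { m with realArr := Function.update m.realArr a (Function.update (m.realArr a) i c) }

/-- `Runs p m t m'`: started with memory `m`, the program `p` halts after exactly `t` units of time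
with memory `m'`. -/
inductive Runs : Program → Memory → ℕ → Memory → Prop where
  | nop (m : Memory) : Runs .nop m 1 m
  | setNat (m : Memory) (x : ℕ) (e : NatExpr) :
      Runs (.setNat x e) m (e.size + 1) (m.setNat x (e.eval m))
  | storeNat (m : Memory) (a : ℕ) (i e : NatExpr) :
      Runs (.storeNat a i e) m (i.size + e.size + 1) (m.storeNat a (i.eval m) (e.eval m))
  | storeReal (m : Memory) (a : ℕ) (i : NatExpr) (e : RealExpr) :
      Runs (.storeReal a i e) m (i.size + e.size + 1) (m.storeReal a (i.eval m) (e.eval m))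
  | seq {p r : Program} {m m' m'' : Memory} {t t' : ℕ} :
      Runs p m t m' → Runs r m' t' m'' → Runs (.seq p r) m (t + t') m''
  | cond_true {b : Test} {p r : Program} {m m' : Memory} {t : ℕ} :
      b.Holds m → Runs p m t m' → Runs (.cond b p r) m (b.size + t) m'
  | cond_false {b : Test} {p r : Program} {m m' : Memory} {t : ℕ} :
      ¬ b.Holds m → Runs r m t m' → Runs (.cond b p r) m (b.size + t) m'
  | loop_true {b : Test} {p : Program} {m m' m'' : Memory} {t t' : ℕ} :
      b.Holds m → Runs p m t m' → Runs (.loop b p) m' t' m'' →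
      Runs (.loop b p) m (b.size + t + t') m''
  | loop_false {b : Test} {p : Program} {m : Memory} :
      ¬ b.Holds m → Runs (.loop b p) m b.size m

/-- The machine is deterministic. -/
theorem Runs.unique {p : Program} {m m₁ m₂ : Memory} {t₁ t₂ : ℕ}
    (h₁ : Runs p m t₁ m₁) (h₂ : Runs p m t₂ m₂) : t₁ = t₂ ∧ m₁ = m₂ := by
  induction h₁ generalizing t₂ m₂ with
  | nop | setNat | storeNat | storeReal => cases h₂; exact ⟨rfl, rfl⟩
  | seq _ _ ih ih' =>
    cases h₂ with
    | seq a b =>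
      obtain ⟨rfl, rfl⟩ := ih a
      obtain ⟨rfl, rfl⟩ := ih' b
      exact ⟨rfl, rfl⟩
  | cond_true hb _ ih =>
    cases h₂ with
    | cond_true _ a => obtain ⟨rfl, rfl⟩ := ih a; exact ⟨rfl, rfl⟩
    | cond_false hb' _ => exact absurd hb hb'
  | cond_false hb _ ih =>
    cases h₂ with
    | cond_true hb' _ => exact absurd hb' hb
    | cond_false _ a => obtain ⟨rfl, rfl⟩ := ih a; exact ⟨rfl, rfl⟩
  | loop_true hb _ _ ih ih' =>
    cases h₂ with
    | loop_true _ a b =>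
      obtain ⟨rfl, rfl⟩ := ih a
      obtain ⟨rfl, rfl⟩ := ih' b
      exact ⟨rfl, rfl⟩
    | loop_false hb' => exact absurd hb hb'
  | loop_false hb =>
    cases h₂ with
    | loop_true hb' _ _ => exact absurd hb' hb
    | loop_false _ => exact ⟨rfl, rfl⟩

open Classical in
/-- The input: variable `0` holds `n`, integer array `0` holds the `n × n` adjacency matrix of `G`
row by row, entry `0` of real array `0` holds `α`, and real array `1` holds the vector `q`. All
the rest of the memory is `0`. -/
def inputMemory (n : ℕ) (G : SimpleGraph (Fin n)) (α : ℝ) (q : Fin n → ℝ) : Memory where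
  nat x := if x = 0 then n else 0
  natArr a p := if a = 0 ∧ ∃ i j : Fin n, p = i * n + j ∧ G.Adj i j then 1 else 0
  realArr a p :=
    if a = 0 ∧ p = 0 then α else if h : a = 1 ∧ p < n then q ⟨p, h.2⟩ else 0

/-- The strategy that the machine outputs: the nodes `u` such that entry `u` of integer array `1`
is `1`. -/
def outputStrategy (n : ℕ) (m : Memory) : Set (Fin n) :=
  {u | m.natArr 1 u = 1}

/-- The output is right: variable `1` is `1` if `G` is a Nash equilibrium of the deletion-model.
Otherwise it is `0`, variable `2` names a player, and integer array `1` holds an improving strategy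
for her. -/
def CorrectOutput (n : ℕ) (G : SimpleGraph (Fin n)) (α : ℝ) (q : Fin n → ℝ) (m : Memory) : Prop :=
  (IsNash G α q → m.nat 1 = 1) ∧
  (¬ IsNash G α q → m.nat 1 = 0 ∧
    ∃ v : Fin n, m.nat 2 = v ∧ IsImproving G α q v (outputStrategy n m))

end

end PageRankGame

namespace PageRankGame

/-! # Program logic -/

/-! Fix a player `v` and put `β = 1 - α`. For a strategy `E` let `h u` be the probability that the
walk from `u`, in the graph left by `E`, reaches `v` when every step survives only with probability
`β`. Extend `h` by `h v = 1` and pair it with the stationarity equation: all nodes except `v`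
cancel, and π_v (1 - β R / |E|) = α (q_v + Q) remains, with Q = ∑ q_u h u over u ≠ v (`entryMass`)
and R = ∑ h u over u ∈ E (`returnMass`). This is `pageRank_mul_eq`. Clearing the positive
denominator, `E` beats a payoff ρ if and only if |E| (α q_v - ρ) + (|E| α Q + ρ β R) > 0
(`lt_pageRank_retain_iff`).

Before it hits `v`, the walk cannot leave its component of `G - v`. So on a component C the function
`h` depends on `E ∩ C` alone, and Q and R are sums over the components (`hit_union`). Once the size
s = |E| is fixed, the bracket above is additive over the components. Maximising it is a knapsack
problem: choose in each component a set of neighbours of `v`, with sizes adding up to s. The weights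
depend on s, so one knapsack is solved for each s.

Neighbours of `v` in the same component of `G - v` lie with `v` in one block: two of them and a path
between them close a cycle through `v`, and biconnected sets that share two nodes have a biconnected
union. Hence a component contains at most k of them (`card_le_blockDegree`); in a tree it contains
at most one, as paths are unique. So each component offers at most 2^k choices. For each, `h` solves
a linear system in |C| unknowns with a nonnegative matrix of row sums at most `β < 1`, for which
Gaussian elimination never meets a zero pivot and takes O(|C| n²) time.

Summed over the disjoint components this is O(2^k n³) per player (`gather_spec`). A knapsack runs
through at most n components, n sizes and 2^k sets, and there are n values of s: again O(2^k n³) per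
player (`knapsack_spec`). The n players give the claim.

The program is verified in a small Hoare logic: `Halts p m T Q` bounds the time and describes the
final memory, and `Frame` tells which memory a program cannot have touched. Sets of nodes are stored
as binary codes, so that a knapsack cell can hold its optimal set in one number. -/

@[simp] theorem Memory.setNat_nat (m : Memory) (x c y : ℕ) :
    (m.setNat x c).nat y = if y = x then c else m.nat y := by
  simp [Memory.setNat, Function.update_apply]

@[simp] theorem Memory.setNat_natArr (m : Memory) (x c : ℕ) :
    (m.setNat x c).natArr = m.natArr := rfl

@[simp] theorem Memory.setNat_realArr (m : Memory) (x c : ℕ) :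
    (m.setNat x c).realArr = m.realArr := rfl

@[simp] theorem Memory.storeNat_nat (m : Memory) (a i c : ℕ) :
    (m.storeNat a i c).nat = m.nat := rfl

@[simp] theorem Memory.storeNat_realArr (m : Memory) (a i c : ℕ) :
    (m.storeNat a i c).realArr = m.realArr := rfl

@[simp] theorem Memory.storeNat_natArr (m : Memory) (a i c b j : ℕ) :
    (m.storeNat a i c).natArr b j = if b = a then (if j = i then c else m.natArr a j)
      else m.natArr b j := by
  by_cases h : b = a
  · subst h
    simp [Memory.storeNat, Function.update_apply]
  · simp [Memory.storeNat, h]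

@[simp] theorem Memory.storeReal_nat (m : Memory) (a i : ℕ) (c : ℝ) :
    (m.storeReal a i c).nat = m.nat := rfl

@[simp] theorem Memory.storeReal_natArr (m : Memory) (a i : ℕ) (c : ℝ) :
    (m.storeReal a i c).natArr = m.natArr := rfl

@[simp] theorem Memory.storeReal_realArr (m : Memory) (a i : ℕ) (c : ℝ) (b j : ℕ) :
    (m.storeReal a i c).realArr b j = if b = a then (if j = i then c else m.realArr a j)
      else m.realArr b j := by
  by_cases h : b = a
  · subst h
    simp [Memory.storeReal, Function.update_apply]
  · simp [Memory.storeReal, h]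

attribute [simp] NatExpr.eval RealExpr.eval Test.Holds

/-- Does the program assign to integer variable `x`? -/
def Program.writesNat : Program → ℕ → Bool
  | .nop, _ => false
  | .setNat y _, x => y == x
  | .storeNat _ _ _, _ => false
  | .storeReal _ _ _, _ => false
  | .seq p r, x => p.writesNat x || r.writesNat x
  | .cond _ p r, x => p.writesNat x || r.writesNat x
  | .loop _ p, x => p.writesNat x

/-- Does the program assign to integer array `x`? -/
def Program.writesNatArr : Program → ℕ → Bool
  | .nop, _ => false
  | .setNat _ _, _ => false
  | .storeNat a _ _, x => a == x
  | .storeReal _ _ _, _ => false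
  | .seq p r, x => p.writesNatArr x || r.writesNatArr x
  | .cond _ p r, x => p.writesNatArr x || r.writesNatArr x
  | .loop _ p, x => p.writesNatArr x

/-- Does the program assign to real array `x`? -/
def Program.writesRealArr : Program → ℕ → Bool
  | .nop, _ => false
  | .setNat _ _, _ => false
  | .storeNat _ _ _, _ => false
  | .storeReal a _ _, x => a == x
  | .seq p r, x => p.writesRealArr x || r.writesRealArr x
  | .cond _ p r, x => p.writesRealArr x || r.writesRealArr x
  | .loop _ p, x => p.writesRealArr x

/-- `m'` agrees with `m` on everything to which `p` does not assign. -/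
structure Frame (p : Program) (m m' : Memory) : Prop where
  nat' : ∀ x, p.writesNat x = false → m'.nat x = m.nat x
  natArr' : ∀ a, p.writesNatArr a = false → m'.natArr a = m.natArr a
  realArr' : ∀ a, p.writesRealArr a = false → m'.realArr a = m.realArr a

/-- Which variables a concrete program writes can be read off its text, so `decide` discharges the
side condition. The same holds for arrays. -/
theorem Frame.nat {p : Program} {m m' : Memory} (f : Frame p m m') (x : ℕ)
    (h : p.writesNat x = false := by decide) : m'.nat x = m.nat x := f.nat' x h

theorem Frame.natArr {p : Program} {m m' : Memory} (f : Frame p m m') (x : ℕ)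
    (h : p.writesNatArr x = false := by decide) : m'.natArr x = m.natArr x := f.natArr' x h

theorem Frame.realArr {p : Program} {m m' : Memory} (f : Frame p m m') (x : ℕ)
    (h : p.writesRealArr x = false := by decide) : m'.realArr x = m.realArr x := f.realArr' x h

theorem Frame.refl (p : Program) (m : Memory) : Frame p m m :=
  ⟨fun _ _ => rfl, fun _ _ => rfl, fun _ _ => rfl⟩

theorem Frame.trans {p : Program} {m m' m'' : Memory} (h : Frame p m m') (h' : Frame p m' m'') :
    Frame p m m'' :=
  ⟨fun x hx => (h'.nat' x hx).trans (h.nat' x hx),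
   fun x hx => (h'.natArr' x hx).trans (h.natArr' x hx),
   fun x hx => (h'.realArr' x hx).trans (h.realArr' x hx)⟩

theorem Frame.weaken {p r : Program} {m m' : Memory} (h : Frame p m m')
    (h1 : ∀ x, r.writesNat x = false → p.writesNat x = false)
    (h2 : ∀ x, r.writesNatArr x = false → p.writesNatArr x = false)
    (h3 : ∀ x, r.writesRealArr x = false → p.writesRealArr x = false) : Frame r m m' :=
  ⟨fun x hx => h.nat' x (h1 x hx), fun x hx => h.natArr' x (h2 x hx),
   fun x hx => h.realArr' x (h3 x hx)⟩

/-- Thanks to this, a specification needs to mention only what its program changes; `HaltsWith.seq`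
and `HaltsWith.mono` hand the frame on for free. -/
theorem Runs.frame {p : Program} {m m' : Memory} {t : ℕ} (h : Runs p m t m') : Frame p m m' := by
  induction h with
  | nop | loop_false => exact Frame.refl _ _
  | setNat m x e =>
    refine ⟨fun y hy => ?_, fun _ _ => rfl, fun _ _ => rfl⟩
    have : y ≠ x := by rintro rfl; simp [Program.writesNat] at hy
    simp [this]
  | storeNat m a i e =>
    refine ⟨fun _ _ => rfl, fun b hb => ?_, fun _ _ => rfl⟩
    have : b ≠ a := by rintro rfl; simp [Program.writesNatArr] at hb
    simp [Memory.storeNat, this]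
  | storeReal m a i e =>
    refine ⟨fun _ _ => rfl, fun _ _ => rfl, fun b hb => ?_⟩
    have : b ≠ a := by rintro rfl; simp [Program.writesRealArr] at hb
    simp [Memory.storeReal, this]
  | seq _ _ ih ih' =>
    refine (ih.weaken ?_ ?_ ?_).trans (ih'.weaken ?_ ?_ ?_) <;> intro x hx <;>
      simp_all [Program.writesNat, Program.writesNatArr, Program.writesRealArr]
  | cond_true _ _ ih =>
    refine ih.weaken ?_ ?_ ?_ <;> intro x hx <;>
      simp_all [Program.writesNat, Program.writesNatArr, Program.writesRealArr]
  | cond_false _ _ ih =>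
    refine ih.weaken ?_ ?_ ?_ <;> intro x hx <;>
      simp_all [Program.writesNat, Program.writesNatArr, Program.writesRealArr]
  | loop_true _ _ _ ih ih' =>
    exact Frame.trans (ih.weaken (r := .loop _ _) (fun _ h => h) (fun _ h => h) (fun _ h => h)) ih'

/-- Started in `m`, the program `p` halts, and its running time and final memory satisfy `Q`. -/
def HaltsWith (p : Program) (m : Memory) (Q : ℕ → Memory → Prop) : Prop :=
  ∃ t m', Runs p m t m' ∧ Q t m'

/-- Started in `m`, the program `p` halts within time `T` in a memory that satisfies `Q`. -/
def Halts (p : Program) (m : Memory) (T : ℕ) (Q : Memory → Prop) : Prop :=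
  HaltsWith p m fun t m' => t ≤ T ∧ Q m'

theorem HaltsWith.mono {p : Program} {m : Memory} {Q Q' : ℕ → Memory → Prop}
    (h : HaltsWith p m Q) (hQ : ∀ t m', Frame p m m' → Q t m' → Q' t m') : HaltsWith p m Q' := by
  obtain ⟨t, m', hr, hq⟩ := h
  exact ⟨t, m', hr, hQ t m' hr.frame hq⟩

theorem HaltsWith.seq {p r : Program} {m : Memory} {Q R : ℕ → Memory → Prop}
    (h : HaltsWith p m Q)
    (h' : ∀ t m', Frame p m m' → Q t m' → HaltsWith r m' fun t' => R (t + t')) :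
    HaltsWith (.seq p r) m R := by
  obtain ⟨t, m', hr, hq⟩ := h
  obtain ⟨t', m'', hr', hq'⟩ := h' t m' hr.frame hq
  exact ⟨_, m'', hr.seq hr', hq'⟩

theorem Halts.mono {p : Program} {m : Memory} {T T' : ℕ} {Q Q' : Memory → Prop}
    (h : Halts p m T Q) (hT : T ≤ T') (hQ : ∀ m', Frame p m m' → Q m' → Q' m') :
    Halts p m T' Q' :=
  HaltsWith.mono h fun _ m' f ⟨h1, h2⟩ => ⟨h1.trans hT, hQ m' f h2⟩

theorem Halts.seq {p r : Program} {m : Memory} {T T' : ℕ} {Q R : Memory → Prop}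
    (h : Halts p m T Q) (h' : ∀ m', Frame p m m' → Q m' → Halts r m' T' R) :
    Halts (.seq p r) m (T + T') R :=
  HaltsWith.seq h fun _ m' f ⟨h1, h2⟩ =>
    HaltsWith.mono (h' m' f h2) fun _ _ _ ⟨h3, h4⟩ => ⟨Nat.add_le_add h1 h3, h4⟩

/-- The program contains no loop. -/
def Program.loopFree : Program → Bool
  | .seq p r => p.loopFree && r.loopFree
  | .cond _ p r => p.loopFree && r.loopFree
  | .loop _ _ => false
  | _ => true

open Classical in
/-- The memory after a program without loops. -/
noncomputable def Program.exec : Program → Memory → Memory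
  | .nop, m => m
  | .setNat x e, m => m.setNat x (e.eval m)
  | .storeNat a i e, m => m.storeNat a (i.eval m) (e.eval m)
  | .storeReal a i e, m => m.storeReal a (i.eval m) (e.eval m)
  | .seq p r, m => r.exec (p.exec m)
  | .cond b p r, m => if b.Holds m then p.exec m else r.exec m
  | .loop _ _, m => m

/-- An upper bound for the running time of a program without loops. -/
def Program.cost : Program → ℕ
  | .nop => 1
  | .setNat _ e => e.size + 1
  | .storeNat _ i e => i.size + e.size + 1
  | .storeReal _ i e => i.size + e.size + 1
  | .seq p r => p.cost + r.cost
  | .cond b p r => b.size + max p.cost r.cost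
  | .loop _ _ => 0

attribute [simp] Program.exec

/-- Straight-line blocks are verified by computing `exec` with `simp` and `cost` with `decide`. A
conditional is charged its dearer branch, so `cost` is only an upper bound. -/
theorem halts_of_loopFree (p : Program) (m : Memory) (h : p.loopFree = true := by decide) :
    Halts p m p.cost (· = p.exec m) := by
  induction p generalizing m with
  | nop => exact ⟨_, _, Runs.nop m, le_rfl, rfl⟩
  | setNat x e => exact ⟨_, _, Runs.setNat m x e, le_rfl, rfl⟩
  | storeNat a i e => exact ⟨_, _, Runs.storeNat m a i e, le_rfl, rfl⟩
  | storeReal a i e => exact ⟨_, _, Runs.storeReal m a i e, le_rfl, rfl⟩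
  | seq p r ih ih' =>
    simp only [Program.loopFree, Bool.and_eq_true] at h
    refine (ih m h.1).seq fun m' _ hm' => ?_
    subst hm'
    exact ih' _ h.2
  | cond b p r ih ih' =>
    simp only [Program.loopFree, Bool.and_eq_true] at h
    by_cases hb : b.Holds m
    · obtain ⟨t, m', hr, ht, hm⟩ := ih m h.1
      refine ⟨_, m', Runs.cond_true hb hr, ?_, ?_⟩
      · simp only [Program.cost]; omega
      · rw [hm, Program.exec, if_pos hb]
    · obtain ⟨t, m', hr, ht, hm⟩ := ih' m h.2
      refine ⟨_, m', Runs.cond_false hb hr, ?_, ?_⟩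
      · simp only [Program.cost]; omega
      · rw [hm, Program.exec, if_neg hb]
  | loop => simp [Program.loopFree] at h

theorem Halts.of_exec {p : Program} {m : Memory} {T : ℕ} {Q : Memory → Prop} (hQ : Q (p.exec m))
    (hT : p.cost ≤ T) (h : p.loopFree = true := by decide) : Halts p m T Q :=
  (halts_of_loopFree p m h).mono hT fun _ _ e => e ▸ hQ

theorem HaltsWith.cond {b : Test} {p r : Program} {m : Memory} {Q : ℕ → Memory → Prop}
    (h : b.Holds m → HaltsWith p m fun t => Q (b.size + t))
    (h' : ¬ b.Holds m → HaltsWith r m fun t => Q (b.size + t)) : HaltsWith (.cond b p r) m Q := by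
  by_cases hb : b.Holds m
  · obtain ⟨t, m', hr, hq⟩ := h hb
    exact ⟨_, m', Runs.cond_true hb hr, hq⟩
  · obtain ⟨t, m', hr, hq⟩ := h' hb
    exact ⟨_, m', Runs.cond_false hb hr, hq⟩

theorem Halts.cond {b : Test} {p r : Program} {m : Memory} {T : ℕ} {Q : Memory → Prop}
    (h : b.Holds m → Halts p m T Q) (h' : ¬ b.Holds m → Halts r m T Q) :
    Halts (.cond b p r) m (b.size + T) Q :=
  HaltsWith.cond (fun hb => HaltsWith.mono (h hb) fun _ _ _ h => ⟨by omega, h.2⟩)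
    (fun hb => HaltsWith.mono (h' hb) fun _ _ _ h => ⟨by omega, h.2⟩)

/-- For `x` from `0` to `y - 1` do `p`. -/
def forLoop (x y : ℕ) (p : Program) : Program :=
  .seq (.setNat x (.const 0)) (.loop (.natLt (.var x) (.var y))
    (.seq p (.setNat x (.add (.var x) (.const 1)))))

/-- The invariant also sees the time spent in the bodies so far, which allows amortised bounds when
rounds differ in cost. The loop itself costs 3 for each test and 4 for each increment, hence 7 per
round; the initial assignment (2) and the last, failing test (3) make up the 5. -/
theorem HaltsWith.forLoop {x y : ℕ} {p : Program} {m : Memory} (I : ℕ → ℕ → Memory → Prop)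
    (hxy : x ≠ y) (hx : p.writesNat x = false) (hy : p.writesNat y = false)
    (h0 : I 0 0 (m.setNat x 0))
    (step : ∀ i < m.nat y, ∀ t m', Frame (PageRankGame.forLoop x y p) m m' → m'.nat x = i →
      I i t m' → HaltsWith p m' fun t' m'' => Frame p m' m'' → m''.nat x = i →
        I (i + 1) (t + t') (m''.setNat x (i + 1))) :
    HaltsWith (PageRankGame.forLoop x y p) m fun t m' =>
      ∃ t', t = t' + m.nat y * 7 + 5 ∧ I (m.nat y) t' m' := by
  obtain ⟨N, hN⟩ : ∃ N, m.nat y = N := ⟨_, rfl⟩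
  rw [hN] at step ⊢
  have key : ∀ d i t m', i + d = N → Frame (PageRankGame.forLoop x y p) m m' → m'.nat x = i →
      I i t m' → HaltsWith (.loop (.natLt (.var x) (.var y))
        (.seq p (.setNat x (.add (.var x) (.const 1))))) m' fun t' m'' =>
          ∃ t'', t + t' = t'' + d * 7 + 3 ∧ I N t'' m'' := by
    -- Induction on the number `d` of rounds still to go; 3 is the failing test.
    intro d
    induction d with
    | zero =>
      intro i t m' hi f hxi hI
      have hyN : m'.nat y = N := by
        rw [f.nat' y (by simp [PageRankGame.forLoop, Program.writesNat, hxy, hy]), hN]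
      refine ⟨_, _, Runs.loop_false (by simp [hxi, hyN]; omega), t, ?_, ?_⟩
      · simp [Test.size, NatExpr.size]
      · have : i = N := by omega
        rwa [← this]
    | succ d ih =>
      intro i t m' hi f hxi hI
      have hyN : m'.nat y = N := by
        rw [f.nat' y (by simp [PageRankGame.forLoop, Program.writesNat, hxy, hy]), hN]
      obtain ⟨t', m'', hr, hq⟩ := step i (by omega) t m' f hxi hI
      have hx' : m''.nat x = i := by rw [hr.frame.nat' x hx, hxi]
      have hr' := Runs.setNat m'' x (.add (.var x) (.const 1))
      have e : m''.setNat x (NatExpr.eval m'' (.add (.var x) (.const 1)))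
          = m''.setNat x (i + 1) := by simp [hx']
      rw [e] at hr'
      have f' : Frame (PageRankGame.forLoop x y p) m (m''.setNat x (i + 1)) := by
        refine f.trans ((hr.seq hr').frame.weaken ?_ ?_ ?_) <;> intro z hz <;>
          simp_all [PageRankGame.forLoop, Program.writesNat, Program.writesNatArr,
            Program.writesRealArr]
      obtain ⟨t₂, m₂, hr₂, t₃, h₃, hI₃⟩ := ih (i + 1) (t + t') _ (by omega) f' (by simp)
        (hq hr.frame hx')
      refine ⟨_, _, Runs.loop_true (by simp [hxi, hyN]; omega) (hr.seq hr') hr₂, t₃, ?_, hI₃⟩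
      simp only [Test.size, NatExpr.size]
      omega
  obtain ⟨t, m', hr, t', ht, hI⟩ := key N 0 0 (m.setNat x 0) (by omega)
    (by
      refine (Runs.setNat m x (.const 0)).frame.weaken ?_ ?_ ?_ <;> intro z hz <;>
          simp_all [PageRankGame.forLoop, Program.writesNat, Program.writesNatArr,
            Program.writesRealArr]) (by simp) h0
  refine ⟨_, m', (Runs.setNat m x (.const 0)).seq hr, t', ?_, hI⟩
  simp only [NatExpr.size]
  omega

theorem Halts.forLoop {x y : ℕ} {p : Program} {m : Memory} {T N : ℕ} (I : ℕ → Memory → Prop)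
    (hN : m.nat y = N) (h0 : I 0 (m.setNat x 0))
    (step : ∀ i < N, ∀ m', Frame (PageRankGame.forLoop x y p) m m' → m'.nat x = i →
      I i m' → Halts p m' T fun m'' => Frame p m' m'' → m''.nat x = i →
        I (i + 1) (m''.setNat x (i + 1)))
    (hxy : x ≠ y := by decide) (hx : p.writesNat x = false := by decide)
    (hy : p.writesNat y = false := by decide) :
    Halts (PageRankGame.forLoop x y p) m (N * (T + 7) + 5) (I N) := by
  subst hN
  refine HaltsWith.mono (HaltsWith.forLoop (fun i t m' => t ≤ i * T ∧ I i m') hxy hx hy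
    ⟨by simp, h0⟩ ?_) ?_
  · rintro i hi t m' f hxi ⟨ht, hI⟩
    refine HaltsWith.mono (step i hi m' f hxi hI) fun t' m'' f' ⟨ht', hI'⟩ f'' hx'' =>
      ⟨?_, hI' f'' hx''⟩
    rw [add_mul]; omega
  · rintro t m' f ⟨t', rfl, ht', hI⟩
    refine ⟨?_, hI⟩
    rw [mul_add]; omega

end PageRankGame

namespace PageRankGame

/-! # Discounted hitting probabilities -/

/-! ### Linear systems with row sums below one -/

section Contraction

variable {V : Type*}

/-- Maximum principle: at a point where `|d|` is largest, the equation gives `|d| ≤ β |d|`. -/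
theorem eq_zero_of_contraction {C : Finset V} {P : V → V → ℝ} {β : ℝ} (hβ : β < 1)
    (hP : ∀ u w, 0 ≤ P u w) (hs : ∀ u ∈ C, ∑ w ∈ C, P u w ≤ β) {d : V → ℝ}
    (hd : ∀ u ∈ C, d u = ∑ w ∈ C, P u w * d w) : ∀ u ∈ C, d u = 0 := by
  intro u hu
  obtain ⟨z, hz, hmax⟩ := C.exists_max_image (fun u => |d u|) ⟨u, hu⟩
  have h1 : |d z| ≤ β * |d z| := by
    calc |d z| = |∑ w ∈ C, P z w * d w| := by rw [← hd z hz]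
      _ ≤ ∑ w ∈ C, |P z w * d w| := Finset.abs_sum_le_sum_abs _ _
      _ ≤ ∑ w ∈ C, P z w * |d z| := by
        refine Finset.sum_le_sum fun w hw => ?_
        rw [abs_mul, abs_of_nonneg (hP z w)]
        exact mul_le_mul_of_nonneg_left (hmax w hw) (hP z w)
      _ = (∑ w ∈ C, P z w) * |d z| := by rw [Finset.sum_mul]
      _ ≤ β * |d z| := mul_le_mul_of_nonneg_right (hs z hz) (abs_nonneg _)
  have h2 : |d z| = 0 := by
    have := abs_nonneg (d z)
    nlinarith
  have h3 := hmax u hu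
  simp only [h2] at h3
  exact abs_nonpos_iff.1 h3

/-- The map `x ↦ x - P x` on functions on `C` is injective by `eq_zero_of_contraction`, hence
surjective in finite dimension. -/
theorem exists_of_contraction (C : Finset V) {P : V → V → ℝ} {β : ℝ} (hβ : β < 1)
    (hP : ∀ u w, 0 ≤ P u w) (hs : ∀ u ∈ C, ∑ w ∈ C, P u w ≤ β) (b : V → ℝ) :
    ∃ x : V → ℝ, ∀ u ∈ C, x u = ∑ w ∈ C, P u w * x w + b u := by
  classical
  let L : (C → ℝ) →ₗ[ℝ] (C → ℝ) :=
    { toFun := fun x u => x u - ∑ w : C, P u w * x w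
      map_add' := by
        intro x y
        funext w
        simp only [Pi.add_apply, mul_add, Finset.sum_add_distrib]
        ring
      map_smul' := by
        intro c x
        funext w
        simp only [Pi.smul_apply, smul_eq_mul, RingHom.id_apply, mul_sub, Finset.mul_sum]
        congr 1
        exact Finset.sum_congr rfl fun _ _ => by ring }
  have hL : ∀ x u, L x u = x u - ∑ w : C, P u w * x w := fun _ _ => rfl
  have ext : ∀ (x : C → ℝ) (u : V), ∑ w ∈ C, P u w * (if h : w ∈ C then x ⟨w, h⟩ else 0)
      = ∑ w : C, P u w * x w := by
    intro x u
    rw [← Finset.sum_coe_sort C]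
    exact Finset.sum_congr rfl fun w _ => by simp
  have hinj : Function.Injective L := by
    rw [← LinearMap.ker_eq_bot, LinearMap.ker_eq_bot']
    intro x hx
    have := eq_zero_of_contraction (C := C) hβ hP hs
      (d := fun w => if h : w ∈ C then x ⟨w, h⟩ else 0) (by
        intro u hu
        have h1 := congrFun hx ⟨u, hu⟩
        rw [hL] at h1
        simp only [Pi.zero_apply] at h1
        rw [ext]
        simp only [hu, dif_pos]
        linarith)
    funext u
    simpa using this u u.2
  obtain ⟨x, hx⟩ := LinearMap.injective_iff_surjective.1 hinj (fun u => b u)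
  refine ⟨fun w => if h : w ∈ C then x ⟨w, h⟩ else 0, fun u hu => ?_⟩
  have h1 := congrFun hx ⟨u, hu⟩
  rw [hL] at h1
  rw [ext]
  simp only [hu, dif_pos]
  linarith

/-- If the maximum of `x` exceeded 1, then `b ≤ b * max x`, and the equation at the maximum would
give `max x ≤ β * max x`. -/
theorem le_one_of_contraction {C : Finset V} {P : V → V → ℝ} {b : V → ℝ} {β : ℝ} (hβ : β < 1)
    (hP : ∀ u w, 0 ≤ P u w) (hb : ∀ u, 0 ≤ b u) (hs : ∀ u ∈ C, ∑ w ∈ C, P u w + b u ≤ β)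
    {x : V → ℝ} (hx : ∀ u ∈ C, x u = ∑ w ∈ C, P u w * x w + b u) : ∀ u ∈ C, x u ≤ 1 := by
  intro u hu
  obtain ⟨z, hz, hmax⟩ := C.exists_max_image x ⟨u, hu⟩
  refine (hmax u hu).trans ?_
  by_contra! h
  have h1 : x z ≤ β * x z := by
    calc x z = ∑ w ∈ C, P z w * x w + b z := hx z hz
      _ ≤ ∑ w ∈ C, P z w * x z + b z * x z := by
        refine add_le_add (Finset.sum_le_sum fun w hw => ?_) ?_
        · exact mul_le_mul_of_nonneg_left (hmax w hw) (hP z w)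
        · nlinarith [hb z]
      _ = (∑ w ∈ C, P z w + b z) * x z := by rw [add_mul, Finset.sum_mul]
      _ ≤ β * x z := mul_le_mul_of_nonneg_right (hs z hz) (by linarith)
  nlinarith

end Contraction

/-! ### Hitting probabilities of a player and their additivity over components -/

section Hitting

variable {V : Type*} [DecidableEq V] (A : V → V → Prop) (β : ℝ) (C S : Finset V)

open Classical in
/-- The number of links of `u` in the graph consisting of the part of `A` inside `C` and of one
more node that is linked to the nodes in `S`. -/
noncomputable def linkCount (u : V) : ℕ :=
  (C.filter (A u)).card + if u ∈ S then 1 else 0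

open Classical in
/-- The discounted probability of a step from `u` to `w`. -/
noncomputable def moveProb (u w : V) : ℝ :=
  if A u w then β / linkCount A C S u else 0

/-- The discounted probability of a step from `u` to the additional node. -/
noncomputable def exitProb (u : V) : ℝ :=
  if u ∈ S then β / linkCount A C S u else 0

variable {A β C S}

theorem moveProb_nonneg (h0 : 0 ≤ β) (u w : V) : 0 ≤ moveProb A β C S u w := by
  unfold moveProb
  split_ifs <;> positivity

theorem exitProb_nonneg (h0 : 0 ≤ β) (u : V) : 0 ≤ exitProb A β C S u := by
  unfold exitProb
  split_ifs <;> positivity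

theorem sum_moveProb_add_exitProb_le (h0 : 0 ≤ β) (u : V) :
    ∑ w ∈ C, moveProb A β C S u w + exitProb A β C S u ≤ β := by
  classical
  have h : ∑ w ∈ C, moveProb A β C S u w + exitProb A β C S u
      = linkCount A C S u * (β / linkCount A C S u) := by
    unfold moveProb exitProb
    rw [← Finset.sum_filter, Finset.sum_const, nsmul_eq_mul]
    have h2 : (if u ∈ S then β / (linkCount A C S u : ℝ) else 0)
        = ((if u ∈ S then 1 else 0 : ℕ) : ℝ) * (β / linkCount A C S u) := by
      split_ifs <;> simp
    rw [h2, ← add_mul, ← Nat.cast_add]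
    rfl
  rw [h]
  rcases eq_or_ne (linkCount A C S u) 0 with h3 | h3
  · simpa [h3] using h0
  · rw [mul_div_cancel₀ _ (by exact_mod_cast h3)]

theorem sum_moveProb_le (h0 : 0 ≤ β) (u : V) : ∑ w ∈ C, moveProb A β C S u w ≤ β :=
  (le_add_of_nonneg_right (exitProb_nonneg h0 u)).trans (sum_moveProb_add_exitProb_le h0 u)

variable (A β C S) in
/-- `x` satisfies the equations of the discounted probabilities of hitting the additional node. -/
def IsHitting (x : V → ℝ) : Prop :=
  ∀ u ∈ C, x u = ∑ w ∈ C, moveProb A β C S u w * x w + exitProb A β C S u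

theorem IsHitting.unique (h0 : 0 ≤ β) (h1 : β < 1) {x y : V → ℝ} (hx : IsHitting A β C S x)
    (hy : IsHitting A β C S y) : ∀ u ∈ C, x u = y u := by
  intro u hu
  have := eq_zero_of_contraction (C := C) (d := fun u => x u - y u) h1
    (moveProb_nonneg (A := A) (C := C) (S := S) h0)
    (fun u _ => sum_moveProb_le h0 u) (by
      intro u hu
      simp only [mul_sub, Finset.sum_sub_distrib]
      rw [hx u hu, hy u hu]
      ring) u hu
  linarith

theorem exists_isHitting (h0 : 0 ≤ β) (h1 : β < 1) : ∃ x, IsHitting A β C S x :=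
  exists_of_contraction C h1 (moveProb_nonneg h0) (fun u _ => sum_moveProb_le h0 u) _

theorem IsHitting.le_one (h0 : 0 ≤ β) (h1 : β < 1) {x : V → ℝ} (hx : IsHitting A β C S x) :
    ∀ u ∈ C, x u ≤ 1 :=
  le_one_of_contraction h1 (moveProb_nonneg h0) (exitProb_nonneg h0)
    (fun u _ => sum_moveProb_add_exitProb_le h0 u) hx

variable (A β C S) in
open Classical in
/-- The discounted probability of hitting the additional node from `u`; it is `0` outside `C`. -/
noncomputable def hit (u : V) : ℝ :=
  if h : u ∈ C ∧ ∃ x, IsHitting A β C S x then h.2.choose u else 0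

theorem hit_of_notMem {u : V} (hu : u ∉ C) : hit A β C S u = 0 := by
  unfold hit
  rw [dif_neg]
  exact fun h => hu h.1

theorem hit_isHitting (h0 : 0 ≤ β) (h1 : β < 1) : IsHitting A β C S (hit A β C S) := by
  have h : ∃ x, IsHitting A β C S x := exists_isHitting h0 h1
  have e : ∀ u ∈ C, hit A β C S u = h.choose u := by
    intro u hu
    unfold hit
    rw [dif_pos ⟨hu, h⟩]
  intro u hu
  rw [e u hu, h.choose_spec u hu]
  congr 1
  exact Finset.sum_congr rfl fun w hw => by rw [e w hw]

/-- Uniqueness in the form in which it is used: a candidate that vanishes outside `C` only has to be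
checked against the equations. -/
theorem hit_eq (h0 : 0 ≤ β) (h1 : β < 1) {x : V → ℝ} (hx : IsHitting A β C S x)
    (hx0 : ∀ u ∉ C, x u = 0) : hit A β C S = x := by
  funext u
  by_cases hu : u ∈ C
  · exact (hit_isHitting h0 h1).unique h0 h1 hx u hu
  · rw [hit_of_notMem hu, hx0 u hu]

/-- `U` is a part of `W` without links to the rest of `W`. -/
structure IsSeparated (A : V → V → Prop) (W U : Finset V) : Prop where
  subset : U ⊆ W
  no_link : ∀ u ∈ U, ∀ w ∈ W, w ∉ U → ¬ A u w ∧ ¬ A w u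

theorem IsSeparated.filter_eq {W U : Finset V} (h : IsSeparated A W U) {u : V} (hu : u ∈ U)
    [DecidablePred (A u)] : W.filter (A u) = U.filter (A u) := by
  ext w
  simp only [Finset.mem_filter]
  constructor
  · rintro ⟨hw, hA⟩
    refine ⟨?_, hA⟩
    by_contra hwU
    exact (h.no_link u hu w hw hwU).1 hA
  · rintro ⟨hw, hA⟩
    exact ⟨h.subset hw, hA⟩

/-- The hitting probabilities of separated parts combine. -/
theorem hit_union (h0 : 0 ≤ β) (h1 : β < 1) {W U₁ U₂ E₁ E₂ : Finset V}
    (hU₁ : IsSeparated A W U₁) (hU₂ : IsSeparated A W U₂) (hd : Disjoint U₁ U₂) (hE₁ : E₁ ⊆ U₁)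
    (hE₂ : E₂ ⊆ U₂) :
    hit A β W (E₁ ∪ E₂) = fun u => hit A β U₁ E₁ u + hit A β U₂ E₂ u := by
  classical
  refine hit_eq h0 h1 ?_ ?_
  -- Inside a separated part, link counts and exits do not see the other part, and the other summand
  -- vanishes. The statement is symmetric so that it serves for both parts.
  · have aux : ∀ {U U' E E' : Finset V}, IsSeparated A W U → Disjoint U U' → E ⊆ U → E' ⊆ U' →
        ∀ u ∈ U, hit A β U E u + hit A β U' E' u =
          ∑ w ∈ W, moveProb A β W (E ∪ E') u w * (hit A β U E w + hit A β U' E' w)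
            + exitProb A β W (E ∪ E') u := by
      intro U U' E E' hU hd hE hE' u hu
      have hu' : u ∉ U' := Finset.disjoint_left.1 hd hu
      have hc : linkCount A W (E ∪ E') u = linkCount A U E u := by
        unfold linkCount
        rw [hU.filter_eq hu]
        have : u ∉ E' := fun h => hu' (hE' h)
        simp [this]
      rw [hit_of_notMem hu', add_zero, hit_isHitting h0 h1 u hu]
      congr 1
      · rw [← Finset.sum_subset hU.subset]
        · refine Finset.sum_congr rfl fun w hw => ?_
          rw [hit_of_notMem (Finset.disjoint_left.1 hd hw), add_zero]
          unfold moveProb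
          rw [hc]
        · intro w hw hwU
          unfold moveProb
          rw [if_neg (hU.no_link u hu w hw hwU).1, zero_mul]
      · unfold exitProb
        rw [hc]
        have : u ∉ E' := fun h => hu' (hE' h)
        simp [this]
    intro u hu
    beta_reduce
    by_cases hu1 : u ∈ U₁
    · exact aux hU₁ hd hE₁ hE₂ u hu1
    by_cases hu2 : u ∈ U₂
    · have := aux hU₂ hd.symm hE₂ hE₁ u hu2
      rw [add_comm, this, Finset.union_comm]
      congr 1
      exact Finset.sum_congr rfl fun w _ => by rw [add_comm (hit A β U₂ E₂ w)]
    -- A node of `W` outside both parts has no link into either of them, so both sides are 0.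
    · rw [hit_of_notMem hu1, hit_of_notMem hu2, Finset.sum_eq_zero]
      · unfold exitProb
        rw [if_neg, add_zero]
        rw [Finset.mem_union]
        rintro (h | h)
        · exact hu1 (hE₁ h)
        · exact hu2 (hE₂ h)
      · intro w hw
        unfold moveProb
        split_ifs with hA
        · have hw1 : w ∉ U₁ := fun h => (hU₁.no_link w h u hu hu1).2 hA
          have hw2 : w ∉ U₂ := fun h => (hU₂.no_link w h u hu hu2).2 hA
          rw [hit_of_notMem hw1, hit_of_notMem hw2]
          simp
        · simp
  · intro u hu
    rw [hit_of_notMem fun h => hu (hU₁.subset h), hit_of_notMem fun h => hu (hU₂.subset h),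
      add_zero]

theorem hit_empty (h0 : 0 ≤ β) (h1 : β < 1) : hit A β C ∅ = fun _ => 0 := by
  refine hit_eq h0 h1 ?_ fun _ _ => rfl
  intro u _
  simp [exitProb]

theorem hit_of_isSeparated (h0 : 0 ≤ β) (h1 : β < 1) {W U E : Finset V}
    (hU : IsSeparated A W U) (hE : E ⊆ U) : hit A β W E = hit A β U E := by
  have h := hit_union h0 h1 hU (U₂ := ∅) (E₂ := ∅)
    ⟨Finset.empty_subset _, by simp⟩ (Finset.disjoint_empty_right _) hE (Finset.empty_subset _)
  rw [Finset.union_empty] at h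
  rw [h]
  funext u
  rw [hit_of_notMem (C := ∅) (Finset.notMem_empty u), add_zero]

variable (A β) in
/-- The weight that enters the additional node from all nodes but itself. -/
noncomputable def entryMass (q : V → ℝ) (W E : Finset V) : ℝ :=
  ∑ u ∈ W, q u * hit A β W E u

variable (A β) in
/-- The sum of the return probabilities to the additional node over the nodes in `E`. -/
noncomputable def returnMass (W E : Finset V) : ℝ :=
  ∑ u ∈ E, hit A β W E u

theorem entryMass_union (h0 : 0 ≤ β) (h1 : β < 1) (q : V → ℝ) {W U₁ U₂ E₁ E₂ : Finset V}
    (hU₁ : IsSeparated A W U₁) (hU₂ : IsSeparated A W U₂) (hd : Disjoint U₁ U₂) (hE₁ : E₁ ⊆ U₁)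
    (hE₂ : E₂ ⊆ U₂) :
    entryMass A β q W (E₁ ∪ E₂) = entryMass A β q W E₁ + entryMass A β q W E₂ := by
  unfold entryMass
  rw [hit_union h0 h1 hU₁ hU₂ hd hE₁ hE₂, hit_of_isSeparated h0 h1 hU₁ hE₁,
    hit_of_isSeparated h0 h1 hU₂ hE₂, ← Finset.sum_add_distrib]
  exact Finset.sum_congr rfl fun u _ => by ring

theorem returnMass_union (h0 : 0 ≤ β) (h1 : β < 1) {W U₁ U₂ E₁ E₂ : Finset V}
    (hU₁ : IsSeparated A W U₁) (hU₂ : IsSeparated A W U₂) (hd : Disjoint U₁ U₂) (hE₁ : E₁ ⊆ U₁)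
    (hE₂ : E₂ ⊆ U₂) :
    returnMass A β W (E₁ ∪ E₂) = returnMass A β W E₁ + returnMass A β W E₂ := by
  unfold returnMass
  rw [hit_union h0 h1 hU₁ hU₂ hd hE₁ hE₂, hit_of_isSeparated h0 h1 hU₁ hE₁,
    hit_of_isSeparated h0 h1 hU₂ hE₂, Finset.sum_union (Finset.disjoint_of_subset_left hE₁
      (Finset.disjoint_of_subset_right hE₂ hd))]
  congr 1
  · refine Finset.sum_congr rfl fun u hu => ?_
    rw [hit_of_notMem (C := U₂) (Finset.disjoint_left.1 hd (hE₁ hu)), add_zero]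
  · refine Finset.sum_congr rfl fun u hu => ?_
    rw [hit_of_notMem (C := U₁) (Finset.disjoint_right.1 hd (hE₂ hu)), zero_add]

theorem entryMass_of_isSeparated (h0 : 0 ≤ β) (h1 : β < 1) (q : V → ℝ) {W U E : Finset V}
    (hU : IsSeparated A W U) (hE : E ⊆ U) :
    entryMass A β q W E = entryMass A β q U E := by
  unfold entryMass
  rw [hit_of_isSeparated h0 h1 hU hE, Finset.sum_subset hU.subset]
  intro u _ hu
  rw [hit_of_notMem hu, mul_zero]

theorem returnMass_of_isSeparated (h0 : 0 ≤ β) (h1 : β < 1) {W U E : Finset V}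
    (hU : IsSeparated A W U) (hE : E ⊆ U) : returnMass A β W E = returnMass A β U E := by
  unfold returnMass
  rw [hit_of_isSeparated h0 h1 hU hE]

/-- Keeps the denominator `1 - β R / |E|` of the payoff positive. -/
theorem returnMass_le (h0 : 0 ≤ β) (h1 : β < 1) {W E : Finset V} (hE : E ⊆ W) :
    returnMass A β W E ≤ E.card := by
  unfold returnMass
  calc ∑ u ∈ E, hit A β W E u ≤ ∑ u ∈ E, 1 :=
        Finset.sum_le_sum fun u hu => (hit_isHitting h0 h1).le_one h0 h1 u (hE hu)
    _ = E.card := by simp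

/-- Hitting probabilities are invariant under relabelling; this carries them from `Fin n` to the
natural numbers on which the machine works. -/
theorem hit_map {V' : Type*} [DecidableEq V'] (h0 : 0 ≤ β) (h1 : β < 1) (ι : V ↪ V')
    {A' : V' → V' → Prop} (hA : ∀ u w, A' (ι u) (ι w) ↔ A u w) (C S : Finset V) (u : V) :
    hit A' β (C.map ι) (S.map ι) (ι u) = hit A β C S u := by
  classical
  have hc : ∀ u, linkCount A' (C.map ι) (S.map ι) (ι u) = linkCount A C S u := by
    intro u
    unfold linkCount
    rw [Finset.filter_map, Finset.card_map]
    congr 2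
    · congr 1
      ext w
      simp [hA]
    · simp
  have h : hit A β C S = fun u => hit A' β (C.map ι) (S.map ι) (ι u) := by
    refine hit_eq h0 h1 ?_ ?_
    · intro u hu
      beta_reduce
      rw [hit_isHitting h0 h1 (ι u) (Finset.mem_map_of_mem ι hu), Finset.sum_map]
      congr 1
      · refine Finset.sum_congr rfl fun w _ => ?_
        unfold moveProb
        rw [hc]
        simp [hA]
      · unfold exitProb
        rw [hc]
        simp
    · intro u hu
      exact hit_of_notMem (by simpa using hu)
  rw [h]

end Hitting

end PageRankGame

namespace PageRankGame

/-! # The payoff of a strategy -/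

section Payoff

variable {V : Type*}

theorem sum_step_mul [Fintype V] [DecidableEq V] (G : SimpleGraph V) (u : V) (f : V → ℝ)
    (N : Finset V) (hN : ∀ w, w ∈ N ↔ G.Adj u w) :
    ∑ w, step G u w * f w = if N.card = 0 then f u else (∑ w ∈ N, f w) / N.card := by
  have hc : (G.neighborSet u).ncard = N.card := by
    rw [← Set.ncard_coe_finset]
    congr 1
    ext w
    simp [hN]
  unfold step
  rw [hc]
  split_ifs with h
  · simp
  · classical
    rw [Finset.sum_div, ← Finset.sum_subset (Finset.subset_univ N)]
    · refine Finset.sum_congr rfl fun w hw => ?_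
      rw [if_pos ((hN w).1 hw)]
      ring
    · intro w _ hw
      rw [if_neg fun h => hw ((hN w).2 h), zero_mul]

theorem retain_adj {G : SimpleGraph V} {v : V} {E : Set V} {u w : V} :
    (retain G v E).Adj u w ↔ G.Adj u w ∧ (u = v → w ∈ E) ∧ (w = v → u ∈ E) := by
  unfold retain
  rw [SimpleGraph.deleteEdges_adj]
  simp only [Set.mem_ofPred_eq, Set.mem_sdiff, SimpleGraph.mem_neighborSet, not_exists, not_and]
  constructor
  · rintro ⟨h, h'⟩
    refine ⟨h, ?_, ?_⟩
    · rintro rfl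
      by_contra hw
      exact h' w ⟨h, hw⟩ rfl
    · rintro rfl
      by_contra hw
      exact h' u ⟨h.symm, hw⟩ Sym2.eq_swap
  · rintro ⟨h, h1, h2⟩
    refine ⟨h, ?_⟩
    rintro i ⟨hi, hiE⟩ he
    rw [Sym2.eq_iff] at he
    rcases he with ⟨rfl, rfl⟩ | ⟨rfl, rfl⟩
    · exact hiE (h1 rfl)
    · exact hiE (h2 rfl)

theorem retain_neighborSet (G : SimpleGraph V) (v : V) : retain G v (G.neighborSet v) = G := by
  ext u w
  rw [retain_adj]
  constructor
  · exact fun h => h.1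
  · refine fun h => ⟨h, ?_, ?_⟩
    · rintro rfl
      exact h
    · rintro rfl
      exact h.symm

/-- The PageRank of `v` through the probabilities of returning to `v`. -/
theorem pageRank_mul_eq [Fintype V] [DecidableEq V] (G : SimpleGraph V) {α : ℝ} (h0 : 0 < α) (h1 : α < 1)
    {q : V → ℝ} (hq : IsDistribution q) {v : V} {E : Finset V} (hE : ∀ u ∈ E, G.Adj v u)
    (hne : E.Nonempty) :
    pageRank (retain G v E) α q v
        * (1 - (1 - α) * returnMass G.Adj (1 - α) (Finset.univ.erase v) E / E.card)
      = α * (q v + entryMass G.Adj (1 - α) q (Finset.univ.erase v) E) := by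
  classical
  set H := retain G v (E : Set V) with hH
  set W := Finset.univ.erase v with hW
  set β := 1 - α with hβ
  have hβ0 : 0 ≤ β := by rw [hβ]; linarith
  have hβ1 : β < 1 := by rw [hβ]; linarith
  set f : V → ℝ := fun u => if u = v then 1 else hit G.Adj β W E u with hf
  have hvE : v ∉ E := fun h => (hE v h).ne rfl
  have hEW : E ⊆ W := fun u hu => Finset.mem_erase.2 ⟨fun h => hvE (h ▸ hu), Finset.mem_univ u⟩
  have hfW : ∀ u ∈ W, f u = hit G.Adj β W E u := fun u hu => if_neg (Finset.ne_of_mem_erase hu)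
  have hfv : f v = 1 := if_pos rfl
  -- Away from `v`, `f` is harmonic for the discounted walk on the graph left by the strategy.
  have hstep : ∀ u ∈ W, f u = β * ∑ w, step H u w * f w := by
    intro u hu
    have huv : u ≠ v := Finset.ne_of_mem_erase hu
    set N : Finset V := W.filter (G.Adj u) ∪ if u ∈ E then {v} else ∅ with hN
    have hNd : Disjoint (W.filter (G.Adj u)) (if u ∈ E then {v} else ∅) := by
      split_ifs <;> simp [hW]
    have hcard : N.card = linkCount G.Adj W E u := by
      rw [hN, Finset.card_union_of_disjoint hNd, linkCount]
      split_ifs <;> simp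
    have hsum : ∑ w ∈ N, f w = ∑ w ∈ W with G.Adj u w, f w + if u ∈ E then 1 else 0 := by
      rw [hN, Finset.sum_union hNd]
      congr 1
      split_ifs <;> simp [hfv]
    rw [sum_step_mul H u f N, hfW u hu, hit_isHitting hβ0 hβ1 u hu]
    · have e1 : ∑ w ∈ W, moveProb G.Adj β W E u w * hit G.Adj β W E w + exitProb G.Adj β W E u
          = β / linkCount G.Adj W E u * ∑ w ∈ N, f w := by
        rw [hsum, mul_add, Finset.mul_sum, Finset.sum_filter]
        congr 1
        · refine Finset.sum_congr rfl fun w hw => ?_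
          unfold moveProb
          rw [hfW w hw]
          split_ifs <;> simp
        · unfold exitProb
          split_ifs <;> simp
      rw [e1]
      -- A node without links stays put, so the equation reads `f u = β * f u`. It holds because
      -- `hit` is 0 there: its transition weights are quotients with denominator 0.
      split_ifs with hc
      · rw [hcard] at hc
        rw [hc]
        simp
      · rw [hcard]
        ring
    · intro w
      rw [hH, retain_adj]
      by_cases hwv : w = v
      · subst hwv
        by_cases hu' : u ∈ E
        · simp [hN, hu', (hE u hu').symm, huv]
        · simp [hN, hu', hW]
      · have : w ∉ (if u ∈ E then {v} else ∅ : Finset V) := by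
          split_ifs <;> simp [hwv]
        rw [hN, Finset.mem_union]
        simp [this, hwv, hW, huv]
  have hstepv : ∑ w, step H v w * f w = returnMass G.Adj β W E / E.card := by
    rw [sum_step_mul H v f E, if_neg (Finset.card_ne_zero.2 hne), returnMass,
      Finset.sum_congr rfl fun u hu => hfW u (hEW hu)]
    intro w
    rw [hH, retain_adj]
    constructor
    · intro hw
      exact ⟨hE w hw, fun _ => hw, fun h => absurd (h ▸ hw) hvE⟩
    · exact fun h => h.2.1 rfl
  obtain ⟨⟨_, hsum⟩, hstat⟩ := pageRank_isStationary H h0 h1 hq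
  set π := pageRank H α q with hπ
  have hstat' : ∀ w, π w = α * q w + β * ∑ u, π u * step H u w := by
    intro w
    rw [hstat w]
    have : ∀ u, π u * alphaStep H α q u w = π u * (α * q w) + β * (π u * step H u w) := by
      intro u
      unfold alphaStep
      ring
    simp only [this, Finset.sum_add_distrib, ← Finset.sum_mul, ← Finset.mul_sum, hsum, one_mul]
  -- The stationarity equation paired with `f`, with the transition matrix moved from `π` to `f`.
  have hdual : ∑ w, π w * f w = α * ∑ w, q w * f w + ∑ u, π u * (β * ∑ w, step H u w * f w) := by
    calc ∑ w, π w * f w = ∑ w, (α * q w + β * ∑ u, π u * step H u w) * f w :=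
          Finset.sum_congr rfl fun w _ => by rw [← hstat' w]
      _ = ∑ w, (α * (q w * f w) + ∑ u, π u * (β * (step H u w * f w))) := by
          refine Finset.sum_congr rfl fun w _ => ?_
          rw [add_mul, mul_assoc, mul_assoc, Finset.sum_mul, Finset.mul_sum]
          congr 1
          exact Finset.sum_congr rfl fun u _ => by ring
      _ = _ := by
          rw [Finset.sum_add_distrib, ← Finset.mul_sum, Finset.sum_comm]
          congr 1
          refine Finset.sum_congr rfl fun u _ => ?_
          rw [Finset.mul_sum, Finset.mul_sum]
  rw [← Finset.add_sum_erase _ _ (Finset.mem_univ v), ← hW] at hdual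
  conv at hdual => rhs; rw [← Finset.add_sum_erase _ (fun w => q w * f w) (Finset.mem_univ v),
    ← Finset.add_sum_erase _ (fun u => π u * (β * ∑ w, step H u w * f w)) (Finset.mem_univ v), ← hW]
  -- By harmonicity the terms over `W` become the same sum on both sides; only the contribution of
  -- `v` survives.
  rw [← Finset.sum_congr rfl fun u hu => congrArg (π u * ·) (hstep u hu), hstepv, hfv] at hdual
  have hentry : ∑ w ∈ W, q w * f w = entryMass G.Adj β q W E :=
    Finset.sum_congr rfl fun u hu => by rw [hfW u hu]
  rw [hentry] at hdual
  rw [mul_div_assoc]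
  linarith

/-- A strategy is better than the payoff `ρ` if and only if an expression that is additive over
the components of `G - v` is positive. -/
theorem lt_pageRank_retain_iff [Fintype V] [DecidableEq V] (G : SimpleGraph V) {α : ℝ} (h0 : 0 < α)
    (h1 : α < 1) {q : V → ℝ} (hq : IsDistribution q) {v : V} {E : Finset V}
    (hE : ∀ u ∈ E, G.Adj v u) (hne : E.Nonempty) (ρ : ℝ) :
    ρ < pageRank (retain G v E) α q v ↔
      0 < E.card * (α * q v - ρ) +
        (E.card * α * entryMass G.Adj (1 - α) q (Finset.univ.erase v) E
          + ρ * (1 - α) * returnMass G.Adj (1 - α) (Finset.univ.erase v) E) := by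
  have hs : (0 : ℝ) < E.card := by exact_mod_cast Finset.card_pos.2 hne
  have hEW : E ⊆ Finset.univ.erase v := fun u hu =>
    Finset.mem_erase.2 ⟨fun h => (hE u hu).ne h.symm, Finset.mem_univ u⟩
  have hret : returnMass G.Adj (1 - α) (Finset.univ.erase v) E ≤ E.card :=
    returnMass_le (by linarith) (by linarith) hEW
  have h := pageRank_mul_eq G h0 h1 hq hE hne
  set p := pageRank (retain G v E) α q v
  set R := returnMass G.Adj (1 - α) (Finset.univ.erase v) E
  set Q := entryMass G.Adj (1 - α) q (Finset.univ.erase v) E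
  -- The denominator after multiplication by `|E|`; it is positive as `R ≤ |E|` and `1 - α < 1`.
  have hD : 0 < (E.card : ℝ) - (1 - α) * R := by nlinarith
  have h' : p * (E.card - (1 - α) * R) = E.card * (α * (q v + Q)) := by
    rw [← h]
    field_simp
  constructor
  · intro hlt
    have := mul_lt_mul_of_pos_right hlt hD
    rw [h'] at this
    linarith
  · intro hpos
    refine lt_of_mul_lt_mul_right ?_ hD.le
    rw [h']
    linarith

theorem pageRank_eq_div [Fintype V] [DecidableEq V] (G : SimpleGraph V) {α : ℝ} (h0 : 0 < α)
    (h1 : α < 1) {q : V → ℝ} (hq : IsDistribution q) {v : V} {E : Finset V}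
    (hE : ∀ u, u ∈ E ↔ G.Adj v u) (hne : E.Nonempty) :
    pageRank G α q v = α * (q v + entryMass G.Adj (1 - α) q (Finset.univ.erase v) E)
      / (1 - (1 - α) * returnMass G.Adj (1 - α) (Finset.univ.erase v) E / E.card) := by
  have hs : (0 : ℝ) < E.card := by exact_mod_cast Finset.card_pos.2 hne
  have hEW : E ⊆ Finset.univ.erase v := fun u hu =>
    Finset.mem_erase.2 ⟨fun h => ((hE u).1 hu).ne h.symm, Finset.mem_univ u⟩
  have hret : returnMass G.Adj (1 - α) (Finset.univ.erase v) E ≤ E.card :=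
    returnMass_le (by linarith) (by linarith) hEW
  have h := pageRank_mul_eq G h0 h1 hq (fun u hu => (hE u).1 hu) hne
  -- The current graph is the outcome of the strategy that keeps all links.
  have e : retain G v (E : Set V) = G := by
    rw [show (E : Set V) = G.neighborSet v from Set.ext fun u => by simp [hE],
      retain_neighborSet]
  rw [e] at h
  have hle : returnMass G.Adj (1 - α) (Finset.univ.erase v) E / E.card ≤ 1 :=
    (div_le_one hs).2 hret
  rw [← h, mul_div_cancel_right₀]
  rw [mul_div_assoc]
  nlinarith

end Payoff

end PageRankGame

namespace PageRankGame

/-! # Degrees in biconnected components -/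

section Block

variable {V : Type*} {G : SimpleGraph V}

theorem reachable_induce_of_walk {B : Set V} {u w : V} (p : G.Walk u w)
    (hp : ∀ z ∈ p.support, z ∈ B) :
    (G.induce B).Reachable ⟨u, hp u p.start_mem_support⟩ ⟨w, hp w p.end_mem_support⟩ :=
  ⟨p.induce B hp⟩

theorem preconnected_of_root {B : Set V} {r : V} (hr : r ∈ B)
    (h : ∀ u ∈ B, ∃ p : G.Walk u r, ∀ z ∈ p.support, z ∈ B) : (G.induce B).Preconnected := by
  have h' : ∀ u : B, (G.induce B).Reachable u ⟨r, hr⟩ := by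
    rintro ⟨u, hu⟩
    obtain ⟨p, hp⟩ := h u hu
    exact reachable_induce_of_walk p hp
  exact fun u w => (h' u).trans (h' w).symm

/-- Deleting `w` cuts a path into at most two pieces, and each piece contains an end of the path. -/
theorem exists_walk_to_end {a b : V} (p : G.Walk a b) (hp : p.IsPath) (w : V) :
    ∀ u ∈ p.support, u ≠ w →
      (∃ r : G.Walk u a, ∀ z ∈ r.support, z ∈ p.support ∧ z ≠ w) ∨
      (∃ r : G.Walk u b, ∀ z ∈ r.support, z ∈ p.support ∧ z ≠ w) := by
  classical
  induction p with
  | nil =>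
    intro u hu huw
    simp only [SimpleGraph.Walk.support_nil, List.mem_singleton] at hu
    subst hu
    exact Or.inl ⟨.nil, by simpa using huw⟩
  | @cons a c b h p ih =>
    intro u hu huw
    rw [SimpleGraph.Walk.cons_isPath_iff] at hp
    by_cases hua : u = a
    · subst hua
      exact Or.inl ⟨.nil, by simpa using huw⟩
    have hup : u ∈ p.support := by simpa [hua] using hu
    by_cases hwa : w = a
    · subst hwa
      refine Or.inr ⟨p.dropUntil u hup, fun z hz => ?_⟩
      have hz' := p.support_dropUntil_subset_support hup hz
      refine ⟨by simp [hz'], ?_⟩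
      rintro rfl
      exact hp.2 hz'
    · rcases ih hp.1 u hup huw with ⟨r, hr⟩ | ⟨r, hr⟩
      · refine Or.inl ⟨r.concat h.symm, fun z hz => ?_⟩
        rw [SimpleGraph.Walk.support_concat] at hz
        simp only [List.mem_append, List.mem_singleton] at hz
        rcases hz with hz | rfl
        · exact ⟨by simp [(hr z hz).1], (hr z hz).2⟩
        · exact ⟨by simp, fun h => hwa h.symm⟩
      · exact Or.inr ⟨r, fun z hz => ⟨by simp [(hr z hz).1], (hr z hz).2⟩⟩

/-- Together with `v` the path forms a cycle, or a single link if `a = b`. After deletion of a node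
of the path, every remaining node still reaches an end of the path and from there `v`. -/
theorem isBiconnected_insert_support {a b v : V} (p : G.Walk a b) (hp : p.IsPath)
    (hv : v ∉ p.support) (ha : G.Adj v a) (hb : G.Adj v b) :
    IsBiconnected G (insert v {u | u ∈ p.support}) := by
  classical
  have key : ∀ w ≠ v, (G.induce (insert v {u | u ∈ p.support} \ {w})).Preconnected := by
    intro w hw
    refine preconnected_of_root (r := v) ⟨by simp, fun h => hw h.symm⟩ ?_
    rintro u ⟨hu, huw⟩
    by_cases huv : u = v
    · subst huv
      exact ⟨.nil, by simpa using huw⟩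
    have hup : u ∈ p.support := by simpa [huv] using hu
    have fin : ∀ c, G.Adj v c → (∃ r : G.Walk u c, ∀ z ∈ r.support, z ∈ p.support ∧ z ≠ w) →
        ∃ r : G.Walk u v, ∀ z ∈ r.support, z ∈ insert v {u | u ∈ p.support} \ {w} := by
      rintro c hc ⟨r, hr⟩
      refine ⟨r.concat hc.symm, fun z hz => ?_⟩
      rw [SimpleGraph.Walk.support_concat] at hz
      simp only [List.mem_append, List.mem_singleton] at hz
      rcases hz with hz | rfl
      · exact ⟨by simp [(hr z hz).1], (hr z hz).2⟩
      · exact ⟨by simp, fun h => hw h.symm⟩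
    rcases exists_walk_to_end p hp w u hup huw with h | h
    · exact fin a ha h
    · exact fin b hb h
  have key' : (G.induce {u | u ∈ p.support}).Preconnected := by
    refine preconnected_of_root (r := b) (by simp) fun u hu =>
      ⟨p.dropUntil u hu, fun z hz => p.support_dropUntil_subset_support hu hz⟩
  refine ⟨@SimpleGraph.Connected.mk _ _ ?_ ⟨v, by simp⟩, fun w hw => ?_⟩
  · refine preconnected_of_root (r := v) (by simp) fun u hu => ?_
    by_cases huv : u = v
    · subst huv
      exact ⟨.nil, by simp⟩
    have hup : u ∈ p.support := by simpa [huv] using hu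
    refine ⟨(p.dropUntil u hup).concat hb.symm, fun z hz => ?_⟩
    rw [SimpleGraph.Walk.support_concat] at hz
    simp only [List.mem_append, List.mem_singleton] at hz
    rcases hz with hz | rfl
    · exact Or.inr (p.support_dropUntil_subset_support hup hz)
    · simp
  · by_cases hwv : w = v
    · subst hwv
      rwa [Set.insert_sdiff_self_of_notMem (by simpa using hv)]
    · exact key w hwv

theorem preconnected_induce_union {B₁ B₂ : Set V} (h₁ : (G.induce B₁).Preconnected)
    (h₂ : (G.induce B₂).Preconnected) {z : V} (hz₁ : z ∈ B₁) (hz₂ : z ∈ B₂) :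
    (G.induce (B₁ ∪ B₂)).Preconnected :=
  (SimpleGraph.induce_union_connected (G := G) (s := B₁) (t := B₂) h₁ h₂
    ⟨z, hz₁, hz₂⟩).preconnected

/-- Whichever node is deleted, one of the two common nodes `y`, `z` survives and joins the
remainders. -/
theorem IsBiconnected.union {B₁ B₂ : Set V} (h₁ : IsBiconnected G B₁) (h₂ : IsBiconnected G B₂)
    {y z : V} (hyz : y ≠ z) (hy₁ : y ∈ B₁) (hy₂ : y ∈ B₂) (hz₁ : z ∈ B₁) (hz₂ : z ∈ B₂) :
    IsBiconnected G (B₁ ∪ B₂) := by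
  have del : ∀ {B : Set V}, IsBiconnected G B → ∀ w, (G.induce (B \ {w})).Preconnected := by
    intro B hB w
    by_cases hw : w ∈ B
    · exact hB.2 w hw
    · rw [Set.sdiff_singleton_eq_self hw]
      exact hB.1.preconnected
  refine ⟨@SimpleGraph.Connected.mk _ _ (preconnected_induce_union h₁.1.preconnected
    h₂.1.preconnected hy₁ hy₂) ⟨y, Or.inl hy₁⟩, fun w _ => ?_⟩
  rw [Set.union_sdiff_distrib]
  by_cases hw : y = w
  · exact preconnected_induce_union (del h₁ w) (del h₂ w) (z := z)
      ⟨hz₁, fun h => hyz (hw.trans h.symm)⟩ ⟨hz₂, fun h => hyz (hw.trans h.symm)⟩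
  · exact preconnected_induce_union (del h₁ w) (del h₂ w) (z := y) ⟨hy₁, hw⟩ ⟨hy₂, hw⟩

/-- Neighbours of `v` that are connected to each other in `G - v` lie in one block with `v`. -/
theorem card_le_blockDegree [Fintype V] (G : SimpleGraph V) {v : V} {D : Finset V}
    (hD : ∀ u ∈ D, G.Adj v u) (hconn : ∀ a ∈ D, ∀ b ∈ D, ∃ p : G.Walk a b, v ∉ p.support) :
    D.card ≤ blockDegree G := by
  classical
  have hpath : ∀ a ∈ D, ∀ b ∈ D, ∃ p : G.Walk a b, p.IsPath ∧ v ∉ p.support := by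
    intro a ha b hb
    obtain ⟨p, hp⟩ := hconn a ha b hb
    exact ⟨p.bypass, p.bypass_isPath, fun h => hp (p.support_bypass_subset_support h)⟩
  unfold blockDegree
  split_ifs with ht
  · rw [Finset.card_le_one]
    intro a ha b hb
    by_contra hab
    obtain ⟨p, hp, hv⟩ := hpath a ha b hb
    -- In a tree, the path through `v` and the path avoiding `v` would be two different paths from
    -- `a` to `b`.
    let r : G.Walk a b := .cons (hD a ha).symm (.cons (hD b hb) .nil)
    have hr : r.IsPath := by
      simp [r, SimpleGraph.Walk.cons_isPath_iff, hab, (hD a ha).ne', (hD b hb).ne]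
    have := (ht.2.subsingleton_path a b).elim ⟨p, hp⟩ ⟨r, hr⟩
    have e : p = r := congrArg Subtype.val this
    exact hv (e ▸ by simp [r])
  · rcases D.eq_empty_or_nonempty with rfl | ⟨a, ha⟩
    · simp
    have h0 : IsBiconnected G {v, a} := by
      have := isBiconnected_insert_support (G := G) (a := a) (b := a) (v := v) .nil (by simp)
        (by simpa using (hD a ha).ne) (hD a ha) (hD a ha)
      simpa using this
    -- A block through the link from `v` to `a`. By maximality it absorbs the cycle through `v`, `a`
    -- and any other `b` in `D`, since the two share `v` and `a`.
    obtain ⟨B, hB0, hB⟩ := (Set.toFinite {B | IsBiconnected G B}).exists_le_maximal h0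
    have hvB : v ∈ B := hB0 (by simp)
    have haB : a ∈ B := hB0 (by simp)
    have hDB : ∀ b ∈ D, b ∈ B := by
      intro b hb
      obtain ⟨p, hp, hv⟩ := hpath a ha b hb
      have h1 := isBiconnected_insert_support p hp hv (hD a ha) (hD b hb)
      have h2 : IsBiconnected G (B ∪ insert v {u | u ∈ p.support}) :=
        IsBiconnected.union hB.1 h1 (hD a ha).ne hvB (by simp) haB (by simp)
      exact hB.2 h2 (fun _ h => Or.inl h) (Or.inr (by simp))
    calc D.card = (D : Set V).ncard := (Set.ncard_coe_finset D).symm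
      _ ≤ (G.neighborSet v ∩ B).ncard :=
        Set.ncard_le_ncard (fun b hb => ⟨hD b hb, hDB b hb⟩) (Set.toFinite _)
      _ ≤ _ := by
        refine le_csSup ⟨Fintype.card V, ?_⟩ ⟨B, hB, v, hvB, rfl⟩
        -- The supremum of natural numbers in `blockDegree` is meaningful only for a bounded set;
        -- the number of nodes bounds it.
        rintro d ⟨B', _, w, _, rfl⟩
        rw [← Nat.card_eq_fintype_card, ← Set.ncard_univ]
        exact Set.ncard_le_ncard (Set.subset_univ _) (Set.toFinite _)

end Block

end PageRankGame

namespace PageRankGame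

/-! # Sets of nodes as natural numbers -/

/-- The natural number whose binary digits indicate the elements of `E`. -/
def code (E : Finset ℕ) : ℕ := ∑ u ∈ E, 2 ^ u

theorem code_empty : code ∅ = 0 := rfl

theorem code_union {E F : Finset ℕ} (h : Disjoint E F) : code (E ∪ F) = code E + code F :=
  Finset.sum_union h

theorem code_insert {E : Finset ℕ} {u : ℕ} (h : u ∉ E) : code (insert u E) = code E + 2 ^ u := by
  rw [code, Finset.sum_insert h, add_comm, code]

theorem code_injective : Function.Injective code := fun _ _ h =>
  Finset.geomSum_injective le_rfl h

/-- The reason why greedy decoding works: the digits below `k` cannot add up to `2 ^ k`. -/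
theorem code_filter_lt (E : Finset ℕ) (k : ℕ) : code (E.filter (· < k)) < 2 ^ k := by
  calc code (E.filter (· < k)) ≤ ∑ u ∈ Finset.range k, 2 ^ u :=
        Finset.sum_le_sum_of_subset fun u hu => by simp at hu; simp [hu.2]
    _ < 2 ^ k := by
        have := Nat.geomSum_lt (m := 2) (n := k) (s := Finset.range k) le_rfl (by simp)
        exact this

theorem code_filter_succ (E : Finset ℕ) (k : ℕ) :
    code (E.filter (· < k + 1)) = code (E.filter (· < k)) + if k ∈ E then 2 ^ k else 0 := by
  split_ifs with h
  · rw [← code_insert (by simp)]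
    congr 1
    ext u
    simp only [Finset.mem_filter, Finset.mem_insert]
    constructor
    · rintro ⟨h1, h2⟩
      rcases Nat.lt_succ_iff_lt_or_eq.1 h2 with h3 | h3
      · exact Or.inr ⟨h1, h3⟩
      · exact Or.inl h3
    · rintro (rfl | ⟨h1, h2⟩)
      · exact ⟨h, by omega⟩
      · exact ⟨h1, by omega⟩
  · rw [add_zero]
    congr 1
    ext u
    simp only [Finset.mem_filter]
    refine and_congr_right fun h1 => ?_
    have : u ≠ k := by rintro rfl; exact h h1
    omega

/-! # The static part of the memory -/

open Classical in
/-- The input and the tables of the multiples of `n` and of the powers of two. -/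
structure HasInput (n : ℕ) (A : ℕ → ℕ → Prop) (α : ℝ) (q : ℕ → ℝ) (m : Memory) : Prop where
  size : m.nat 0 = n
  adj : ∀ u < n, ∀ w < n, m.natArr 0 (u * n + w) = if A u w then 1 else 0
  mul : ∀ u < n, m.natArr 2 u = u * n
  pow : ∀ u < n, m.natArr 3 u = 2 ^ u
  alpha : m.realArr 0 0 = α
  weight : ∀ u < n, m.realArr 1 u = q u

theorem HasInput.of_frame {n : ℕ} {A : ℕ → ℕ → Prop} {α : ℝ} {q : ℕ → ℝ} {p : Program}
    {m m' : Memory} (h : HasInput n A α q m) (f : Frame p m m')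
    (h0 : p.writesNat 0 = false := by decide)
    (h1 : p.writesNatArr 0 = false ∧ p.writesNatArr 2 = false ∧ p.writesNatArr 3 = false :=
      by decide)
    (h2 : p.writesRealArr 0 = false ∧ p.writesRealArr 1 = false := by decide) :
    HasInput n A α q m' := by
  constructor
  · rw [f.nat' 0 h0, h.size]
  · rw [f.natArr' 0 h1.1]; exact h.adj
  · rw [f.natArr' 2 h1.2.1]; exact h.mul
  · rw [f.natArr' 3 h1.2.2]; exact h.pow
  · rw [f.realArr' 0 h2.1]; exact h.alpha
  · rw [f.realArr' 1 h2.2]; exact h.weight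

/-! # Decoding a set -/

/-- One step of `decode`. -/
def decodeStep (a : ℕ) : Program :=
  .seq (.setNat 26 (.sub (.sub (.var 0) (.var 14)) (.const 1)))
    (.cond (.natLt (.var 13) (.get 3 (.var 26)))
      (.storeNat a (.var 26) (.const 0))
      (.seq (.storeNat a (.var 26) (.const 1))
        (.setNat 13 (.sub (.var 13) (.get 3 (.var 26))))))

/-- Write the indicator function of the set whose code is variable `13` into array `a`. -/
def decode (a : ℕ) : Program := forLoop 14 0 (decodeStep a)

/-- Digits are read off greedily from the highest one, by comparing with and subtracting tabulated
powers of two. Array `3` holds these powers, hence the condition on `a`. -/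
theorem decode_spec {n : ℕ} {A : ℕ → ℕ → Prop} {α : ℝ} {q : ℕ → ℝ} {m : Memory} (a : ℕ)
    (ha : a ≠ 3) (hm : HasInput n A α q m) {E : Finset ℕ} (hE : E ⊆ Finset.range n)
    (h13 : m.nat 13 = code E) :
    Halts (decode a) m (30 * n + 5) fun m' => ∀ u < n, m'.natArr a u = if u ∈ E then 1 else 0 := by
  have key := Halts.forLoop (x := 14) (y := 0) (p := decodeStep a) (m := m) (T := 23)
    -- After `t` rounds the `t` highest digits have been written, and variable `13` holds the code
    -- of the rest.
    (fun t m' => m'.nat 13 = code (E.filter (· < n - t)) ∧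
      ∀ u < n, n - t ≤ u → m'.natArr a u = if u ∈ E then 1 else 0) hm.size
    (by
      constructor
      · simp only [Memory.setNat_nat, h13]
        rw [if_neg (by decide), Finset.filter_true_of_mem]
        exact fun u hu => Finset.mem_range.1 (hE hu)
      · intro u hu hu'
        omega)
    (by
      rintro t ht m' f h14 ⟨hI1, hI2⟩
      refine (halts_of_loopFree (decodeStep a) m' rfl).mono (Nat.le_of_ble_eq_true rfl) ?_
      rintro m'' - rfl - -
      have hn : m'.nat 0 = n := by
        rw [f.nat' 0 rfl, hm.size]
      have hpow : m'.natArr 3 (n - t - 1) = 2 ^ (n - t - 1) := by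
        rw [f.natArr' 3 (by simpa [forLoop, decodeStep, Program.writesNatArr] using ha)]
        exact hm.pow _ (by omega)
      obtain ⟨k, hk⟩ : ∃ k, n - t = k + 1 := ⟨n - t - 1, by omega⟩
      have hk' : n - (t + 1) = k := by omega
      rw [hk] at hI1 hI2
      rw [code_filter_succ] at hI1
      have hlt := code_filter_lt E k
      simp only [hk, Nat.add_sub_cancel] at hpow
      rw [hk']
      by_cases hkE : k ∈ E
      · simp only [hkE, if_true] at hI1
        have h3 : ¬ (code (E.filter (· < k)) + 2 ^ k < 2 ^ k) := by omega
        simp [decodeStep, hI1, hn, h14, hpow, hk, Ne.symm ha]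
        intro u hu hku
        split_ifs with h1 h2 h2
        · rfl
        · exact absurd (h1 ▸ hkE) h2
        · simpa [h2] using hI2 u hu (by omega)
        · simpa [h2] using hI2 u hu (by omega)
      · simp only [hkE, if_false, add_zero] at hI1
        simp [decodeStep, hI1, hn, h14, hpow, hk, hlt]
        intro u hu hku
        split_ifs with h1 h2 h2
        · exact absurd (h1 ▸ h2) hkE
        · rfl
        · simpa [h2] using hI2 u hu (by omega)
        · simpa [h2] using hI2 u hu (by omega))
    (by decide) rfl rfl
  exact key.mono (by omega) fun m' _ h u hu => h.2 u hu (by omega)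

end PageRankGame

namespace PageRankGame

/-! # Gaussian elimination -/

/-- The system `x = P x + b` is substochastic and has solution `x`. -/
structure IsContractive (N : ℕ) (β : ℝ) (P : ℕ → ℕ → ℝ) (b x : ℕ → ℝ) : Prop where
  nonneg : ∀ i < N, ∀ j < N, 0 ≤ P i j
  row : ∀ i < N, ∑ j ∈ Finset.range N, P i j ≤ β
  eq : ∀ i < N, x i = ∑ j ∈ Finset.range N, P i j * x j + b i

/-- Solve equation `k` for the unknown `k`. -/
noncomputable def scaleMatrix (P : ℕ → ℕ → ℝ) (k i j : ℕ) : ℝ :=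
  if i = k then (if j = k then 0 else P k j) / (1 - P k k) else P i j

noncomputable def scaleVector (P : ℕ → ℕ → ℝ) (b : ℕ → ℝ) (k i : ℕ) : ℝ :=
  if i = k then b k / (1 - P k k) else b i

/-- Insert equation `k` into the others. -/
noncomputable def elimMatrix (P : ℕ → ℕ → ℝ) (k i j : ℕ) : ℝ :=
  (if j = k then 0 else P i j) + P i k * P k j

noncomputable def elimVector (P : ℕ → ℕ → ℝ) (b : ℕ → ℝ) (k i : ℕ) : ℝ :=
  b i + P i k * b k

theorem elimMatrix_congr {P R : ℕ → ℕ → ℝ} {k i : ℕ} (hi : P i = R i) (hk : P k = R k) (j : ℕ) :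
    elimMatrix P k i j = elimMatrix R k i j := by
  rw [elimMatrix, elimMatrix, hi, hk]

theorem elimVector_congr {P R : ℕ → ℕ → ℝ} {b c : ℕ → ℝ} {k i : ℕ} (hi : P i = R i)
    (hbi : b i = c i) (hbk : b k = c k) :
    elimVector P b k i = elimVector R c k i := by
  rw [elimVector, elimVector, hi, hbi, hbk]

theorem sum_ite_eq_zero {N k : ℕ} (hk : k < N) (f : ℕ → ℝ) :
    ∑ j ∈ Finset.range N, (if j = k then 0 else f j) = ∑ j ∈ Finset.range N, f j - f k := by
  rw [eq_sub_iff_add_eq, ← Finset.sum_erase_add _ _ (Finset.mem_range.2 hk),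
    ← Finset.sum_erase_add (Finset.range N) f (Finset.mem_range.2 hk)]
  simp only [if_true, add_zero]
  congr 1
  exact Finset.sum_congr rfl fun j hj => if_neg (Finset.ne_of_mem_erase hj)

/-- The pivot satisfies `P k k ≤ β < 1`, so the division is safe. A row sum `r ≤ β` with diagonal
entry `p` becomes `(r - p) / (1 - p)`, which is again at most `β`. -/
theorem IsContractive.scale {N : ℕ} {β : ℝ} {P : ℕ → ℕ → ℝ} {b x : ℕ → ℝ}
    (h : IsContractive N β P b x) (h1 : β < 1) {k : ℕ} (hk : k < N) :
    IsContractive N β (scaleMatrix P k) (scaleVector P b k) x := by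
  have hle : P k k ≤ β :=
    (Finset.single_le_sum (fun j hj => h.nonneg k hk j (Finset.mem_range.1 hj))
      (Finset.mem_range.2 hk)).trans (h.row k hk)
  have hd : 0 < 1 - P k k := by linarith
  have h0 : 0 ≤ P k k := h.nonneg k hk k hk
  refine ⟨fun i hi j hj => ?_, fun i hi => ?_, fun i hi => ?_⟩
  · unfold scaleMatrix
    split_ifs
    · simp
    · exact div_nonneg (h.nonneg k hk j hj) hd.le
    · exact h.nonneg i hi j hj
  · by_cases hik : i = k
    · subst hik
      simp only [scaleMatrix, if_true, ← Finset.sum_div]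
      rw [sum_ite_eq_zero hk, div_le_iff₀ hd]
      have := h.row i hi
      nlinarith
    · simpa only [scaleMatrix, hik, if_false] using h.row i hi
  · by_cases hik : i = k
    · subst hik
      have e : ∀ j, scaleMatrix P i i j * x j = (if j = i then 0 else P i j * x j) / (1 - P i i) := by
        intro j
        simp only [scaleMatrix, if_true]
        split_ifs <;> ring
      simp only [e, scaleVector, if_true, ← Finset.sum_div]
      rw [sum_ite_eq_zero hk, ← add_div, eq_div_iff hd.ne']
      have := h.eq i hi
      linarith
    · simp only [scaleMatrix, scaleVector, hik, if_false]
      exact h.eq i hi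

/-- Substituting row `k` replaces the weight `P i k` by `P i k` times a row sum that is at most 1,
so no row sum grows. Contractivity is thus preserved throughout the elimination, and later pivots
are safe without any search. -/
theorem IsContractive.elim {N : ℕ} {β : ℝ} {P : ℕ → ℕ → ℝ} {b x : ℕ → ℝ}
    (h : IsContractive N β P b x) (h1 : β < 1) {k : ℕ} (hk : k < N) :
    IsContractive N β (elimMatrix P k) (elimVector P b k) x := by
  refine ⟨fun i hi j hj => ?_, fun i hi => ?_, fun i hi => ?_⟩
  · unfold elimMatrix
    refine add_nonneg ?_ (mul_nonneg (h.nonneg i hi k hk) (h.nonneg k hk j hj))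
    split_ifs
    · exact le_rfl
    · exact h.nonneg i hi j hj
  · simp only [elimMatrix, Finset.sum_add_distrib, ← Finset.mul_sum]
    rw [sum_ite_eq_zero hk]
    nlinarith [h.row i hi, h.row k hk, h.nonneg i hi k hk]
  · have e : ∀ j, elimMatrix P k i j * x j
        = (if j = k then 0 else P i j * x j) + P i k * (P k j * x j) := by
      intro j
      simp only [elimMatrix]
      split_ifs <;> ring
    simp only [e, elimVector, Finset.sum_add_distrib, ← Finset.mul_sum]
    rw [sum_ite_eq_zero hk]
    have h2 := h.eq i hi
    have h3 := h.eq k hk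
    have h4 : ∑ j ∈ Finset.range N, P k j * x j = x k - b k := by linarith
    rw [h4]
    linarith

theorem index_inj {n a b a' b' : ℕ} (hb : b < n) (hb' : b' < n) :
    a * n + b = a' * n + b' ↔ a = a' ∧ b = b' := by
  constructor
  · intro h
    have hn : 0 < n := by omega
    have h1 : (a * n + b) % n = (a' * n + b') % n := by rw [h]
    rw [Nat.mul_add_mod_self_right, Nat.mul_add_mod_self_right, Nat.mod_eq_of_lt hb,
      Nat.mod_eq_of_lt hb'] at h1
    subst h1
    refine ⟨?_, rfl⟩
    exact Nat.eq_of_mul_eq_mul_right hn (by omega)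
  · rintro ⟨rfl, rfl⟩
    rfl

/-- The address of the matrix entry in row `x` and column `y`. -/
def entry (x y : ℕ) : NatExpr := .add (.get 2 (.var x)) (.var y)

def gaussScaleStep : Program :=
  .storeReal 2 (entry 18 17) (.div (.get 2 (entry 18 17)) (.get 12 (.const 0)))

def gaussRowStep : Program :=
  .storeReal 2 (entry 16 17)
    (.add (.get 2 (entry 16 17)) (.mul (.get 13 (.const 0)) (.get 2 (entry 18 17))))

def gaussRowInit : Program :=
  .seq (.storeReal 13 (.const 0) (.get 2 (entry 16 18)))
    (.seq (.storeReal 2 (entry 16 18) (.cast (.const 0)))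
      (.storeReal 3 (.var 16)
        (.add (.get 3 (.var 16)) (.mul (.get 13 (.const 0)) (.get 3 (.var 18))))))

/-- Insert equation `k` into equation `a`. -/
def gaussRow : Program := .seq gaussRowInit (forLoop 17 7 gaussRowStep)

def gaussPivotInit : Program :=
  .seq (.storeReal 12 (.const 0) (.sub (.cast (.const 1)) (.get 2 (entry 18 18))))
    (.seq (.storeReal 2 (entry 18 18) (.cast (.const 0)))
      (.storeReal 3 (.var 18) (.div (.get 3 (.var 18)) (.get 12 (.const 0)))))

/-- Eliminate unknown `k`. -/
def gaussPivot : Program :=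
  .seq gaussPivotInit (.seq (forLoop 17 7 gaussScaleStep) (forLoop 16 7 gaussRow))

/-- Solve the system `x = P x + b` with matrix `P` in array `2` and vector `b` in array `3`. -/
def gauss : Program := forLoop 18 7 gaussPivot

/-- Arrays `2` and `3` hold the system `x = P x + b` with `N` unknowns. -/
structure HoldsSystem (n N : ℕ) (P : ℕ → ℕ → ℝ) (b : ℕ → ℝ) (m : Memory) : Prop where
  matrix : ∀ i < N, ∀ j < N, m.realArr 2 (i * n + j) = P i j
  vector : ∀ i < N, m.realArr 3 i = b i

section

variable {n : ℕ} {A : ℕ → ℕ → Prop} {α : ℝ} {q : ℕ → ℝ} {m : Memory} {N : ℕ}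
  {P : ℕ → ℕ → ℝ} {b : ℕ → ℝ}

theorem gaussScale_spec (hm : HasInput n A α q m) (hN : m.nat 7 = N) (hNn : N ≤ n)
    {k : ℕ} (hk : k < N) (hk' : m.nat 18 = k) (hs : HoldsSystem n N P b m) :
    Halts (forLoop 17 7 gaussScaleStep) m (30 * N + 5) (HoldsSystem n N
      (fun i j => if i = k then P i j / m.realArr 12 0 else P i j) b) := by
  have key := Halts.forLoop (x := 17) (y := 7) (p := gaussScaleStep) (m := m) (T := 14)
    (fun t m' => HoldsSystem n N
      (fun i j => if i = k ∧ j < t then P i j / m.realArr 12 0 else P i j) b m') hN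
    ⟨by simpa using hs.matrix, by simpa using hs.vector⟩
    (by
      intro t ht m' f hx hI
      refine (halts_of_loopFree gaussScaleStep m').mono (by decide) ?_
      rintro m'' - rfl - -
      have e1 : m'.nat 18 = k := (f.nat 18).trans hk'
      have e2 : m'.natArr 2 k = k * n := by
        rw [f.natArr 2]; exact hm.mul k (by omega)
      have e3 : m'.realArr 12 = m.realArr 12 := f.realArr 12
      have e4 := hI.matrix k hk t ht
      simp only [lt_irrefl, and_false, if_false] at e4
      constructor
      · intro i hi j hj
        simp [gaussScaleStep, entry, e1, e2, e3, hx, e4, hI.matrix i hi j hj,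
          index_inj (show j < n by omega) (show t < n by omega)]
        by_cases h1 : i = k ∧ j = t
        · simp [h1]
        · rw [if_neg h1]
          have : (i = k ∧ j ≤ t) ↔ (i = k ∧ j < t) := by
            constructor <;> rintro ⟨h2, h3⟩ <;> refine ⟨h2, ?_⟩
            · have : j ≠ t := fun h => h1 ⟨h2, h⟩
              omega
            · omega
          simp only [this]
      · intro i hi
        simpa [gaussScaleStep] using hI.vector i hi)
  refine key.mono (by omega) fun m' _ h => ⟨fun i hi j hj => ?_, h.vector⟩
  rw [h.matrix i hi j hj]
  simp [hj]

/-- The row `a = k` is not excluded; as `P k k = 0` after scaling, it is then left unchanged. -/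
theorem gaussRow_spec (hm : HasInput n A α q m) (hN : m.nat 7 = N) (hNn : N ≤ n)
    {k a : ℕ} (hk : k < N) (hk' : m.nat 18 = k) (ha : a < N) (ha' : m.nat 16 = a)
    (hs : HoldsSystem n N P b m) (hkk : P k k = 0) :
    Halts gaussRow m (30 * N + 60) (HoldsSystem n N
      (fun i j => if i = a then elimMatrix P k i j else P i j)
      (fun i => if i = a then elimVector P b k i else b i)) := by
  have hmk := hm.mul k (by omega)
  have hma := hm.mul a (by omega)
  refine Halts.mono (Halts.seq (halts_of_loopFree gaussRowInit m) fun m₁ f₁ h₁ =>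
    (Halts.forLoop (x := 17) (y := 7) (p := gaussRowStep) (m := m₁) (T := 19)
    (fun t m' => HoldsSystem n N
      (fun i j => if i = a ∧ j < t then elimMatrix P k i j else
        if i = a ∧ j = k then 0 else P i j)
      (fun i => if i = a then elimVector P b k i else b i) m') (by rw [f₁.nat 7, hN]) ?_ ?_)) ?_ ?_ (T' := 30 * N + 60)
  · subst h₁
    constructor
    · intro i hi j hj
      simp [gaussRowInit, entry, hk', ha', hma, hs.matrix i hi j hj,
        index_inj (show j < n by omega) (show k < n by omega)]
    · intro i hi
      simp [gaussRowInit, entry, hk', ha', hma, hs.matrix a ha k hk, hs.vector i hi, hs.vector k hk,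
        hs.vector a ha, elimVector]
      split_ifs with h
      · rw [h]
      · rfl
  · intro t ht m' f hx hI
    have h13 : m'.realArr 13 0 = P a k := by
      rw [f.realArr 13, h₁]
      simp [gaussRowInit, entry, hk', ha', hma, hs.matrix a ha k hk]
    have e1 : m'.nat 18 = k := by rw [f.nat 18, f₁.nat 18, hk']
    have e2 : m'.nat 16 = a := by rw [f.nat 16, f₁.nat 16, ha']
    have e3 : m'.natArr 2 k = k * n := by rw [f.natArr 2, f₁.natArr 2, hmk]
    have e4 : m'.natArr 2 a = a * n := by rw [f.natArr 2, f₁.natArr 2, hma]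
    have e5 := hI.matrix a ha t ht
    -- If `a = k`, the row read is the one being overwritten, but its coefficient is 0.
    have e6 : P a k * m'.realArr 2 (k * n + t) = P a k * P k t := by
      by_cases hak : a = k
      · rw [hak, hkk, zero_mul, zero_mul]
      · rw [hI.matrix k hk t ht]
        simp [Ne.symm hak]
    simp only [lt_irrefl, and_false, if_false, true_and] at e5
    refine (halts_of_loopFree gaussRowStep m').mono (by decide) ?_
    rintro m'' - rfl - -
    constructor
    · intro i hi j hj
      simp [gaussRowStep, entry, e1, e2, e3, e4, hx, e5, hI.matrix i hi j hj, h13, e6,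
        index_inj (show j < n by omega) (show t < n by omega)]
      by_cases h1 : i = a ∧ j = t
      · simp [h1, elimMatrix]
      · rw [if_neg h1]
        have : (i = a ∧ j ≤ t) ↔ (i = a ∧ j < t) := by
          constructor <;> rintro ⟨h2, h3⟩ <;> refine ⟨h2, ?_⟩
          · have : j ≠ t := fun h => h1 ⟨h2, h⟩
            omega
          · omega
        simp only [this]
    · intro i hi
      simpa [gaussRowStep] using hI.vector i hi
  · have : gaussRowInit.cost ≤ 30 := by decide
    omega
  · intro m' _ h
    refine ⟨fun i hi j hj => ?_, h.vector⟩
    rw [h.matrix i hi j hj]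
    by_cases hia : i = a
    · simp [hia, hj]
    · simp [hia]

theorem gaussPivot_spec (hm : HasInput n A α q m) (hN : m.nat 7 = N) (hNn : N ≤ n)
    {k : ℕ} (hk : k < N) (hk' : m.nat 18 = k) (hs : HoldsSystem n N P b m) :
    Halts gaussPivot m (N * (30 * N + 67) + 30 * N + 50) (HoldsSystem n N
      (elimMatrix (scaleMatrix P k) k) (elimVector (scaleMatrix P k) (scaleVector P b k) k)) := by
  have hmk := hm.mul k (by omega)
  set R := scaleMatrix P k with hR
  set c := scaleVector P b k with hc
  have hRkk : R k k = 0 := by simp [hR, scaleMatrix]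
  refine Halts.mono (Halts.seq (halts_of_loopFree gaussPivotInit m) fun m₁ f₁ h₁ => Halts.seq
    (gaussScale_spec (P := fun i j => if i = k ∧ j = k then 0 else P i j) (b := c)
      (hm.of_frame f₁) (by rw [f₁.nat 7, hN]) hNn hk (by rw [f₁.nat 18, hk']) ?_)
      fun m₂ f₂ h₂ => (Halts.forLoop (x := 16) (y := 7) (p := gaussRow) (m := m₂)
        (T := 30 * N + 60)
        (fun t m' => HoldsSystem n N (fun i j => if i < t then elimMatrix R k i j else R i j)
          (fun i => if i < t then elimVector R c k i else c i) m')
        (by rw [f₂.nat 7, f₁.nat 7, hN]) ?_ ?_)) ?_ ?_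
  · subst h₁
    constructor
    · intro i hi j hj
      simp [gaussPivotInit, entry, hk', hmk, hs.matrix i hi j hj,
        index_inj (show j < n by omega) (show k < n by omega)]
    · intro i hi
      simp [gaussPivotInit, entry, hk', hmk, hs.matrix k hk k hk, hs.vector i hi, hs.vector k hk,
        hc, scaleVector]
  · have e12 : m₁.realArr 12 0 = 1 - P k k := by
      rw [h₁]
      simp [gaussPivotInit, entry, hk', hmk, hs.matrix k hk k hk]
    constructor
    · intro i hi j hj
      simp only [Memory.setNat_realArr, h₂.matrix i hi j hj, e12, hR, scaleMatrix, not_lt_zero,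
        if_false]
      by_cases h1 : i = k <;> by_cases h2 : j = k <;> simp [h1, h2]
    · intro i hi
      simpa using h₂.vector i hi
  · intro t ht m' f hx hI
    -- Row `k` is its own elimination, so it does not matter whether the loop has already passed it.
    have ek : elimMatrix R k k = R k := by
      funext j
      simp only [elimMatrix, hRkk, zero_mul, add_zero]
      split_ifs with h
      · rw [h, hRkk]
      · rfl
    have ek' : elimVector R c k k = c k := by simp [elimVector, hRkk]
    have hRk : ∀ j, (if k < t then elimMatrix R k k j else R k j) = R k j := by
      intro j
      split_ifs
      · rw [ek]
      · rfl
    have hck : (if k < t then elimVector R c k k else c k) = c k := by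
      rw [ek', ite_self]
    refine (gaussRow_spec (m := m') (((hm.of_frame f₁).of_frame f₂).of_frame f)
      (by rw [f.nat 7, f₂.nat 7, f₁.nat 7, hN]) hNn hk (by rw [f.nat 18, f₂.nat 18, f₁.nat 18, hk'])
      ht hx hI (by rw [hRk, hRkk])).mono le_rfl ?_
    intro m'' _ h _ _
    constructor
    · intro i hi j hj
      simp only [Memory.setNat_realArr]
      rw [h.matrix i hi j hj]
      rcases lt_trichotomy i t with h1 | h1 | h1
      · simp [h1, h1.ne, Nat.lt_succ_of_lt h1]
      · subst h1
        rw [if_pos rfl, if_pos (Nat.lt_succ_self i), elimMatrix_congr (R := R)]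
        · simp
        · exact funext hRk
      · simp [h1.ne', not_lt_of_gt h1, show ¬ i < t + 1 by omega]
    · intro i hi
      simp only [Memory.setNat_realArr]
      rw [h.vector i hi]
      rcases lt_trichotomy i t with h1 | h1 | h1
      · simp [h1, h1.ne, Nat.lt_succ_of_lt h1]
      · subst h1
        rw [if_pos rfl, if_pos (Nat.lt_succ_self i), elimVector_congr (R := R) (c := c)]
        · simp
        · simp
        · exact hck
      · simp [h1.ne', not_lt_of_gt h1, show ¬ i < t + 1 by omega]
  · have : gaussPivotInit.cost ≤ 40 := by decide
    rw [show 30 * N + 60 + 7 = 30 * N + 67 by rfl]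
    omega
  · intro m' _ h
    constructor
    · intro i hi j hj
      simpa [hi] using h.matrix i hi j hj
    · intro i hi
      simpa [hi] using h.vector i hi

/-- The current system always has the same solution `x`, and its first `t` columns vanish after `t`
pivots. When all columns vanish, the system reads `x = b`. -/
theorem gauss_spec (hm : HasInput n A α q m) (hN : m.nat 7 = N) (hNn : N ≤ n)
    {β : ℝ} (h1 : β < 1) {x : ℕ → ℝ} (hs : HoldsSystem n N P b m) (hP : IsContractive N β P b x) :
    Halts gauss m (N * (200 * n ^ 2) + 5) fun m' => ∀ i < N, m'.realArr 3 i = x i := by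
  refine Halts.mono (Halts.forLoop (x := 18) (y := 7) (p := gaussPivot) (m := m)
    (T := N * (30 * N + 67) + 30 * N + 50)
    (fun t m' => ∃ P b, HoldsSystem n N P b m' ∧ IsContractive N β P b x ∧
      ∀ i < N, ∀ j < t, P i j = 0) hN ⟨P, b, ⟨by simpa using hs.matrix, by simpa using hs.vector⟩,
        hP, by simp⟩ ?_) ?_ ?_
  · rintro t ht m' f hx ⟨P, b, hs, hP, h0⟩
    refine (gaussPivot_spec (hm.of_frame f) (by rw [f.nat 7, hN]) hNn ht hx hs).mono le_rfl ?_
    intro m'' _ h _ _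
    refine ⟨_, _, ⟨h.matrix, h.vector⟩, (hP.scale h1 ht).elim h1 ht, ?_⟩
    -- Columns already cleared stay 0 under scaling, and column `t` is dropped by the elimination.
    -- What is added is a multiple of the scaled row `t`, whose first `t + 1` entries are 0.
    have hz : ∀ i < N, ∀ j < t + 1, (if j = t then 0 else scaleMatrix P t i j) = 0 := by
      intro i hi j hj
      split_ifs with hjt
      · rfl
      · have hj' : j < t := by omega
        simp [scaleMatrix, h0 i hi j hj', h0 t ht j hj']
    have hz' : ∀ j < t + 1, scaleMatrix P t t j = 0 := by
      intro j hj
      have := hz t ht j hj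
      by_cases hjt : j = t
      · simp [scaleMatrix, hjt]
      · rwa [if_neg hjt] at this
    intro i hi j hj
    rw [elimMatrix, hz i hi j hj, hz' j hj, mul_zero, add_zero]
  · rcases Nat.eq_zero_or_pos N with h0 | h0
    · simp [h0]
    · gcongr
      nlinarith
  · rintro m' _ ⟨P, b, hs, hP, h0⟩ i hi
    rw [hs.vector i hi, hP.eq i hi, Finset.sum_eq_zero, zero_add]
    intro j hj
    rw [h0 i hi j (Finset.mem_range.1 hj), zero_mul]

end

end PageRankGame

namespace PageRankGame

/-! # Finding a component of the graph without a node -/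

/-- Record node `w` if it is an unmarked neighbour, other than the player, of the current node. -/
def exploreVisit : Program :=
  .cond (.natEq (.get 0 (.add (.get 2 (.var 10)) (.var 9))) (.const 1))
    (.cond (.natEq (.var 9) (.var 3)) .nop
      (.cond (.natEq (.get 4 (.var 9)) (.const 0))
        (.seq (.storeNat 5 (.var 7) (.var 9))
          (.seq (.storeNat 4 (.var 9) (.const 1)) (.setNat 7 (.add (.var 7) (.const 1)))))
        .nop))
    .nop

/-- Visit the neighbours of the node at position `p` of the list. -/
def exploreNode : Program :=
  .cond (.natLt (.var 8) (.var 7))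
    (.seq (.setNat 10 (.get 5 (.var 8))) (forLoop 9 0 exploreVisit)) .nop

def exploreInit : Program :=
  .seq (.storeNat 5 (.const 0) (.var 4))
    (.seq (.storeNat 4 (.var 4) (.const 1)) (.setNat 7 (.const 1)))

/-- List and mark the component of node `4` in the graph without node `3`. -/
def explore : Program := .seq exploreInit (forLoop 8 0 exploreNode)

/-- The adjacency relation of the graph without `v`. -/
def avoidAdj (A : ℕ → ℕ → Prop) (v a b : ℕ) : Prop := A a b ∧ a ≠ v ∧ b ≠ v

/-- The first entries of array `5` list the elements of `C`. -/
structure HoldsList (C : Finset ℕ) (m : Memory) : Prop where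
  card : m.nat 7 = C.card
  image : (Finset.range C.card).image (m.natArr 5) = C

theorem HoldsList.injOn {C : Finset ℕ} {m : Memory} (h : HoldsList C m) :
    Set.InjOn (m.natArr 5) (Finset.range C.card) := by
  apply Finset.injOn_of_card_image_eq
  rw [h.image, Finset.card_range]

theorem HoldsList.mem {C : Finset ℕ} {m : Memory} (h : HoldsList C m) {p : ℕ} (hp : p < C.card) :
    m.natArr 5 p ∈ C := by
  have := Finset.mem_image_of_mem (m.natArr 5) (Finset.mem_range.2 hp)
  rwa [h.image] at this

theorem HoldsList.exists {C : Finset ℕ} {m : Memory} (h : HoldsList C m) {u : ℕ} (hu : u ∈ C) :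
    ∃ p < C.card, m.natArr 5 p = u := by
  rw [← h.image] at hu
  obtain ⟨p, hp, h⟩ := Finset.mem_image.1 hu
  exact ⟨p, Finset.mem_range.1 hp, h⟩

theorem HoldsList.of_frame {C : Finset ℕ} {p : Program} {m m' : Memory} (h : HoldsList C m)
    (f : Frame p m m') (h7 : p.writesNat 7 = false := by decide)
    (h5 : p.writesNatArr 5 = false := by decide) : HoldsList C m' :=
  ⟨by rw [f.nat' 7 h7, h.card], by rw [f.natArr' 5 h5, h.image]⟩

/-- `C` is a set of nodes in the component of `i` in the graph without `v`, outside of the set `U`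
of nodes marked before. -/
structure IsExplored (n : ℕ) (A : ℕ → ℕ → Prop) (v i : ℕ) (U C : Finset ℕ) (m : Memory) :
    Prop where
  root : i ∈ C
  subset : C ⊆ Finset.range n
  avoid : v ∉ C
  disj : Disjoint U C
  list : HoldsList C m
  mark : ∀ u < n, m.natArr 4 u = if u ∈ U ∪ C then 1 else 0
  conn : ∀ u ∈ C, Relation.ReflTransGen (avoidAdj A v) i u

section

variable {n : ℕ} {A : ℕ → ℕ → Prop} {α : ℝ} {q : ℕ → ℝ} {m : Memory}

/-- The marks of earlier components, the set `U`, are kept. Since `U` is closed under neighbours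
other than `v`, a marked neighbour of a node of `C` must lie in `C`, so a single array of marks
suffices. -/
theorem exploreVisit_spec (hm : HasInput n A α q m) {v i u w : ℕ} {U C : Finset ℕ}
    (hsymm : ∀ u w, A u w → A w u) (hv : m.nat 3 = v) (hw : w < n) (hw' : m.nat 9 = w)
    (hu' : m.nat 10 = u) (hU : ∀ u ∈ U, ∀ w, A u w → w ≠ v → w ∈ U) (h : IsExplored n A v i U C m)
    (hu : u ∈ C) :
    Halts exploreVisit m 30 fun m' => ∃ C', C ⊆ C' ∧ IsExplored n A v i U C' m' ∧
      (∀ p < C.card, m'.natArr 5 p = m.natArr 5 p) ∧ (A u w → w ≠ v → w ∈ C') := by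
  classical
  refine (halts_of_loopFree exploreVisit m).mono (by decide) ?_
  rintro m' - rfl
  have hun : u < n := Finset.mem_range.1 (h.subset hu)
  have e1 := hm.mul u hun
  have e2 := hm.adj u hun w hw
  by_cases hA : A u w
  swap
  · have : exploreVisit.exec m = m := by simp [exploreVisit, hw', hu', e1, e2, hA]
    rw [this]
    exact ⟨C, subset_rfl, h, fun _ _ => rfl, fun h => absurd h hA⟩
  by_cases hwv : w = v
  · have : exploreVisit.exec m = m := by simp [exploreVisit, hw', hu', e1, hv, hwv]
    rw [this]
    exact ⟨C, subset_rfl, h, fun _ _ => rfl, fun _ h => absurd hwv h⟩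
  have e3 := h.mark w hw
  by_cases hwC : w ∈ U ∪ C
  · have : exploreVisit.exec m = m := by simp [exploreVisit, hw', hu', e1, e2, hA, hv, hwv, e3, hwC]
    rw [this]
    refine ⟨C, subset_rfl, h, fun _ _ => rfl, fun _ _ => ?_⟩
    rcases Finset.mem_union.1 hwC with h1 | h1
    · have : u ∈ U := hU w h1 u (hsymm _ _ hA) fun h2 => h.avoid (h2 ▸ hu)
      exact absurd hu (Finset.disjoint_left.1 h.disj this)
    · exact h1
  rw [if_neg hwC] at e3
  have hwU : w ∉ U := fun h => hwC (Finset.mem_union_left _ h)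
  have hwC : w ∉ C := fun h => hwC (Finset.mem_union_right _ h)
  have key : exploreVisit.exec m = ((m.storeNat 5 C.card w).storeNat 4 w 1).setNat 7 (C.card + 1) := by
    simp [exploreVisit, hw', hu', e1, e2, hA, hv, hwv, e3, h.list.card]
  rw [key]
  refine ⟨insert w C, Finset.subset_insert _ _, ?_, ?_, fun _ _ => Finset.mem_insert_self _ _⟩
  · refine ⟨Finset.mem_insert_of_mem h.root, ?_, ?_, ?_, ⟨?_, ?_⟩, ?_, ?_⟩
    · exact Finset.insert_subset (Finset.mem_range.2 hw) h.subset
    · simp [h.avoid, Ne.symm hwv]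
    · simp [h.disj, hwU]
    · simp [Finset.card_insert_of_notMem hwC]
    · rw [Finset.card_insert_of_notMem hwC, Finset.range_add_one, Finset.image_insert]
      congr 1
      · simp
      · conv_rhs => rw [← h.list.image]
        refine Finset.image_congr fun p hp => ?_
        have : p ≠ C.card := (Finset.mem_range.1 hp).ne
        simp [this]
    · intro z hz
      have := h.mark z hz
      simp only [Memory.setNat_natArr, Memory.storeNat_natArr, if_true, Finset.union_insert,
        Finset.mem_insert]
      by_cases hzw : z = w
      · simp [hzw]
      · simpa [hzw] using this
    · intro z hz
      rcases Finset.mem_insert.1 hz with rfl | hz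
      · exact (h.conn u hu).tail ⟨hA, fun h2 => h.avoid (h2 ▸ hu), hwv⟩
      · exact h.conn z hz
  · intro p hp
    simp [hp.ne]

/-- The list serves as the queue of the search. Once the position has passed its end, nothing is
added any more; this is the last clause. -/
theorem exploreNode_spec (hm : HasInput n A α q m) {v i p : ℕ} {U C : Finset ℕ}
    (hsymm : ∀ u w, A u w → A w u) (hlt : ∀ u w, A u w → w < n) (hv : m.nat 3 = v)
    (hp' : m.nat 8 = p)
    (hU : ∀ u ∈ U, ∀ w, A u w → w ≠ v → w ∈ U) (h : IsExplored n A v i U C m) :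
    Halts exploreNode m (40 * n + 20) fun m' => ∃ C', C ⊆ C' ∧ IsExplored n A v i U C' m' ∧
      (∀ p < C.card, m'.natArr 5 p = m.natArr 5 p) ∧
      (∀ w, p < C'.card → A (m'.natArr 5 p) w → w ≠ v → w ∈ C') ∧
      (C.card ≤ p → C' = C) := by
  refine Halts.mono (Halts.cond (T := 10 + (n * 37 + 5)) (fun hlen => ?_) (fun hlen => ?_))
    (T := 3 + (10 + (n * 37 + 5))) (by omega) fun _ _ h => h
  · have hpC : p < C.card := by simpa [hp', h.list.card] using hlen
    refine Halts.mono (Halts.seq (halts_of_loopFree (.setNat 10 (.get 5 (.var 8))) m)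
      fun m₁ f₁ h₁ => Halts.forLoop (x := 9) (y := 0) (p := exploreVisit) (T := 30)
      (fun w m' => ∃ C', C ⊆ C' ∧ IsExplored n A v i U C' m' ∧
        (∀ p < C.card, m'.natArr 5 p = m.natArr 5 p) ∧
        (∀ z < w, A (m.natArr 5 p) z → z ≠ v → z ∈ C')) (by rw [f₁.nat 0, hm.size]) ?_ ?_)
      ?_ ?_
    · subst h₁
      exact ⟨C, subset_rfl, ⟨h.root, h.subset, h.avoid, h.disj,
        ⟨by simpa using h.list.card, by simpa using h.list.image⟩, by simpa using h.mark, h.conn⟩,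
        by simp, by simp⟩
    · rintro w hw m' f hx ⟨C', hCC', hC', hL, hN⟩
      refine (exploreVisit_spec (u := m.natArr 5 p) ((hm.of_frame f₁).of_frame f) hsymm
        (by rw [f.nat 3, f₁.nat 3, hv]) hw hx ?_ hU hC' ?_).mono le_rfl ?_
      · rw [f.nat 10, h₁]
        simp [hp']
      · rw [← hL p hpC]
        exact hC'.list.mem (hpC.trans_le (Finset.card_le_card hCC'))
      · rintro m'' - ⟨C'', h1, h2, h3, h4⟩ - -
        refine ⟨C'', hCC'.trans h1, ⟨h2.root, h2.subset, h2.avoid, h2.disj,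
          ⟨by simpa using h2.list.card, by simpa using h2.list.image⟩, by simpa using h2.mark,
          h2.conn⟩, ?_, ?_⟩
        · intro p' hp'
          exact (h3 p' (hp'.trans_le (Finset.card_le_card hCC'))).trans (hL p' hp')
        · intro z hz hA hzv
          rcases Nat.lt_succ_iff_lt_or_eq.1 hz with hz | rfl
          · exact h1 (hN z hz hA hzv)
          · exact h4 hA hzv
    · have : Program.cost (.setNat 10 (.get 5 (.var 8))) ≤ 10 := by decide
      omega
    · rintro m' - ⟨C', h1, h2, h3, h4⟩
      refine ⟨C', h1, h2, h3, fun w _ hA hwv => ?_, fun hle => ?_⟩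
      · rw [h3 p hpC] at hA
        exact h4 w (hlt _ _ hA) hA hwv
      · omega
  · refine (halts_of_loopFree .nop m).mono (by simp [Program.cost]; omega) ?_
    rintro m' - rfl
    refine ⟨C, subset_rfl, h, fun _ _ => rfl, fun w hp => ?_, fun _ => rfl⟩
    simp [hp', h.list.card] at hlen
    omega

/-- The search runs through `n` positions whatever the size of the component, as no list is longer
than `n`; surplus rounds do nothing. -/
theorem explore_spec (hm : HasInput n A α q m) {v i : ℕ} {U : Finset ℕ}
    (hsymm : ∀ u w, A u w → A w u) (hlt : ∀ u w, A u w → w < n) (hv : m.nat 3 = v)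
    (hi : m.nat 4 = i) (hin : i < n) (hiv : i ≠ v) (hiU : i ∉ U)
    (hU : ∀ u ∈ U, ∀ w, A u w → w ≠ v → w ∈ U)
    (hmark : ∀ u < n, m.natArr 4 u = if u ∈ U then 1 else 0) :
    Halts explore m (100 * n ^ 2) fun m' => ∃ C, IsExplored n A v i U C m' ∧
      ∀ u ∈ C, ∀ w, A u w → w ≠ v → w ∈ C := by
  refine Halts.mono (Halts.seq (halts_of_loopFree exploreInit m) fun m₁ f₁ h₁ =>
    Halts.forLoop (x := 8) (y := 0) (p := exploreNode) (T := 40 * n + 20)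
    (fun p m' => ∃ C, IsExplored n A v i U C m' ∧
      ∀ p' < p, p' < C.card → ∀ w, A (m'.natArr 5 p') w → w ≠ v → w ∈ C)
    (by rw [f₁.nat 0, hm.size]) ?_ ?_) ?_ ?_
  · subst h₁
    refine ⟨{i}, ⟨by simp, by simpa using hin, by simpa using Ne.symm hiv, by simpa using hiU,
      ⟨by simp [exploreInit], by simp [exploreInit, hi]⟩, ?_, ?_⟩, by simp⟩
    · intro u hu
      have := hmark u hu
      by_cases hui : u = i
      · simp [exploreInit, hui, hi]
      · simpa [exploreInit, hui, hi] using this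
    · intro u hu
      rw [Finset.mem_singleton.1 hu]
  · rintro p hp m' f hx ⟨C, hC, hN⟩
    refine (exploreNode_spec ((hm.of_frame f₁).of_frame f) hsymm hlt
      (by rw [f.nat 3, f₁.nat 3, hv]) hx hU hC).mono le_rfl ?_
    rintro m'' - ⟨C', h1, h2, h3, h4, h5⟩ - -
    refine ⟨C', ⟨h2.root, h2.subset, h2.avoid, h2.disj,
          ⟨by simpa using h2.list.card, by simpa using h2.list.image⟩, by simpa using h2.mark,
          h2.conn⟩, ?_⟩
    intro p' hp' hpC' w hA hwv
    simp only [Memory.setNat_natArr] at hA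
    rcases Nat.lt_succ_iff_lt_or_eq.1 hp' with hlt | rfl
    · by_cases hpC : p' < C.card
      · rw [h3 p' hpC] at hA
        exact h1 (hN p' hlt hpC w hA hwv)
      -- Position `p'` was already behind the end of the list, so the list cannot have grown.
      · rw [h5 (by omega)] at hpC'
        exact absurd hpC' hpC
    · exact h4 w hpC' hA hwv
  · have : exploreInit.cost ≤ 20 := by decide
    have : n * (40 * n + 20 + 7) = 40 * n ^ 2 + 27 * n := by ring
    have : n ≤ n ^ 2 := Nat.le_self_pow (by decide) n
    have : 1 ≤ n := by omega
    omega
  · rintro m' - ⟨C, hC, hN⟩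
    refine ⟨C, hC, fun u hu w hA hwv => ?_⟩
    obtain ⟨p, hp, rfl⟩ := hC.list.exists hu
    refine hN p ?_ hp w hA hwv
    calc p < C.card := hp
      _ ≤ (Finset.range n).card := Finset.card_le_card hC.subset
      _ = n := Finset.card_range n

end

end PageRankGame

namespace PageRankGame

/-! # Enumerating the subsets of a set of neighbours -/

def masksAppend : Program :=
  .storeNat 6 (.add (.var 11) (.var 12)) (.add (.get 6 (.var 12)) (.get 3 (.var 10)))

/-- If node `p` of the list is a neighbour of the player, double the list of subsets. -/
def masksNode : Program :=
  .seq (.setNat 10 (.get 5 (.var 8)))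
    (.cond (.natEq (.get 0 (.add (.get 2 (.var 3)) (.var 10))) (.const 1))
      (.seq (forLoop 12 11 masksAppend) (.setNat 11 (.add (.var 11) (.var 11)))) .nop)

def masksInit : Program := .seq (.storeNat 6 (.const 0) (.const 0)) (.setNat 11 (.const 1))

/-- List the codes of all sets of neighbours of node `3` in the list of nodes. -/
def masks : Program := .seq masksInit (forLoop 8 7 masksNode)

/-- Array `6` lists the codes of the subsets of `D`. -/
structure HoldsMasks (D : Finset ℕ) (m : Memory) : Prop where
  count : m.nat 11 = 2 ^ D.card
  sound : ∀ x < 2 ^ D.card, ∃ S ⊆ D, m.natArr 6 x = code S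
  complete : ∀ S ⊆ D, ∃ x < 2 ^ D.card, m.natArr 6 x = code S
  last : m.natArr 6 (2 ^ D.card - 1) = code D

theorem HoldsMasks.of_frame {D : Finset ℕ} {p : Program} {m m' : Memory} (h : HoldsMasks D m)
    (f : Frame p m m') (h11 : p.writesNat 11 = false := by decide)
    (h6 : p.writesNatArr 6 = false := by decide) : HoldsMasks D m' :=
  ⟨by rw [f.nat' 11 h11, h.count], by rw [f.natArr' 6 h6]; exact h.sound,
    by rw [f.natArr' 6 h6]; exact h.complete, by rw [f.natArr' 6 h6]; exact h.last⟩

/-- The second half of the new list consists of the old sets with `u` added. The full set therefore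
stays in the last place, where `closeGroup` looks for it. -/
theorem HoldsMasks.double {D : Finset ℕ} {m m' : Memory} (h : HoldsMasks D m) {u : ℕ} (hu : u ∉ D)
    (hc : m'.nat 11 = 2 ^ D.card + 2 ^ D.card)
    (hlo : ∀ x < 2 ^ D.card, m'.natArr 6 x = m.natArr 6 x)
    (hhi : ∀ x < 2 ^ D.card, m'.natArr 6 (2 ^ D.card + x) = m.natArr 6 x + 2 ^ u) :
    HoldsMasks (insert u D) m' := by
  have hcard : 2 ^ (insert u D).card = 2 ^ D.card + 2 ^ D.card := by
    rw [Finset.card_insert_of_notMem hu, pow_succ, mul_two]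
  refine ⟨by rw [hc, hcard], fun x hx => ?_, fun S hS => ?_, ?_⟩
  · rw [hcard] at hx
    by_cases hx' : x < 2 ^ D.card
    · obtain ⟨S, hS, e⟩ := h.sound x hx'
      exact ⟨S, hS.trans (Finset.subset_insert _ _), by rw [hlo x hx', e]⟩
    · obtain ⟨y, rfl⟩ : ∃ y, x = 2 ^ D.card + y := ⟨x - 2 ^ D.card, by omega⟩
      obtain ⟨S, hS, e⟩ := h.sound y (by omega)
      refine ⟨insert u S, Finset.insert_subset_insert _ hS, ?_⟩
      rw [hhi y (by omega), e, code_insert fun h => hu (hS h)]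
  · rw [hcard]
    by_cases huS : u ∈ S
    · obtain ⟨x, hx, e⟩ := h.complete (S.erase u) (by rwa [← Finset.subset_insert_iff])
      refine ⟨2 ^ D.card + x, by omega, ?_⟩
      rw [hhi x hx, e, ← code_insert (Finset.notMem_erase u S), Finset.insert_erase huS]
    · obtain ⟨x, hx, e⟩ := h.complete S ((Finset.subset_insert_iff_of_notMem huS).1 hS)
      exact ⟨x, by omega, by rw [hlo x hx, e]⟩
  · have hpos : 0 < 2 ^ D.card := by positivity
    rw [hcard, show 2 ^ D.card + 2 ^ D.card - 1 = 2 ^ D.card + (2 ^ D.card - 1) by omega,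
      hhi _ (by omega), h.last, code_insert hu]

section

variable {n : ℕ} {A : ℕ → ℕ → Prop} {α : ℝ} {q : ℕ → ℝ} {m : Memory}

open Classical in
theorem masksNode_spec (hm : HasInput n A α q m) {v p k : ℕ} {C D : Finset ℕ} (hvn : v < n)
    (hv : m.nat 3 = v) (hL : HoldsList C m) (hC : C ⊆ Finset.range n) (hp : p < C.card)
    (hp' : m.nat 8 = p) (hD : HoldsMasks D m) (hu : m.natArr 5 p ∉ D) (hk : D.card ≤ k) :
    Halts masksNode m (20 * 2 ^ k + 50)
      (HoldsMasks (if A v (m.natArr 5 p) then insert (m.natArr 5 p) D else D)) := by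
  obtain ⟨u, hu'⟩ : ∃ u, m.natArr 5 p = u := ⟨_, rfl⟩
  have hun : u < n := by
    rw [← hu']
    exact Finset.mem_range.1 (hC (hL.mem hp))
  rw [hu'] at hu ⊢
  refine Halts.mono (Halts.seq (halts_of_loopFree (.setNat 10 (.get 5 (.var 8))) m)
    fun m₁ f₁ h₁ => Halts.cond (T := 20 * 2 ^ k + 20) (fun hA => ?_) (fun hA => ?_)) ?_
    fun _ _ h => h
  · have h10 : m₁.nat 10 = u := by rw [h₁]; simp [hp', hu']
    have hmask := hD.of_frame f₁
    have hA : A v u := by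
      by_contra hA'
      have := (hm.of_frame f₁).adj v hvn u hun
      rw [if_neg hA'] at this
      simp [f₁.nat 3, hv, h10, (hm.of_frame f₁).mul v hvn, this] at hA
    rw [if_pos hA]
    refine Halts.mono (Halts.seq (R := HoldsMasks (insert u D))
      (Halts.forLoop (x := 12) (y := 11) (p := masksAppend) (T := 10)
      (fun t m' => (∀ x < 2 ^ D.card, m'.natArr 6 x = m₁.natArr 6 x) ∧
        ∀ x < t, m'.natArr 6 (2 ^ D.card + x) = m₁.natArr 6 x + 2 ^ u) hmask.count ?_ ?_)
      fun m₂ f₂ h₂ => Halts.of_exec (T := 10) ?_ (by decide)) ?_ fun _ _ h => h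
    · simp
    · rintro t ht m' f hx ⟨hlo, hhi⟩
      refine (halts_of_loopFree masksAppend m').mono (by decide) ?_
      rintro m'' - rfl - -
      have e1 : m'.nat 10 = u := by rw [f.nat 10, h10]
      have e2 : m'.nat 11 = 2 ^ D.card := by rw [f.nat 11, hmask.count]
      have e3 : m'.natArr 3 u = 2 ^ u := by rw [f.natArr 3, (hm.of_frame f₁).pow u hun]
      constructor
      · intro x hx
        simp [masksAppend, e1, e2, hlo x hx]
        omega
      · intro x hx'
        rcases Nat.lt_succ_iff_lt_or_eq.1 hx' with h | rfl
        · have : x ≠ t := by omega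
          simp [masksAppend, e1, e2, this, hhi x h, hx]
        · simp [masksAppend, e1, e2, e3, hx, hlo x ht]
    · have e2 : m₂.nat 11 = 2 ^ D.card := by rw [f₂.nat 11, hmask.count]
      exact hmask.double hu (by simp [e2]) (by simpa using h₂.1) (by simpa using h₂.2)
    · have h2 : 2 ^ D.card ≤ 2 ^ k := Nat.pow_le_pow_right (by decide) hk
      omega
  · have h10 : m₁.nat 10 = u := by rw [h₁]; simp [hp', hu']
    have hA : ¬ A v u := by
      intro hA'
      have := (hm.of_frame f₁).adj v hvn u hun
      rw [if_pos hA'] at this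
      simp [f₁.nat 3, hv, h10, (hm.of_frame f₁).mul v hvn, this] at hA
    rw [if_neg hA]
    refine (halts_of_loopFree .nop m₁).mono (by simp [Program.cost]) ?_
    rintro m' - rfl
    exact hD.of_frame f₁
  · have h1 : Program.cost (.setNat 10 (.get 5 (.var 8))) ≤ 10 := by decide
    have h2 : Test.size (.natEq (.get 0 (.add (.get 2 (.var 3)) (.var 10))) (.const 1)) ≤ 20 := by
      decide
    omega

open Classical in
theorem masks_spec (hm : HasInput n A α q m) {v k : ℕ} {C : Finset ℕ} (hvn : v < n)
    (hv : m.nat 3 = v) (hL : HoldsList C m) (hC : C ⊆ Finset.range n)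
    (hk : (C.filter (A v)).card ≤ k) :
    Halts masks m (C.card * (20 * 2 ^ k + 57) + 20) (HoldsMasks (C.filter (A v))) := by
  refine Halts.mono (Halts.seq (halts_of_loopFree masksInit m) fun m₁ f₁ h₁ =>
    Halts.forLoop (x := 8) (y := 7) (p := masksNode) (T := 20 * 2 ^ k + 50)
    (fun p m' => HoldsMasks (((Finset.range p).image (m.natArr 5)).filter (A v)) m')
    (by rw [f₁.nat 7, hL.card]) ?_ ?_) ?_ ?_
  · subst h₁
    refine ⟨by simp [masksInit], fun x hx => ⟨∅, by simp, ?_⟩, fun S hS => ⟨0, by simp, ?_⟩, ?_⟩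
    · simp at hx
      simp [masksInit, hx, code_empty]
    · simp at hS
      simp [masksInit, hS, code_empty]
    · simp [masksInit, code_empty]
  · rintro p hp m' f hx hI
    have e5 : m'.natArr 5 = m.natArr 5 := by rw [f.natArr 5, f₁.natArr 5]
    have hsub : (Finset.range p).image (m.natArr 5) ⊆ C := by
      conv_rhs => rw [← hL.image]
      exact Finset.image_subset_image (Finset.range_subset_range.2 hp.le)
    refine (masksNode_spec ((hm.of_frame f₁).of_frame f) hvn (by rw [f.nat 3, f₁.nat 3, hv])
      ((hL.of_frame f₁).of_frame f) hC hp hx hI ?_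
      ((Finset.card_le_card (Finset.filter_subset_filter _ hsub)).trans hk)).mono le_rfl ?_
    -- The list has no repetitions, so its node at position `p` is new.
    · rw [e5]
      intro h
      obtain ⟨p', hp', e⟩ := Finset.mem_image.1 (Finset.mem_filter.1 h).1
      have hp' := Finset.mem_range.1 hp'
      have := hL.injOn (Finset.mem_coe.2 (Finset.mem_range.2 (hp'.trans hp)))
        (Finset.mem_coe.2 (Finset.mem_range.2 hp)) e
      omega
    · rintro m'' - h - -
      rw [Finset.range_add_one, Finset.image_insert, Finset.filter_insert]
      rw [e5] at h
      exact ⟨by simpa using h.count, h.sound, h.complete, h.last⟩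
  · have : masksInit.cost ≤ 10 := by decide
    rw [show 20 * 2 ^ k + 50 + 7 = 20 * 2 ^ k + 57 by rfl]
    omega
  · intro m' _ h
    rwa [hL.image] at h

end

end PageRankGame

namespace PageRankGame

/-! # Evaluating a set of neighbours -/

/-- Is the node at list position `x` adjacent to the node at list position `y`? -/
def linkExpr (x y : ℕ) : NatExpr := .get 0 (.add (.get 2 (.get 5 (.var x))) (.get 5 (.var y)))

def buildCount : Program := .setNat 19 (.add (.var 19) (linkExpr 16 17))

def buildEntry : Program :=
  .storeReal 2 (entry 16 17) (.div (.mul (.sub (.cast (.const 1)) (.get 0 (.const 0)))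
    (.cast (linkExpr 16 17))) (.cast (.var 19)))

def buildVector : Program :=
  .storeReal 3 (.var 16) (.div (.mul (.sub (.cast (.const 1)) (.get 0 (.const 0)))
    (.cast (.get 7 (.get 5 (.var 16))))) (.cast (.var 19)))

def buildRow : Program :=
  .seq (.setNat 19 (.get 7 (.get 5 (.var 16))))
    (.seq (forLoop 17 7 buildCount) (.seq buildVector (forLoop 17 7 buildEntry)))

/-- Write down the equations of the hitting probabilities. -/
def build : Program := forLoop 16 7 buildRow

def collectStep : Program :=
  .seq (.storeReal 7 (.const 0) (.add (.get 7 (.const 0))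
      (.mul (.get 1 (.get 5 (.var 16))) (.get 3 (.var 16)))))
    (.seq (.storeReal 8 (.const 0) (.add (.get 8 (.const 0))
        (.mul (.cast (.get 7 (.get 5 (.var 16)))) (.get 3 (.var 16)))))
      (.setNat 15 (.add (.var 15) (.get 7 (.get 5 (.var 16))))))

def collectInit : Program :=
  .seq (.storeReal 7 (.const 0) (.cast (.const 0)))
    (.seq (.storeReal 8 (.const 0) (.cast (.const 0))) (.setNat 15 (.const 0)))

/-- Compute the entry mass, the return mass and the size of the current set. -/
def collect : Program := .seq collectInit (forLoop 16 7 collectStep)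

section

variable {n : ℕ} {A : ℕ → ℕ → Prop} {α : ℝ} {q : ℕ → ℝ} {m : Memory} {C S : Finset ℕ}

/-- Array `7` is the indicator function of `S`. -/
def HoldsSet (n : ℕ) (S : Finset ℕ) (m : Memory) : Prop :=
  ∀ u < n, m.natArr 7 u = if u ∈ S then 1 else 0

theorem HoldsSet.of_frame {p : Program} {m m' : Memory} (h : HoldsSet n S m) (f : Frame p m m')
    (h7 : p.writesNatArr 7 = false := by decide) : HoldsSet n S m' := by
  intro u hu
  rw [f.natArr' 7 h7, h u hu]

open Classical in
theorem HasInput.eval_linkExpr (hm : HasInput n A α q m) (hL : HoldsList C m)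
    (hC : C ⊆ Finset.range n) {x y a b : ℕ} (hx : m.nat x = a) (hy : m.nat y = b)
    (ha : a < C.card) (hb : b < C.card) :
    (linkExpr x y).eval m = if A (m.natArr 5 a) (m.natArr 5 b) then 1 else 0 := by
  have hau := Finset.mem_range.1 (hC (hL.mem ha))
  have hbu := Finset.mem_range.1 (hC (hL.mem hb))
  simp [linkExpr, hx, hy, hm.mul _ hau, hm.adj _ hau _ hbu]

theorem HoldsList.sum {M : Type*} [AddCommMonoid M] (hL : HoldsList C m) (f : ℕ → M) :
    ∑ p ∈ Finset.range C.card, f (m.natArr 5 p) = ∑ u ∈ C, f u := by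
  have := Finset.sum_image (f := f) hL.injOn
  rw [← this, hL.image]

open Classical in
theorem HoldsList.linkCount_eq (hL : HoldsList C m) (u : ℕ) :
    linkCount A C S u = (if u ∈ S then 1 else 0) +
      ∑ p ∈ Finset.range C.card, if A u (m.natArr 5 p) then 1 else 0 := by
  rw [hL.sum (fun w => if A u w then 1 else 0), linkCount, Finset.card_filter, add_comm]

/-- Variable `19` first counts the links of the node, including the one to the player if the node is
in `S`; this count is the common denominator of the row. -/
theorem buildRow_spec (hm : HasInput n A α q m) (hL : HoldsList C m) (hC : C ⊆ Finset.range n)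
    (hS : HoldsSet n S m) {a : ℕ} (ha : a < C.card) (ha' : m.nat 16 = a) {P : ℕ → ℕ → ℝ}
    {b : ℕ → ℝ} (hs : HoldsSystem n C.card P b m) :
    Halts buildRow m (70 * C.card + 50) (HoldsSystem n C.card
      (fun i j => if i = a then moveProb A (1 - α) C S (m.natArr 5 i) (m.natArr 5 j) else P i j)
      (fun i => if i = a then exitProb A (1 - α) C S (m.natArr 5 i) else b i)) := by
  classical
  have hCn : C.card ≤ n := by simpa using Finset.card_le_card hC
  have hau := Finset.mem_range.1 (hC (hL.mem ha))
  refine Halts.mono (Halts.seq (halts_of_loopFree (.setNat 19 (.get 7 (.get 5 (.var 16)))) m)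
    fun m₁ f₁ h₁ => Halts.seq (Halts.forLoop (x := 17) (y := 7) (p := buildCount) (T := 15)
      (fun t m' => m'.nat 19 = (if m.natArr 5 a ∈ S then 1 else 0) +
        ∑ p ∈ Finset.range t, if A (m.natArr 5 a) (m.natArr 5 p) then 1 else 0)
      (by rw [f₁.nat 7, hL.card]) ?_ ?_)
    fun m₂ f₂ h₂ => Halts.seq (Halts.of_exec (p := buildVector) (T := 20)
      (Q := HoldsSystem n C.card P
        (fun i => if i = a then exitProb A (1 - α) C S (m.natArr 5 i) else b i)) ?_ (by decide))
    fun m₃ f₃ h₃ => Halts.forLoop (x := 17) (y := 7) (p := buildEntry) (T := 30)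
      (fun t m' => HoldsSystem n C.card
        (fun i j => if i = a ∧ j < t then moveProb A (1 - α) C S (m.natArr 5 i) (m.natArr 5 j)
          else P i j)
        (fun i => if i = a then exitProb A (1 - α) C S (m.natArr 5 i) else b i) m')
      (by rw [f₃.nat 7, f₂.nat 7, f₁.nat 7, hL.card]) ?_ ?_) ?_ ?_
  · rw [h₁]
    simp [ha', hS _ hau]
  · rintro t ht m' f hx hI
    refine Halts.of_exec ?_ (by decide)
    intro _ _
    have e := ((hm.of_frame f₁).of_frame f).eval_linkExpr ((hL.of_frame f₁).of_frame f) hC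
      (x := 16) (y := 17) (by rw [f.nat 16, f₁.nat 16, ha']) hx ha ht
    rw [f.natArr 5, f₁.natArr 5] at e
    simp only [buildCount, Program.exec, Memory.setNat_nat, NatExpr.eval, e, hI,
      Finset.sum_range_succ]
    simp [add_assoc]
  · rw [← hL.linkCount_eq] at h₂
    have e16 : m₂.nat 16 = a := by rw [f₂.nat 16, f₁.nat 16, ha']
    have e7 : m₂.natArr 7 (m.natArr 5 a) = if m.natArr 5 a ∈ S then 1 else 0 := by
      rw [f₂.natArr 7, f₁.natArr 7, hS _ hau]
    constructor
    · intro i hi j hj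
      have : m₂.realArr 2 (i * n + j) = P i j := by
        rw [f₂.realArr 2, f₁.realArr 2, hs.matrix i hi j hj]
      simpa [buildVector] using this
    · intro i hi
      have hb : m₂.realArr 3 i = b i := by rw [f₂.realArr 3, f₁.realArr 3, hs.vector i hi]
      have e5 : m₂.natArr 5 = m.natArr 5 := by rw [f₂.natArr 5, f₁.natArr 5]
      have e0 : m₂.realArr 0 0 = α := ((hm.of_frame f₁).of_frame f₂).alpha
      by_cases hia : i = a
      · simp [buildVector, hia, e16, e5, e7, e0, h₂, exitProb, ite_div]
      · simp [buildVector, hia, e16, hb]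
  · exact ⟨by simpa using h₃.matrix, by simpa using h₃.vector⟩
  · rintro t ht m' f hx hI
    have hm' := (((hm.of_frame f₁).of_frame f₂).of_frame f₃).of_frame f
    have e16 : m'.nat 16 = a := by rw [f.nat 16, f₃.nat 16, f₂.nat 16, f₁.nat 16, ha']
    have e19 : m'.nat 19 = linkCount A C S (m.natArr 5 a) := by
      rw [f.nat 19, f₃.nat 19, h₂, ← hL.linkCount_eq]
    have e := hm'.eval_linkExpr ((((hL.of_frame f₁).of_frame f₂).of_frame f₃).of_frame f) hC
      (x := 16) (y := 17) e16 hx ha ht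
    rw [f.natArr 5, f₃.natArr 5, f₂.natArr 5, f₁.natArr 5] at e
    have e2 := hm'.mul a (by omega)
    refine Halts.of_exec ?_ (by decide)
    intro _ _
    constructor
    · intro i hi j hj
      have hij := hI.matrix i hi j hj
      simp only [buildEntry, entry, Program.exec, NatExpr.eval, RealExpr.eval, e, e16, e19, hx, e2,
        hm'.alpha, Memory.setNat_realArr, Memory.storeReal_realArr, if_true,
        index_inj (show j < n by omega) (show t < n by omega), hij]
      by_cases h1 : i = a ∧ j = t
      · simp [h1, moveProb, ite_div]
      · rw [if_neg h1]
        have : (i = a ∧ j < t + 1) ↔ (i = a ∧ j < t) := by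
          constructor <;> rintro ⟨h2, h3⟩ <;> refine ⟨h2, ?_⟩
          · have : j ≠ t := fun h => h1 ⟨h2, h⟩
            omega
          · omega
        simp only [this]
    · intro i hi
      simpa [buildEntry] using hI.vector i hi
  · have : Program.cost (.setNat 19 (.get 7 (.get 5 (.var 16)))) ≤ 10 := by decide
    omega
  · intro m' _ h
    refine ⟨fun i hi j hj => ?_, h.vector⟩
    rw [h.matrix i hi j hj]
    simp [hj]

theorem build_spec (hm : HasInput n A α q m) (hL : HoldsList C m) (hC : C ⊆ Finset.range n)
    (hS : HoldsSet n S m) :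
    Halts build m (C.card * (70 * C.card + 57) + 5) (HoldsSystem n C.card
      (fun i j => moveProb A (1 - α) C S (m.natArr 5 i) (m.natArr 5 j))
      (fun i => exitProb A (1 - α) C S (m.natArr 5 i))) := by
  refine Halts.mono (Halts.forLoop (x := 16) (y := 7) (p := buildRow) (T := 70 * C.card + 50)
    (fun t m' => ∃ P b, HoldsSystem n C.card P b m' ∧
      (∀ i < t, ∀ j, P i j = moveProb A (1 - α) C S (m.natArr 5 i) (m.natArr 5 j)) ∧
      ∀ i < t, b i = exitProb A (1 - α) C S (m.natArr 5 i)) hL.card ?_ ?_) le_rfl ?_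
  · exact ⟨fun i j => m.realArr 2 (i * n + j), m.realArr 3, ⟨by simp, by simp⟩, by simp, by simp⟩
  · rintro t ht m' f hx ⟨P, b, hs, hP, hb⟩
    refine (buildRow_spec (hm.of_frame f) (hL.of_frame f) hC (hS.of_frame f) ht hx hs).mono
      le_rfl ?_
    rintro m'' - h - -
    rw [f.natArr 5] at h
    refine ⟨_, _, ⟨h.matrix, h.vector⟩, fun i hi j => ?_, fun i hi => ?_⟩
    · split_ifs with hit
      · rfl
      · exact hP i (by omega) j
    · split_ifs with hit
      · rfl
      · exact hb i (by omega)
  · rintro m' - ⟨P, b, hs, hP, hb⟩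
    exact ⟨fun i hi j hj => by rw [hs.matrix i hi j hj, hP i hi],
      fun i hi => by rw [hs.vector i hi, hb i hi]⟩

/-- In the numbering of the list, the equations of the hitting probabilities have the form that
`gauss_spec` requires. -/
theorem HoldsList.isContractive (hL : HoldsList C m) {β : ℝ} (h0 : 0 ≤ β) (h1 : β < 1) :
    IsContractive C.card β (fun i j => moveProb A β C S (m.natArr 5 i) (m.natArr 5 j))
      (fun i => exitProb A β C S (m.natArr 5 i)) (fun i => hit A β C S (m.natArr 5 i)) := by
  refine ⟨fun i _ j _ => moveProb_nonneg h0 _ _, fun i _ => ?_, fun i hi => ?_⟩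
  · rw [hL.sum (moveProb A β C S (m.natArr 5 i))]
    exact sum_moveProb_le h0 _
  · rw [hL.sum (fun w => moveProb A β C S (m.natArr 5 i) w * hit A β C S w)]
    exact hit_isHitting h0 h1 _ (hL.mem hi)

theorem collect_spec (hm : HasInput n A α q m) (hL : HoldsList C m) (hC : C ⊆ Finset.range n)
    (hS : HoldsSet n S m) (hSC : S ⊆ C)
    (hx : ∀ i < C.card, m.realArr 3 i = hit A (1 - α) C S (m.natArr 5 i)) :
    Halts collect m (47 * C.card + 20) fun m' => m'.nat 15 = S.card ∧
      m'.realArr 7 0 = entryMass A (1 - α) q C S ∧ m'.realArr 8 0 = returnMass A (1 - α) C S := by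
  classical
  refine Halts.mono (Halts.seq (halts_of_loopFree collectInit m) fun m₁ f₁ h₁ =>
    Halts.forLoop (x := 16) (y := 7) (p := collectStep) (T := 40)
      (fun t m' => m'.nat 15 = ∑ p ∈ Finset.range t, (if m.natArr 5 p ∈ S then 1 else 0) ∧
        m'.realArr 7 0
          = ∑ p ∈ Finset.range t, q (m.natArr 5 p) * hit A (1 - α) C S (m.natArr 5 p) ∧
        m'.realArr 8 0 = ∑ p ∈ Finset.range t,
          (if m.natArr 5 p ∈ S then hit A (1 - α) C S (m.natArr 5 p) else 0))
      (by rw [f₁.nat 7, hL.card]) ?_ ?_) ?_ ?_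
  · rw [h₁]
    simp [collectInit]
  · rintro t ht m' f h16 ⟨hI1, hI2, hI3⟩
    have htu := Finset.mem_range.1 (hC (hL.mem ht))
    have e5 : m'.natArr 5 = m.natArr 5 := by rw [f.natArr 5, f₁.natArr 5]
    have e7 := ((hS.of_frame f₁).of_frame f) _ htu
    have e1 := ((hm.of_frame f₁).of_frame f).weight _ htu
    have e3 : m'.realArr 3 t = hit A (1 - α) C S (m.natArr 5 t) := by
      rw [f.realArr 3, f₁.realArr 3, hx t ht]
    refine Halts.of_exec ?_ (by decide)
    intro _ _
    simp only [Finset.sum_range_succ]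
    refine ⟨?_, ?_, ?_⟩
    · simp [collectStep, h16, e5, e7, hI1]
    · simp [collectStep, h16, e5, hI2, e1, e3]
    · simp [collectStep, h16, e5, e7, hI3, e3]
  · have : collectInit.cost ≤ 15 := by decide
    omega
  · rintro m' - ⟨h1, h2, h3⟩
    refine ⟨?_, ?_, ?_⟩
    · rw [h1, hL.sum (fun u => if u ∈ S then 1 else 0), ← Finset.card_filter,
        Finset.filter_mem_eq_inter, Finset.inter_eq_right.2 hSC]
    · rw [h2, hL.sum (fun u => q u * hit A (1 - α) C S u)]
      rfl
    · rw [h3, hL.sum (fun u => if u ∈ S then hit A (1 - α) C S u else 0), ← Finset.sum_filter,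
        Finset.filter_mem_eq_inter, Finset.inter_eq_right.2 hSC]
      rfl

end

end PageRankGame

namespace PageRankGame

/-! # Recording the values of all sets of neighbours in a component -/

def storeRecord : Program :=
  .seq (.storeNat 8 (.var 6) (.var 15))
    (.seq (.storeNat 9 (.var 6) (.get 6 (.var 12)))
      (.seq (.storeReal 4 (.var 6) (.get 7 (.const 0)))
        (.seq (.storeReal 5 (.var 6) (.get 8 (.const 0))) (.setNat 6 (.add (.var 6) (.const 1))))))

/-- Evaluate the set with number `x`. -/
def recordSet : Program :=
  .seq (.setNat 13 (.get 6 (.var 12)))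
    (.seq (decode 7) (.seq build (.seq gauss (.seq collect storeRecord))))

def recordSets : Program := forLoop 12 11 recordSet

/-- Record `r` describes the set `S`: its size, its code, and its values under `gQ` and `gH`. -/
structure HoldsRecord (gQ gH : Finset ℕ → ℝ) (r : ℕ) (S : Finset ℕ) (m : Memory) : Prop where
  size : m.natArr 8 r = S.card
  code : m.natArr 9 r = code S
  entry : m.realArr 4 r = gQ S
  ret : m.realArr 5 r = gH S

/-- The records below `R` are the same in both memories. -/
structure SameRecords (R : ℕ) (m m' : Memory) : Prop where
  size : ∀ r < R, m'.natArr 8 r = m.natArr 8 r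
  code : ∀ r < R, m'.natArr 9 r = m.natArr 9 r
  entry : ∀ r < R, m'.realArr 4 r = m.realArr 4 r
  ret : ∀ r < R, m'.realArr 5 r = m.realArr 5 r

theorem SameRecords.trans {R : ℕ} {m m' m'' : Memory} (h : SameRecords R m m')
    (h' : SameRecords R m' m'') : SameRecords R m m'' :=
  ⟨fun r hr => (h'.size r hr).trans (h.size r hr), fun r hr => (h'.code r hr).trans (h.code r hr),
    fun r hr => (h'.entry r hr).trans (h.entry r hr), fun r hr => (h'.ret r hr).trans (h.ret r hr)⟩

theorem SameRecords.anti {R R' : ℕ} {m m' : Memory} (h : SameRecords R m m') (hR : R' ≤ R) :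
    SameRecords R' m m' :=
  ⟨fun r hr => h.size r (hr.trans_le hR), fun r hr => h.code r (hr.trans_le hR),
    fun r hr => h.entry r (hr.trans_le hR), fun r hr => h.ret r (hr.trans_le hR)⟩

theorem SameRecords.of_frame {p : Program} {m m' : Memory} (f : Frame p m m') (R : ℕ)
    (h : p.writesNatArr 8 = false ∧ p.writesNatArr 9 = false := by decide)
    (h' : p.writesRealArr 4 = false ∧ p.writesRealArr 5 = false := by decide) :
    SameRecords R m m' := by
  constructor <;> intro r _
  · rw [f.natArr' 8 h.1]
  · rw [f.natArr' 9 h.2]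
  · rw [f.realArr' 4 h'.1]
  · rw [f.realArr' 5 h'.2]

theorem HoldsRecord.of_same {gQ gH : Finset ℕ → ℝ} {r R : ℕ} {S : Finset ℕ} {m m' : Memory}
    (h : HoldsRecord gQ gH r S m) (hs : SameRecords R m m') (hr : r < R) :
    HoldsRecord gQ gH r S m' :=
  ⟨by rw [hs.size r hr, h.size], by rw [hs.code r hr, h.code], by rw [hs.entry r hr, h.entry],
    by rw [hs.ret r hr, h.ret]⟩

section

variable {n : ℕ} {A : ℕ → ℕ → Prop} {α : ℝ} {q : ℕ → ℝ} {m : Memory} {C S : Finset ℕ}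

/-- Gaussian elimination dominates: `|C|³ ≤ |C| n²`. The factor `|C|` is kept in the bound because
it will be summed over the components. -/
theorem recordSet_spec (hm : HasInput n A α q m) (h0 : 0 < α) (h1 : α < 1)
    (hL : HoldsList C m) (hC : C ⊆ Finset.range n) (hne : C.Nonempty) (hSC : S ⊆ C) {x R : ℕ}
    (hx : m.nat 12 = x) (hcode : m.natArr 6 x = code S) (hR : m.nat 6 = R) :
    Halts recordSet m (C.card * (500 * n ^ 2)) fun m' =>
      HoldsRecord (entryMass A (1 - α) q C) (returnMass A (1 - α) C) R S m' ∧
        SameRecords R m m' ∧ m'.nat 6 = R + 1 := by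
  have hC1 : 1 ≤ C.card := Finset.card_pos.2 hne
  have hCn : C.card ≤ n := by simpa using Finset.card_le_card hC
  refine Halts.mono (Halts.seq (halts_of_loopFree (.setNat 13 (.get 6 (.var 12))) m)
    fun m₁ f₁ h₁ => Halts.seq (decode_spec 7 (by decide) (hm.of_frame f₁) (hSC.trans hC)
      (by rw [h₁]; simp [hx, hcode]))
    fun m₂ f₂ h₂ => Halts.seq (build_spec (S := S) ((hm.of_frame f₁).of_frame f₂)
      ((hL.of_frame f₁).of_frame f₂) hC h₂)
    fun m₃ f₃ h₃ => Halts.seq (gauss_spec (β := 1 - α) (((hm.of_frame f₁).of_frame f₂).of_frame f₃)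
      (by rw [f₃.nat 7, f₂.nat 7, f₁.nat 7, hL.card]) hCn (by linarith) h₃
      (((hL.of_frame f₁).of_frame f₂).isContractive (by linarith) (by linarith)))
    fun m₄ f₄ h₄ => Halts.seq (collect_spec (S := S)
      ((((hm.of_frame f₁).of_frame f₂).of_frame f₃).of_frame f₄)
      ((((hL.of_frame f₁).of_frame f₂).of_frame f₃).of_frame f₄) hC
      ((HoldsSet.of_frame h₂ f₃).of_frame f₄) hSC ?_)
    fun m₅ f₅ ⟨hs, hQ, hH⟩ => Halts.of_exec (p := storeRecord) (T := 30) ?_ (by decide)) ?_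
    fun m' _ h => h
  · intro i hi
    rw [h₄ i hi, f₄.natArr 5, f₃.natArr 5]
  · have e6 : m₅.nat 6 = R := by
      rw [f₅.nat 6, f₄.nat 6, f₃.nat 6, f₂.nat 6, f₁.nat 6, hR]
    have e12 : m₅.nat 12 = x := by
      rw [f₅.nat 12, f₄.nat 12, f₃.nat 12, f₂.nat 12, f₁.nat 12, hx]
    have ec : m₅.natArr 6 x = code S := by
      rw [f₅.natArr 6, f₄.natArr 6, f₃.natArr 6, f₂.natArr 6, f₁.natArr 6, hcode]
    have hsame : SameRecords R m m₅ :=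
      ((((SameRecords.of_frame f₁ R).trans (.of_frame f₂ R)).trans (.of_frame f₃ R)).trans
        (.of_frame f₄ R)).trans (.of_frame f₅ R)
    refine ⟨⟨?_, ?_, ?_, ?_⟩, hsame.trans ⟨?_, ?_, ?_, ?_⟩, ?_⟩
    · simp [storeRecord, e6, hs]
    · simp [storeRecord, e6, e12, ec]
    · simp [storeRecord, e6, hQ]
    · simp [storeRecord, e6, hH]
    · intro r hr
      simp [storeRecord, e6, hr.ne]
    · intro r hr
      simp [storeRecord, e6, hr.ne]
    · intro r hr
      simp [storeRecord, e6, hr.ne]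
    · intro r hr
      simp [storeRecord, e6, hr.ne]
    · simp [storeRecord, e6]
  · have hn1 : 1 ≤ n := hC1.trans hCn
    have hc : Program.cost (.setNat 13 (.get 6 (.var 12))) ≤ 10 := by decide
    have hn2 : n ≤ n ^ 2 := Nat.le_self_pow (by decide) n
    calc _ ≤ 10 + (30 * n ^ 2 + 5 + (C.card * (70 * n ^ 2 + 57) + 5 + (C.card * (200 * n ^ 2) + 5
          + (47 * C.card + 20 + 30)))) := by
          have : C.card ≤ n ^ 2 := hCn.trans hn2
          gcongr
      _ ≤ C.card * (500 * n ^ 2) := by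
          have : 1 ≤ n ^ 2 := hn1.trans hn2
          nlinarith

theorem recordSets_spec (hm : HasInput n A α q m) (h0 : 0 < α) (h1 : α < 1)
    (hL : HoldsList C m) (hC : C ⊆ Finset.range n) (hne : C.Nonempty) {D : Finset ℕ} (hDC : D ⊆ C)
    (hD : HoldsMasks D m) {R : ℕ} (hR : m.nat 6 = R) :
    Halts recordSets m (2 ^ D.card * (C.card * (500 * n ^ 2) + 7) + 5) fun m' =>
      m'.nat 6 = R + 2 ^ D.card ∧ SameRecords R m m' ∧
      (∀ r, R ≤ r → r < R + 2 ^ D.card → ∃ S ⊆ D,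
        HoldsRecord (entryMass A (1 - α) q C) (returnMass A (1 - α) C) r S m') ∧
      (∀ S ⊆ D, ∃ r, R ≤ r ∧ r < R + 2 ^ D.card ∧
        HoldsRecord (entryMass A (1 - α) q C) (returnMass A (1 - α) C) r S m') ∧
      HoldsRecord (entryMass A (1 - α) q C) (returnMass A (1 - α) C) (R + 2 ^ D.card - 1) D m' := by
  refine Halts.mono (Halts.forLoop (x := 12) (y := 11) (p := recordSet)
    (T := C.card * (500 * n ^ 2)) (fun t m' => m'.nat 6 = R + t ∧ SameRecords R m m' ∧
      ∀ x < t, ∀ S ⊆ D, m.natArr 6 x = code S →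
        HoldsRecord (entryMass A (1 - α) q C) (returnMass A (1 - α) C) (R + x) S m') hD.count
    ?_ ?_) le_rfl ?_
  · exact ⟨by simpa using hR, ⟨by simp, by simp, by simp, by simp⟩, by simp⟩
  · rintro t ht m' f hx ⟨hI1, hI2, hI3⟩
    obtain ⟨S, hS, e⟩ := hD.sound t ht
    have e' : m'.natArr 6 t = code S := by rw [f.natArr 6, e]
    refine (recordSet_spec (hm.of_frame f) h0 h1 (hL.of_frame f) hC hne (hS.trans hDC) hx e'
      hI1).mono le_rfl ?_
    rintro m'' - ⟨h1, h2, h3⟩ - -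
    refine ⟨by simp [h3, add_assoc], ?_, fun x hx S' hS' he => ?_⟩
    · have := hI2.trans (h2.anti (by omega))
      exact ⟨this.size, this.code, this.entry, this.ret⟩
    · rcases Nat.lt_succ_iff_lt_or_eq.1 hx with hx | rfl
      · have := (hI3 x hx S' hS' he).of_same h2 (by omega)
        exact ⟨this.size, this.code, this.entry, this.ret⟩
      -- The code determines the set, so there is no choice of `S'`.
      · have hSS : S' = S := code_injective (he.symm.trans e)
        rw [hSS]
        exact ⟨h1.size, h1.code, h1.entry, h1.ret⟩
  · rintro m' - ⟨hI1, hI2, hI3⟩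
    have hpos : 0 < 2 ^ D.card := by positivity
    refine ⟨hI1, hI2, fun r hr hr' => ?_, fun S hS => ?_, ?_⟩
    · obtain ⟨x, rfl⟩ : ∃ x, r = R + x := ⟨r - R, by omega⟩
      obtain ⟨S, hS, e⟩ := hD.sound x (by omega)
      exact ⟨S, hS, hI3 x (by omega) S hS e⟩
    · obtain ⟨x, hx, e⟩ := hD.complete S hS
      exact ⟨R + x, by omega, by omega, hI3 x hx S hS e⟩
    · rw [show R + 2 ^ D.card - 1 = R + (2 ^ D.card - 1) by omega]
      exact hI3 _ (by omega) D subset_rfl hD.last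

end

end PageRankGame

namespace PageRankGame

/-! # The components of the graph without the player -/

/-- Marks left by the previous player must not survive. -/
def clearMark : Program := .storeNat 4 (.var 4) (.const 0)

def gatherInit : Program :=
  .seq (.setNat 5 (.const 0)) (.seq (.setNat 6 (.const 0)) (.seq (.setNat 25 (.const 0))
    (.seq (.storeNat 10 (.const 0) (.const 0)) (.seq (.storeReal 9 (.const 0) (.cast (.const 0)))
      (.storeReal 10 (.const 0) (.cast (.const 0)))))))

/-- Close a group of records and add its last record, the one of the full set, to the totals. -/
def closeGroup : Program :=
  .seq (.storeReal 9 (.const 0)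
      (.add (.get 9 (.const 0)) (.get 4 (.sub (.var 6) (.const 1)))))
    (.seq (.storeReal 10 (.const 0)
        (.add (.get 10 (.const 0)) (.get 5 (.sub (.var 6) (.const 1)))))
      (.seq (.setNat 25 (.add (.var 25) (.get 8 (.sub (.var 6) (.const 1)))))
        (.seq (.setNat 5 (.add (.var 5) (.const 1))) (.storeNat 10 (.var 5) (.var 6)))))

def gatherComponent : Program := .seq explore (.seq masks (.seq recordSets closeGroup))

/-- If node `i` is neither the player nor marked, evaluate its component. -/
def gatherNode : Program :=
  .cond (.natEq (.var 4) (.var 3)) .nop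
    (.cond (.natEq (.get 4 (.var 4)) (.const 0)) gatherComponent .nop)

/-- Evaluate all sets of neighbours in the components of the graph without node `3`. -/
def gather : Program := .seq (forLoop 4 0 clearMark) (.seq gatherInit (forLoop 4 0 gatherNode))

/-- `U` contains with a node all its neighbours other than `v`. -/
def IsClosedAvoiding (A : ℕ → ℕ → Prop) (v : ℕ) (U : Finset ℕ) : Prop :=
  ∀ u ∈ U, ∀ w, A u w → w ≠ v → w ∈ U

open Classical in
/-- The memory holds the records of the sets of neighbours of `v`, in groups that belong to the
parts `U (j + 1) \ U j`. -/
structure HoldsGroups (n : ℕ) (A : ℕ → ℕ → Prop) (v k : ℕ) (gQ gH : Finset ℕ → ℝ) (J : ℕ)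
    (U : ℕ → Finset ℕ) (m : Memory) : Prop where
  start : U 0 = ∅
  start_index : m.natArr 10 0 = 0
  subset : ∀ j ≤ J, U j ⊆ (Finset.range n).erase v
  closed : ∀ j ≤ J, IsClosedAvoiding A v (U j)
  mono : ∀ j < J, U j ⊆ U (j + 1)
  index_mono : ∀ j < J, m.natArr 10 j ≤ m.natArr 10 (j + 1)
  index_le : ∀ j < J, m.natArr 10 (j + 1) ≤ m.natArr 10 j + 2 ^ k
  sound : ∀ j < J, ∀ r, m.natArr 10 j ≤ r → r < m.natArr 10 (j + 1) →
    ∃ S ⊆ (U (j + 1) \ U j).filter (A v), HoldsRecord gQ gH r S m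
  complete : ∀ j < J, ∀ S ⊆ (U (j + 1) \ U j).filter (A v),
    ∃ r, m.natArr 10 j ≤ r ∧ r < m.natArr 10 (j + 1) ∧ HoldsRecord gQ gH r S m
  groups : m.nat 5 = J
  records : m.nat 6 = m.natArr 10 J
  total_entry : m.realArr 9 0 = gQ ((U J).filter (A v))
  total_ret : m.realArr 10 0 = gH ((U J).filter (A v))
  total_size : m.nat 25 = ((U J).filter (A v)).card

theorem IsClosedAvoiding.isSeparated {A : ℕ → ℕ → Prop} {v : ℕ} {U W : Finset ℕ}
    (h : IsClosedAvoiding A v U) (hsymm : ∀ u w, A u w → A w u) (hUW : U ⊆ W) (hv : v ∉ W) :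
    IsSeparated A W U := by
  refine ⟨hUW, fun u hu w hw hwU => ?_⟩
  have hwv : w ≠ v := fun e => hv (e ▸ hw)
  exact ⟨fun hA => hwU (h u hu w hA hwv), fun hA => hwU (h u hu w (hsymm _ _ hA) hwv)⟩

theorem IsClosedAvoiding.union {A : ℕ → ℕ → Prop} {v : ℕ} {U U' : Finset ℕ}
    (h : IsClosedAvoiding A v U) (h' : IsClosedAvoiding A v U') :
    IsClosedAvoiding A v (U ∪ U') := by
  intro u hu w hA hwv
  rcases Finset.mem_union.1 hu with hu | hu
  · exact Finset.mem_union_left _ (h u hu w hA hwv)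
  · exact Finset.mem_union_right _ (h' u hu w hA hwv)

section

variable {n : ℕ} {A : ℕ → ℕ → Prop} {α : ℝ} {q : ℕ → ℝ} {m : Memory} {v k : ℕ}

theorem HoldsGroups.index_le_index {gQ gH : Finset ℕ → ℝ} {J : ℕ} {U : ℕ → Finset ℕ}
    (h : HoldsGroups n A v k gQ gH J U m) {i j : ℕ} (hij : i ≤ j) (hj : j ≤ J) :
    m.natArr 10 i ≤ m.natArr 10 j := by
  induction j, hij using Nat.le_induction with
  | base => exact le_rfl
  | succ j _ ih => exact (ih (by omega)).trans (h.index_mono j (by omega))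

theorem HoldsGroups.congr {gQ gH : Finset ℕ → ℝ} {J : ℕ} {U : ℕ → Finset ℕ} {m' : Memory}
    (h : HoldsGroups n A v k gQ gH J U m) (h5 : m'.nat 5 = m.nat 5) (h6 : m'.nat 6 = m.nat 6)
    (h25 : m'.nat 25 = m.nat 25) (ha8 : m'.natArr 8 = m.natArr 8) (ha9 : m'.natArr 9 = m.natArr 9)
    (ha10 : m'.natArr 10 = m.natArr 10) (hr4 : m'.realArr 4 = m.realArr 4)
    (hr5 : m'.realArr 5 = m.realArr 5) (hr9 : m'.realArr 9 = m.realArr 9)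
    (hr10 : m'.realArr 10 = m.realArr 10) : HoldsGroups n A v k gQ gH J U m' := by
  have hrec : ∀ {r S}, HoldsRecord gQ gH r S m → HoldsRecord gQ gH r S m' := by
    intro r S hr
    exact ⟨by rw [ha8, hr.size], by rw [ha9, hr.code], by rw [hr4, hr.entry], by rw [hr5, hr.ret]⟩
  refine ⟨h.start, by rw [ha10]; exact h.start_index, h.subset, h.closed, h.mono,
    by rw [ha10]; exact h.index_mono, by rw [ha10]; exact h.index_le, ?_, ?_,
    by rw [h5]; exact h.groups, by rw [h6, ha10]; exact h.records,
    by rw [hr9]; exact h.total_entry, by rw [hr10]; exact h.total_ret,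
    by rw [h25]; exact h.total_size⟩
  · rw [ha10]
    intro j hj r hr hr'
    obtain ⟨S, hS, hrS⟩ := h.sound j hj r hr hr'
    exact ⟨S, hS, hrec hrS⟩
  · rw [ha10]
    intro j hj S hS
    obtain ⟨r, hr, hr', hrS⟩ := h.complete j hj S hS
    exact ⟨r, hr, hr', hrec hrS⟩

theorem avoidAdj_connected (hsymm : ∀ u w, A u w → A w u) {i a b : ℕ}
    (ha : Relation.ReflTransGen (avoidAdj A v) i a) (hb : Relation.ReflTransGen (avoidAdj A v) i b) :
    Relation.ReflTransGen (avoidAdj A v) a b := by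
  have : Std.Symm (avoidAdj A v) := ⟨fun x y h => ⟨hsymm _ _ h.1, h.2.2, h.2.1⟩⟩
  exact (symm ha).trans hb

open Classical in
-- The time is bounded in terms of the new component `C`, so that the costs add up to a multiple of
-- `n` over all components. The totals grow by the values of the full set of neighbours in `C`, by
-- additivity.
theorem gatherComponent_spec (hm : HasInput n A α q m) (h0 : 0 < α) (h1 : α < 1)
    (hsymm : ∀ u w, A u w → A w u) (hlt : ∀ u w, A u w → w < n) (hvn : v < n)
    (hk : ∀ D : Finset ℕ, (∀ u ∈ D, A v u) →
      (∀ a ∈ D, ∀ b ∈ D, Relation.ReflTransGen (avoidAdj A v) a b) → D.card ≤ k)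
    (hv : m.nat 3 = v) {i : ℕ} (hi : m.nat 4 = i) (hin : i < n) (hiv : i ≠ v)
    {J : ℕ} {U : ℕ → Finset ℕ} (hG : HoldsGroups n A v k
      (entryMass A (1 - α) q ((Finset.range n).erase v))
      (returnMass A (1 - α) ((Finset.range n).erase v)) J U m)
    (hmark : ∀ u < n, m.natArr 4 u = if u ∈ U J then 1 else 0) (hiU : i ∉ U J) :
    HaltsWith gatherComponent m fun t m' => ∃ C, i ∈ C ∧ Disjoint (U J) C ∧
      t ≤ C.card * (900 * 2 ^ k * n ^ 2) ∧
      (∀ u < n, m'.natArr 4 u = if u ∈ U J ∪ C then 1 else 0) ∧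
      HoldsGroups n A v k (entryMass A (1 - α) q ((Finset.range n).erase v))
        (returnMass A (1 - α) ((Finset.range n).erase v)) (J + 1)
        (fun j => if j ≤ J then U j else U J ∪ C) m' := by
  refine HaltsWith.seq (explore_spec hm hsymm hlt hv hi hin hiv hiU (hG.closed J le_rfl) hmark) ?_
  rintro t₁ m₁ f₁ ⟨ht₁, C, hC, hCcl⟩
  have hne : C.Nonempty := ⟨i, hC.root⟩
  set D := C.filter (A v) with hD
  have hDC : D ⊆ C := Finset.filter_subset _ _
  -- The only place in the gathering where the bound on block degrees enters: these neighbours are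
  -- joined by walks that avoid `v`.
  have hDk : D.card ≤ k := hk D (fun u hu => (Finset.mem_filter.1 hu).2) fun a ha b hb =>
    avoidAdj_connected hsymm (hC.conn a (hDC ha)) (hC.conn b (hDC hb))
  have hm₁ := hm.of_frame f₁
  refine HaltsWith.mono (Halts.seq (masks_spec hm₁ hvn (by rw [f₁.nat 3, hv]) hC.list hC.subset hDk)
    fun m₂ f₂ h₂ => Halts.seq (recordSets_spec (R := m.nat 6) (hm₁.of_frame f₂) h0 h1
      (hC.list.of_frame f₂) hC.subset hne hDC h₂ (by rw [f₂.nat 6, f₁.nat 6]))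
    fun m₃ f₃ ⟨h6, hsame, hsound, hcompl, hlast⟩ => Halts.of_exec (p := closeGroup) (T := 60)
      (Q := fun m' => (∀ u < n, m'.natArr 4 u = if u ∈ U J ∪ C then 1 else 0) ∧
        HoldsGroups n A v k (entryMass A (1 - α) q ((Finset.range n).erase v))
        (returnMass A (1 - α) ((Finset.range n).erase v)) (J + 1)
        (fun j => if j ≤ J then U j else U J ∪ C) m') ?_ (by decide)) ?_
  · have hβ0 : 0 ≤ 1 - α := by linarith
    have hβ1 : 1 - α < 1 := by linarith
    have hvW : v ∉ (Finset.range n).erase v := Finset.notMem_erase _ _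
    have hCW : C ⊆ (Finset.range n).erase v := fun u hu =>
      Finset.mem_erase.2 ⟨fun e => hC.avoid (e ▸ hu), hC.subset hu⟩
    have hCs : IsSeparated A ((Finset.range n).erase v) C :=
      IsClosedAvoiding.isSeparated hCcl hsymm hCW hvW
    have hUs := (hG.closed J le_rfl).isSeparated hsymm (hG.subset J le_rfl) hvW
    -- The system was solved on `C` only; by separation the values agree with those on the whole
    -- graph without `v`.
    have conv : ∀ {r S}, S ⊆ D → HoldsRecord (entryMass A (1 - α) q C) (returnMass A (1 - α) C) r S m₃ →
        HoldsRecord (entryMass A (1 - α) q ((Finset.range n).erase v))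
          (returnMass A (1 - α) ((Finset.range n).erase v)) r S m₃ := by
      intro r S hS hr
      refine ⟨hr.size, hr.code, ?_, ?_⟩
      · rw [hr.entry, entryMass_of_isSeparated hβ0 hβ1 q hCs (hS.trans hDC)]
      · rw [hr.ret, returnMass_of_isSeparated hβ0 hβ1 hCs (hS.trans hDC)]
    have hlast' := conv subset_rfl hlast
    have hsame' : SameRecords (m.nat 6) m m₃ :=
      ((SameRecords.of_frame f₁ _).trans (.of_frame f₂ _)).trans hsame
    have e5 : m₃.nat 5 = J := by rw [f₃.nat 5, f₂.nat 5, f₁.nat 5, hG.groups]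
    have e25 : m₃.nat 25 = ((U J).filter (A v)).card := by
      rw [f₃.nat 25, f₂.nat 25, f₁.nat 25, hG.total_size]
    have e9 : m₃.realArr 9 0
        = entryMass A (1 - α) q ((Finset.range n).erase v) ((U J).filter (A v)) := by
      rw [f₃.realArr 9, f₂.realArr 9, f₁.realArr 9, hG.total_entry]
    have e10 : m₃.realArr 10 0
        = returnMass A (1 - α) ((Finset.range n).erase v) ((U J).filter (A v)) := by
      rw [f₃.realArr 10, f₂.realArr 10, f₁.realArr 10, hG.total_ret]
    have ea10 : m₃.natArr 10 = m.natArr 10 := by rw [f₃.natArr 10, f₂.natArr 10, f₁.natArr 10]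
    have hidx : ∀ j, (closeGroup.exec m₃).natArr 10 j
        = if j = J + 1 then m.natArr 10 J + 2 ^ D.card else m.natArr 10 j := by
      intro j
      simp [closeGroup, e5, h6, ea10, hG.records]
    have hrec : ∀ {r S}, HoldsRecord (entryMass A (1 - α) q ((Finset.range n).erase v))
        (returnMass A (1 - α) ((Finset.range n).erase v)) r S m₃ →
        HoldsRecord (entryMass A (1 - α) q ((Finset.range n).erase v))
          (returnMass A (1 - α) ((Finset.range n).erase v)) r S (closeGroup.exec m₃) := by
      intro r S hr
      exact ⟨by simpa [closeGroup] using hr.size, by simpa [closeGroup] using hr.code,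
        by simpa [closeGroup] using hr.entry, by simpa [closeGroup] using hr.ret⟩
    have hfilter : (U J ∪ C).filter (A v) = (U J).filter (A v) ∪ D := Finset.filter_union _ _ _
    have hidx_mono : ∀ j ≤ J, m.natArr 10 j ≤ m.nat 6 := by
      intro j hj
      rw [hG.records]
      exact hG.index_le_index hj le_rfl
    have hdiff : (U J ∪ C) \ U J = C := by
      rw [Finset.union_sdiff_left, Finset.sdiff_eq_self_of_disjoint hC.disj.symm]
    refine ⟨?_, ?_⟩
    · intro u hu
      have := hC.mark u hu
      rw [← f₂.natArr 4, ← f₃.natArr 4] at this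
      simpa [closeGroup] using this
    · refine ⟨by simp [hG.start], ?_, ?_, ?_, ?_, ?_, ?_, ?_, ?_, ?_, ?_, ?_, ?_, ?_⟩
      · rw [hidx]
        simp [hG.start_index]
      · intro j _
        split_ifs with h
        · exact hG.subset j h
        · exact Finset.union_subset (hG.subset J le_rfl) hCW
      · intro j _
        split_ifs with h
        · exact hG.closed j h
        · exact (hG.closed J le_rfl).union hCcl
      · intro j hj
        rcases Nat.lt_succ_iff_lt_or_eq.1 hj with h | rfl
        · simpa [h.le, Nat.succ_le_of_lt h] using hG.mono j h
        · simp
      · intro j hj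
        rw [hidx, hidx, if_neg hj.ne]
        rcases Nat.lt_succ_iff_lt_or_eq.1 hj with h | rfl
        · rw [if_neg (by omega)]
          exact hG.index_mono j h
        · rw [if_pos rfl]
          exact Nat.le_add_right _ _
      · intro j hj
        rw [hidx, hidx, if_neg hj.ne]
        rcases Nat.lt_succ_iff_lt_or_eq.1 hj with h | rfl
        · rw [if_neg (by omega)]
          exact hG.index_le j h
        · rw [if_pos rfl]
          exact Nat.add_le_add_left (Nat.pow_le_pow_right (by decide) hDk) _
      · intro j hj r
        rw [hidx, hidx, if_neg hj.ne]
        rcases Nat.lt_succ_iff_lt_or_eq.1 hj with h | rfl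
        · rw [if_neg (by omega)]
          intro hr hr'
          obtain ⟨S, hS, hrS⟩ := hG.sound j h r hr hr'
          refine ⟨S, by simpa [h.le, Nat.succ_le_of_lt h] using hS, hrec (hrS.of_same hsame' ?_)⟩
          exact hr'.trans_le (hidx_mono _ (Nat.succ_le_of_lt h))
        · rw [if_pos rfl]
          intro hr hr'
          obtain ⟨S, hS, hrS⟩ := hsound r (by rwa [hG.records]) (by rwa [hG.records])
          exact ⟨S, by simpa [hdiff] using hS, hrec (conv hS hrS)⟩
      · intro j hj S
        simp only [hidx]
        rw [if_neg hj.ne]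
        rcases Nat.lt_succ_iff_lt_or_eq.1 hj with h | rfl
        · rw [if_neg (show j + 1 ≠ J + 1 by omega)]
          intro hS
          obtain ⟨r, hr, hr', hrS⟩ := hG.complete j h S
            (by simpa [h.le, Nat.succ_le_of_lt h] using hS)
          refine ⟨r, hr, hr', hrec (hrS.of_same hsame' ?_)⟩
          exact hr'.trans_le (hidx_mono _ (Nat.succ_le_of_lt h))
        · rw [if_pos rfl]
          intro hS
          have hS' : S ⊆ D := by simpa [hdiff] using hS
          obtain ⟨r, hr, hr', hrS⟩ := hcompl S hS'
          rw [hG.records] at hr hr'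
          exact ⟨r, hr, hr', hrec (conv hS' hrS)⟩
      · simp [closeGroup, e5]
      · rw [hidx, if_pos rfl, ← hG.records, ← h6]
        simp [closeGroup]
      · simp only [show ¬ J + 1 ≤ J by omega, if_false, hfilter]
        rw [entryMass_union hβ0 hβ1 q hUs hCs hC.disj (Finset.filter_subset _ _) hDC, ← e9]
        simp [closeGroup, h6, hlast'.entry]
      · simp only [show ¬ J + 1 ≤ J by omega, if_false, hfilter]
        rw [returnMass_union hβ0 hβ1 hUs hCs hC.disj (Finset.filter_subset _ _) hDC, ← e10]
        simp [closeGroup, h6, hlast'.ret]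
      · simp only [show ¬ J + 1 ≤ J by omega, if_false, hfilter]
        rw [Finset.card_union_of_disjoint (Finset.disjoint_of_subset_left (Finset.filter_subset _ _)
          (Finset.disjoint_of_subset_right hDC hC.disj)), ← e25]
        simp [closeGroup, h6, hlast'.size]
  · rintro t₂ m' - ⟨ht₂, hmk, hgr⟩
    refine ⟨C, hC.root, hC.disj, ?_, hmk, hgr⟩
    have hC1 : 1 ≤ C.card := Finset.card_pos.2 hne
    have hn1 : 1 ≤ n ^ 2 := Nat.one_le_pow _ _ (by omega)
    have hk1 : 1 ≤ 2 ^ k := Nat.one_le_two_pow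
    have hD2 : 2 ^ D.card ≤ 2 ^ k := Nat.pow_le_pow_right (by decide) hDk
    -- Every stage costs at most a multiple of `X`.
    set X := C.card * 2 ^ k * n ^ 2 with hX
    have e1 : n ^ 2 ≤ X := by
      rw [hX]; exact Nat.le_mul_of_pos_left _ (by positivity)
    have e2 : C.card * 2 ^ k ≤ X := by
      rw [hX]; exact Nat.le_mul_of_pos_right _ (by positivity)
    have e3 : C.card ≤ C.card * 2 ^ k := Nat.le_mul_of_pos_right _ (by positivity)
    have e4 : 2 ^ k ≤ C.card * 2 ^ k := Nat.le_mul_of_pos_left _ hC1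
    have e5 : 2 ^ D.card * (C.card * (500 * n ^ 2) + 7) ≤ 500 * X + 7 * 2 ^ k := by
      calc 2 ^ D.card * (C.card * (500 * n ^ 2) + 7)
          ≤ 2 ^ k * (C.card * (500 * n ^ 2) + 7) := Nat.mul_le_mul_right _ hD2
        _ = 500 * X + 7 * 2 ^ k := by rw [hX]; ring
    have e6 : C.card * (20 * 2 ^ k + 57) = 20 * (C.card * 2 ^ k) + 57 * C.card := by ring
    have e7 : C.card * (900 * 2 ^ k * n ^ 2) = 900 * X := by rw [hX]; ring
    rw [e7]
    omega

end

end PageRankGame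

namespace PageRankGame

/-! ### Gathering all components of the graph without the player -/

section

variable {n : ℕ} {A : ℕ → ℕ → Prop} {α : ℝ} {q : ℕ → ℝ} {m : Memory} {v k : ℕ}

open Classical in
-- The components are disjoint, so the costs `|C| 2^k n²` sum to `2^k n³`. This amortisation needs
-- the loop rule whose invariant tracks time.
theorem gather_spec (hm : HasInput n A α q m) (h0 : 0 < α) (h1 : α < 1)
    (hsymm : ∀ u w, A u w → A w u) (hlt : ∀ u w, A u w → w < n) (hvn : v < n)
    (hk : ∀ D : Finset ℕ, (∀ u ∈ D, A v u) →
      (∀ a ∈ D, ∀ b ∈ D, Relation.ReflTransGen (avoidAdj A v) a b) → D.card ≤ k)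
    (hv : m.nat 3 = v) :
    Halts gather m (1000 * 2 ^ k * n ^ 3) fun m' => ∃ J U, J ≤ n ∧
      U J = (Finset.range n).erase v ∧ HoldsGroups n A v k
        (entryMass A (1 - α) q ((Finset.range n).erase v))
        (returnMass A (1 - α) ((Finset.range n).erase v)) J U m' := by
  have hβ0 : 0 ≤ 1 - α := by linarith
  have hβ1 : 1 - α < 1 := by linarith
  refine HaltsWith.mono (HaltsWith.seq (Halts.forLoop (x := 4) (y := 0) (p := clearMark) (T := 10)
    (fun t m' => ∀ u < t, m'.natArr 4 u = 0) hm.size (by simp) ?_)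
    fun t₁ m₁ f₁ ⟨ht₁, h₁⟩ => HaltsWith.seq (halts_of_loopFree gatherInit m₁)
    fun t₂ m₂ f₂ ⟨ht₂, h₂⟩ => HaltsWith.mono (HaltsWith.forLoop (x := 4) (y := 0)
      (p := gatherNode) (fun i t m' => ∃ J U, J ≤ i ∧
        t ≤ i * 20 + (U J).card * (900 * 2 ^ k * n ^ 2) ∧ HoldsGroups n A v k
        (entryMass A (1 - α) q ((Finset.range n).erase v))
        (returnMass A (1 - α) ((Finset.range n).erase v)) J U m' ∧
        (∀ u < n, m'.natArr 4 u = if u ∈ U J then 1 else 0) ∧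
        ∀ i' < i, i' ≠ v → i' ∈ U J) (by decide) (by decide) (by decide) ?_ ?_)
      (Q' := fun t m' => (t₁ + (t₂ + t)) ≤ 1000 * 2 ^ k * n ^ 3 ∧ ∃ J U, J ≤ n ∧
      U J = (Finset.range n).erase v ∧ HoldsGroups n A v k
        (entryMass A (1 - α) q ((Finset.range n).erase v))
        (returnMass A (1 - α) ((Finset.range n).erase v)) J U m') ?_)
    fun t m' _ h => h
  · intro t ht m' f hx hI
    refine Halts.of_exec ?_ (by decide)
    intro _ _ u hu
    rcases Nat.lt_succ_iff_lt_or_eq.1 hu with h | rfl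
    · simp [clearMark, hI u h]
    · simp [clearMark, hx]
  · subst h₂
    refine ⟨0, fun _ => ∅, le_rfl, Nat.zero_le _, ⟨rfl, ?_, ?_, ?_, ?_, ?_, ?_, ?_, ?_, ?_, ?_, ?_,
      ?_, ?_⟩, ?_, ?_⟩
    · simp [gatherInit]
    · simp
    · simp [IsClosedAvoiding]
    · simp
    · simp
    · simp
    · simp
    · simp
    · simp [gatherInit]
    · simp [gatherInit]
    · simp [gatherInit, entryMass, hit_empty hβ0 hβ1]
    · simp [gatherInit, returnMass]
    · simp [gatherInit]
    · simpa [gatherInit] using h₁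
    · simp
  · rintro i hi t m' f hx ⟨J, U, hJ, ht, hG, hmark, hall⟩
    have hin : i < n := by rwa [f₂.nat 0, f₁.nat 0, hm.size] at hi
    have hm' := ((hm.of_frame f₁).of_frame f₂).of_frame f
    have hv' : m'.nat 3 = v := by rw [f.nat 3, f₂.nat 3, f₁.nat 3, hv]
    refine HaltsWith.cond (fun hiv => ?_) (fun hiv => HaltsWith.cond (fun hiU => ?_) (fun hiU => ?_))
    · refine HaltsWith.mono (halts_of_loopFree .nop m') ?_
      rintro t' m'' - ⟨ht', rfl⟩ - -
      refine ⟨J, U, by omega, ?_, hG.congr (by simp) (by simp) (by simp) rfl rfl rfl rfl rfl rfl rfl,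
        by simpa using hmark, ?_⟩
      · simp only [Test.size, NatExpr.size, Program.cost] at ht' ⊢
        omega
      · intro i' hi' hiv'
        have : i = v := by simpa [hx, hv'] using hiv
        exact hall i' (by omega) hiv'
    · have hiv : i ≠ v := by simpa [hx, hv'] using hiv
      have hiU : i ∉ U J := by
        intro h
        simp [hx, hmark i hin, h] at hiU
      refine HaltsWith.mono (gatherComponent_spec hm' h0 h1 hsymm hlt hvn hk hv' hx hin hiv hG hmark
        hiU) ?_
      rintro t' m'' - ⟨C, hiC, hd, ht', hmark', hG'⟩ - -
      refine ⟨J + 1, fun j => if j ≤ J then U j else U J ∪ C, by omega, ?_, hG'.congr (by simp)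
        (by simp) (by simp) rfl rfl rfl rfl rfl rfl rfl, ?_, ?_⟩
      · simp only [show ¬ J + 1 ≤ J by omega, if_false, Finset.card_union_of_disjoint hd, add_mul,
          Test.size, NatExpr.size]
        omega
      · simpa using hmark'
      · intro i' hi' hiv'
        simp only [show ¬ J + 1 ≤ J by omega, if_false]
        rcases Nat.lt_succ_iff_lt_or_eq.1 hi' with h | rfl
        · exact Finset.mem_union_left _ (hall i' h hiv')
        · exact Finset.mem_union_right _ hiC
    · refine HaltsWith.mono (halts_of_loopFree .nop m') ?_
      rintro t' m'' - ⟨ht', rfl⟩ - -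
      refine ⟨J, U, by omega, ?_, hG.congr (by simp) (by simp) (by simp) rfl rfl rfl rfl rfl rfl rfl,
        by simpa using hmark, ?_⟩
      · simp only [Test.size, NatExpr.size, Program.cost] at ht' ⊢
        omega
      · intro i' hi' hiv'
        rcases Nat.lt_succ_iff_lt_or_eq.1 hi' with h | rfl
        · exact hall i' h hiv'
        · by_contra h
          simp [hx, hmark i' hin, h] at hiU
  · have hN : m₂.nat 0 = n := by rw [f₂.nat 0, f₁.nat 0, hm.size]
    rw [hN]
    rintro t m' - ⟨t', rfl, J, U, hJ, ht', hG, hmark, hall⟩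
    have hUW : U J = (Finset.range n).erase v := by
      refine (hG.subset J le_rfl).antisymm fun u hu => ?_
      exact hall u (Finset.mem_range.1 (Finset.mem_of_mem_erase hu)) (Finset.ne_of_mem_erase hu)
    refine ⟨?_, J, U, hJ, hUW, hG⟩
    -- The player is in no component, which leaves one summand `X` of slack for all overheads.
    have hcard : (U J).card ≤ n - 1 := by
      rw [hUW, Finset.card_erase_of_mem (Finset.mem_range.2 hvn), Finset.card_range]
    have hc : gatherInit.cost ≤ 20 := by decide
    set X := 2 ^ k * n ^ 2 with hX
    have e1 : n ≤ X := (Nat.le_self_pow (by decide) n).trans (Nat.le_mul_of_pos_left _ (by positivity))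
    obtain ⟨d, rfl⟩ : ∃ d, n = d + 1 := ⟨n - 1, by omega⟩
    have e2 : (U J).card * (900 * 2 ^ k * (d + 1) ^ 2) ≤ 900 * (d * X) := by
      calc (U J).card * (900 * 2 ^ k * (d + 1) ^ 2) ≤ d * (900 * 2 ^ k * (d + 1) ^ 2) :=
            Nat.mul_le_mul_right _ hcard
        _ = _ := by rw [hX]; ring
    have e3 : 1000 * 2 ^ k * (d + 1) ^ 3 = 1000 * (d * X) + 1000 * X := by rw [hX]; ring
    rw [e3]
    omega

end

end PageRankGame

namespace PageRankGame

/-! # Combining the components -/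

/-- The gain of a record, weighted for strategies of size `s`. -/
def gainExpr : RealExpr :=
  .add (.mul (.mul (.cast (.var 20)) (.get 0 (.const 0))) (.get 4 (.var 28)))
    (.mul (.mul (.get 11 (.const 0)) (.sub (.cast (.const 1)) (.get 0 (.const 0))))
      (.get 5 (.var 28)))

/-- Array `11` holds code + 1, with 0 for "no set". Adding the plain code of the record keeps this
shift. -/
def knapUpdate : Program :=
  .seq (.storeNat 11 (.var 23) (.add (.get 11 (.var 29)) (.get 9 (.var 28))))
    (.storeReal 6 (.var 23) (.get 14 (.const 0)))

/-- Try to improve the best set of size `c` by the current record. -/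
def knapTry : Program :=
  .seq (.setNat 28 (.add (.get 10 (.var 21)) (.var 24)))
    (.seq (.setNat 29 (.sub (.var 23) (.get 8 (.var 28))))
      (.cond (.natEq (.get 8 (.var 28)) (.const 0)) .nop
        (.cond (.natLt (.var 23) (.get 8 (.var 28))) .nop
          (.cond (.natEq (.get 11 (.var 29)) (.const 0)) .nop
            (.seq (.storeReal 14 (.const 0) (.add (.get 6 (.var 29)) gainExpr))
              (.cond (.natEq (.get 11 (.var 23)) (.const 0)) knapUpdate
                (.cond (.realLt (.get 6 (.var 23)) (.get 14 (.const 0))) knapUpdate .nop)))))))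

/-- Sizes are treated in decreasing order, so that smaller cells still refer to the earlier groups
and no group is used twice. -/
def knapSize : Program := .seq (.setNat 23 (.sub (.var 0) (.var 22))) (forLoop 24 27 knapTry)

def knapGroup : Program :=
  .seq (.setNat 27 (.sub (.get 10 (.add (.var 21) (.const 1))) (.get 10 (.var 21))))
    (forLoop 22 0 knapSize)

def knapClear : Program := .storeNat 11 (.add (.var 22) (.const 1)) (.const 0)

/-- Cell 0 starts with the empty set, of code 0 and gain 0. -/
def knapInit : Program :=
  .seq (.storeNat 11 (.const 0) (.const 1)) (.storeReal 6 (.const 0) (.cast (.const 0)))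

/-- For every size, find a set of neighbours of that size with the largest gain. -/
def knapsack : Program :=
  .seq (forLoop 22 0 knapClear) (.seq knapInit (forLoop 21 5 knapGroup))

/-- Entry `c` of the tables describes a set with the largest value of `g` among the sets of size
`c` that satisfy `P`, if there is one. -/
structure BestFor (g : Finset ℕ → ℝ) (P : Finset ℕ → Prop) (c : ℕ) (m : Memory) : Prop where
  opt : ∀ E, P E → E.card = c → m.natArr 11 c ≠ 0 ∧ g E ≤ m.realArr 6 c
  wit : m.natArr 11 c ≠ 0 →
    ∃ E, P E ∧ E.card = c ∧ m.natArr 11 c = code E + 1 ∧ m.realArr 6 c = g E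

theorem BestFor.congr {g : Finset ℕ → ℝ} {P P' : Finset ℕ → Prop} {c : ℕ} {m m' : Memory}
    (h : BestFor g P c m) (hP : ∀ E, E.card = c → (P' E ↔ P E))
    (h11 : m'.natArr 11 c = m.natArr 11 c) (h6 : m'.realArr 6 c = m.realArr 6 c) :
    BestFor g P' c m' := by
  constructor
  · intro E hE hc
    rw [h11, h6]
    exact h.opt E ((hP E hc).1 hE) hc
  · intro hK
    rw [h11] at hK
    obtain ⟨E, hE, hc, h1, h2⟩ := h.wit hK
    exact ⟨E, (hP E hc).2 hE, hc, by rw [h11, h1], by rw [h6, h2]⟩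

section

variable {n : ℕ} {A : ℕ → ℕ → Prop} {α : ℝ} {q : ℕ → ℝ} {m : Memory} {v k s : ℕ} {ρ : ℝ}
  {gQ gH : Finset ℕ → ℝ}

/-- For sets `E ∪ S` with `S` fixed, additivity reduces optimality at size `c` to optimality of `E`
at size `c - |S|`. Hence one comparison with the current cell suffices. -/
theorem knapTry_spec {g : Finset ℕ → ℝ} {P P' : Finset ℕ → Prop} {c r : ℕ} {S : Finset ℕ}
    (h23 : m.nat 23 = c) (hr : m.natArr 10 (m.nat 21) + m.nat 24 = r)
    (hrec : HoldsRecord gQ gH r S m)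
    (hg : m.nat 20 * m.realArr 0 0 * gQ S + m.realArr 11 0 * (1 - m.realArr 0 0) * gH S = g S)
    (hlow : 0 < S.card → S.card ≤ c → BestFor g P (c - S.card) m) (hcur : BestFor g P' c m)
    (hadd : ∀ E, P E → g (E ∪ S) = g E + g S) (hdisj : ∀ E, P E → Disjoint E S) :
    Halts knapTry m 100 fun m' =>
      (∀ c', c' ≠ c → m'.natArr 11 c' = m.natArr 11 c' ∧ m'.realArr 6 c' = m.realArr 6 c') ∧
      BestFor g (fun E => P' E ∨ (S.Nonempty ∧ ∃ E', P E' ∧ E = E' ∪ S)) c m' := by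
  refine Halts.of_exec ?_ (by decide)
  have e8 := hrec.size
  have e9 := hrec.code
  have e4 := hrec.entry
  have e5 := hrec.ret
  have skip : (∀ E', P E' → S.Nonempty → (E' ∪ S).card ≠ c) →
      (knapTry.exec m).natArr 11 = m.natArr 11 → (knapTry.exec m).realArr 6 = m.realArr 6 →
      (∀ c', c' ≠ c → (knapTry.exec m).natArr 11 c' = m.natArr 11 c' ∧
        (knapTry.exec m).realArr 6 c' = m.realArr 6 c') ∧
      BestFor g (fun E => P' E ∨ (S.Nonempty ∧ ∃ E', P E' ∧ E = E' ∪ S)) c (knapTry.exec m) := by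
    intro h1 h2 h3
    refine ⟨fun c' _ => by rw [h2, h3]; exact ⟨rfl, rfl⟩, hcur.congr ?_ (by rw [h2]) (by rw [h3])⟩
    intro E hc
    refine ⟨fun h => h.elim id ?_, Or.inl⟩
    rintro ⟨hne, E', hE', rfl⟩
    exact absurd hc (h1 E' hE' hne)
  by_cases hS0 : S.card = 0
  · refine skip (fun E' _ hne => ?_) ?_ ?_
    · exact absurd hS0 (Finset.card_pos.2 hne).ne'
    · simp [knapTry, hr, e8, hS0]
    · simp [knapTry, hr, e8, hS0]
  by_cases hSc : c < S.card
  · refine skip (fun E' _ _ h => ?_) ?_ ?_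
    · have := Finset.card_le_card (Finset.subset_union_right : S ⊆ E' ∪ S)
      omega
    · simp [knapTry, hr, e8, hS0, hSc, h23]
    · simp [knapTry, hr, e8, hS0, hSc, h23]
  have hlow := hlow (by omega) (by omega)
  have hcard : ∀ E', P E' → (E' ∪ S).card = c → E'.card = c - S.card := by
    intro E' hE' h
    rw [Finset.card_union_of_disjoint (hdisj E' hE')] at h
    omega
  by_cases hK : m.natArr 11 (c - S.card) = 0
  · refine skip (fun E' hE' _ h => ?_) ?_ ?_
    · exact (hlow.opt E' hE' (hcard E' hE' h)).1 hK
    · simp [knapTry, hr, e8, hS0, hSc, h23, hK]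
    · simp [knapTry, hr, e8, hS0, hSc, h23, hK]
  obtain ⟨E₀, hE₀, hcE₀, hKE₀, hTE₀⟩ := hlow.wit hK
  have hcE₀S : (E₀ ∪ S).card = c := by
    rw [Finset.card_union_of_disjoint (hdisj E₀ hE₀)]
    omega
  have hcode : code (E₀ ∪ S) = code E₀ + code S := code_union (hdisj E₀ hE₀)
  have hne : S.Nonempty := Finset.card_pos.1 (by omega)
  have hnew : ∀ E', P E' → (E' ∪ S).card = c → g (E' ∪ S) ≤ g (E₀ ∪ S) := by
    intro E' hE' h
    rw [hadd E' hE', hadd E₀ hE₀, ← hTE₀]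
    have := (hlow.opt E' hE' (hcard E' hE' h)).2
    linarith
  have hcand : m.realArr 6 (c - S.card) + (m.nat 20 * m.realArr 0 0 * m.realArr 4 r +
      m.realArr 11 0 * (1 - m.realArr 0 0) * m.realArr 5 r) = g (E₀ ∪ S) := by
    rw [e4, e5, hg, hTE₀, hadd E₀ hE₀]
  by_cases hup : m.natArr 11 c = 0 ∨ m.realArr 6 c < g (E₀ ∪ S)
  · have e11 : ∀ c', (knapTry.exec m).natArr 11 c'
        = if c' = c then code (E₀ ∪ S) + 1 else m.natArr 11 c' := by
      intro c'
      -- The old cell holds `code E₀ + 1`, and codes of disjoint sets add.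
      have : m.natArr 11 (c - S.card) + code S = code (E₀ ∪ S) + 1 := by omega
      by_cases hc0 : m.natArr 11 c = 0
      · simp [knapTry, knapUpdate, gainExpr, hr, e8, hS0, hSc, h23, hK, e9, this, hc0]
      · have hlt := hup.resolve_left hc0
        simp [knapTry, knapUpdate, gainExpr, hr, e8, hS0, hSc, h23, hK, e9, this, hc0, hcand, hlt]
    have e6 : ∀ c', (knapTry.exec m).realArr 6 c'
        = if c' = c then g (E₀ ∪ S) else m.realArr 6 c' := by
      intro c'
      by_cases hc0 : m.natArr 11 c = 0
      · simp [knapTry, knapUpdate, gainExpr, hr, e8, hS0, hSc, h23, hK, hc0, hcand]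
      · have hlt := hup.resolve_left hc0
        simp [knapTry, knapUpdate, gainExpr, hr, e8, hS0, hSc, h23, hK, hc0, hcand, hlt]
    refine ⟨fun c' hc' => by simp [e11, e6, hc'], ?_, ?_⟩
    · rintro E (hE | ⟨_, E', hE', rfl⟩) hc
      · rw [e11, e6, if_pos rfl, if_pos rfl]
        refine ⟨by omega, ?_⟩
        obtain ⟨h1, h2⟩ := hcur.opt E hE hc
        exact h2.trans (hup.resolve_left h1).le
      · rw [e11, e6, if_pos rfl, if_pos rfl]
        exact ⟨by omega, hnew E' hE' hc⟩
    · intro _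
      exact ⟨E₀ ∪ S, Or.inr ⟨hne, E₀, hE₀, rfl⟩, hcE₀S, by rw [e11, if_pos rfl],
        by rw [e6, if_pos rfl]⟩
  · obtain ⟨hc0, hlt⟩ := not_or.1 hup
    have e11 : (knapTry.exec m).natArr 11 = m.natArr 11 := by
      simp [knapTry, knapUpdate, gainExpr, hr, e8, hS0, hSc, h23, hK, hc0, hcand, hlt]
    have e6 : (knapTry.exec m).realArr 6 = m.realArr 6 := by
      funext c'
      simp [knapTry, knapUpdate, gainExpr, hr, e8, hS0, hSc, h23, hK, hc0, hcand, hlt]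
    refine ⟨fun c' _ => by rw [e11, e6]; exact ⟨rfl, rfl⟩, ?_, ?_⟩
    · rintro E (hE | ⟨_, E', hE', rfl⟩) hc
      · rw [e11, e6]
        exact hcur.opt E hE hc
      · rw [e11, e6]
        exact ⟨hc0, (hnew E' hE' hc).trans (not_lt.1 hlt)⟩
    · rw [e11, e6]
      intro h
      obtain ⟨E, hE, h⟩ := hcur.wit h
      exact ⟨E, Or.inl hE, h⟩

/-- The sets obtained from sets with property `P` by adding one of the sets described by the
records from `lo` to `hi - 1`. -/
def Extends (gQ gH : Finset ℕ → ℝ) (m : Memory) (P : Finset ℕ → Prop) (lo hi : ℕ)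
    (E : Finset ℕ) : Prop :=
  P E ∨ ∃ r S, lo ≤ r ∧ r < hi ∧ HoldsRecord gQ gH r S m ∧ S.Nonempty ∧ ∃ E', P E' ∧ E = E' ∪ S

theorem HoldsRecord.unique {r : ℕ} {S S' : Finset ℕ} (h : HoldsRecord gQ gH r S m)
    (h' : HoldsRecord gQ gH r S' m) : S = S' :=
  code_injective (h.code.symm.trans h'.code)

/-- The gain of a set, weighted for strategies of size `s`. -/
noncomputable def gain (α ρ : ℝ) (gQ gH : Finset ℕ → ℝ) (s : ℕ) (E : Finset ℕ) : ℝ :=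
  s * α * gQ E + ρ * (1 - α) * gH E

/-- What the loops of `knapsack` leave unchanged. -/
structure KnapInput (α ρ : ℝ) (gQ gH : Finset ℕ → ℝ) (s n : ℕ) (m₀ m : Memory) : Prop where
  size : m.nat 0 = n
  target : m.nat 20 = s
  alpha : m.realArr 0 0 = α
  rank : m.realArr 11 0 = ρ
  index : m.natArr 10 = m₀.natArr 10
  rsize : m.natArr 8 = m₀.natArr 8
  rcode : m.natArr 9 = m₀.natArr 9
  rentry : m.realArr 4 = m₀.realArr 4
  rret : m.realArr 5 = m₀.realArr 5

theorem KnapInput.of_frame {m₀ m' : Memory} {p : Program} (h : KnapInput α ρ gQ gH s n m₀ m)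
    (f : Frame p m m') (hn : p.writesNat 0 = false ∧ p.writesNat 20 = false := by decide)
    (ha : p.writesNatArr 8 = false ∧ p.writesNatArr 9 = false ∧ p.writesNatArr 10 = false
      := by decide)
    (hr : p.writesRealArr 0 = false ∧ p.writesRealArr 11 = false ∧ p.writesRealArr 4 = false ∧
      p.writesRealArr 5 = false := by decide) : KnapInput α ρ gQ gH s n m₀ m' :=
  ⟨by rw [f.nat' 0 hn.1, h.size], by rw [f.nat' 20 hn.2, h.target],
    by rw [f.realArr' 0 hr.1, h.alpha], by rw [f.realArr' 11 hr.2.1, h.rank],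
    by rw [f.natArr' 10 ha.2.2, h.index], by rw [f.natArr' 8 ha.1, h.rsize],
    by rw [f.natArr' 9 ha.2.1, h.rcode], by rw [f.realArr' 4 hr.2.2.1, h.rentry],
    by rw [f.realArr' 5 hr.2.2.2, h.rret]⟩

theorem KnapInput.record {m₀ : Memory} (h : KnapInput α ρ gQ gH s n m₀ m) {r : ℕ} {S : Finset ℕ}
    (hr : HoldsRecord gQ gH r S m₀) : HoldsRecord gQ gH r S m :=
  ⟨by rw [h.rsize, hr.size], by rw [h.rcode, hr.code], by rw [h.rentry, hr.entry],
    by rw [h.rret, hr.ret]⟩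

/-- Only cell `c` is written, and as empty records are skipped only strictly smaller cells are
extended. So each candidate adds exactly one record to a set with property `P`. -/
theorem knapSize_spec {m₀ : Memory} {P : Finset ℕ → Prop} {c t j N lo : ℕ}
    (hI : KnapInput α ρ gQ gH s n m₀ m) (h22 : m.nat 22 = t) (hc : n - t = c)
    (h21 : m.nat 21 = j) (h27 : m.nat 27 = N) (hlo : m₀.natArr 10 j = lo)
    (hrec : ∀ r, lo ≤ r → r < lo + N → ∃ S, HoldsRecord gQ gH r S m₀ ∧
      (∀ E, P E → Disjoint E S) ∧
      ∀ E, P E → gain α ρ gQ gH s (E ∪ S) = gain α ρ gQ gH s E + gain α ρ gQ gH s S)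
    (hbest : ∀ c' ≤ c, BestFor (gain α ρ gQ gH s) P c' m) :
    Halts knapSize m (N * 107 + 15) fun m' =>
      (∀ c', c' ≠ c → m'.natArr 11 c' = m.natArr 11 c' ∧ m'.realArr 6 c' = m.realArr 6 c') ∧
      BestFor (gain α ρ gQ gH s) (Extends gQ gH m₀ P lo (lo + N)) c m' := by
  refine Halts.mono (Halts.seq (halts_of_loopFree (.setNat 23 (.sub (.var 0) (.var 22))) m)
    fun m₁ f₁ h₁ => Halts.forLoop (x := 24) (y := 27) (p := knapTry) (T := 100)
    (fun t m' => (∀ c', c' ≠ c → m'.natArr 11 c' = m.natArr 11 c' ∧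
        m'.realArr 6 c' = m.realArr 6 c') ∧
      BestFor (gain α ρ gQ gH s) (Extends gQ gH m₀ P lo (lo + t)) c m')
    (by rw [f₁.nat 27, h27]) ?_ ?_) ?_ fun _ _ h => h
  · subst h₁
    refine ⟨by simp, (hbest c le_rfl).congr (fun E _ => ?_) (by simp) (by simp)⟩
    refine ⟨fun h => h.elim id ?_, Or.inl⟩
    rintro ⟨r, S, h1, h2, _⟩
    omega
  · rintro x hx m' f h24 ⟨hsame, hcur⟩
    have hI' := (hI.of_frame f₁).of_frame f
    obtain ⟨S, hS, hdisj, hadd⟩ := hrec (lo + x) (by omega) (by omega)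
    have h23 : m'.nat 23 = c := by
      rw [f.nat 23, h₁]
      simp [hI.size, h22, hc]
    have h21' : m'.nat 21 = j := by rw [f.nat 21, f₁.nat 21, h21]
    refine (knapTry_spec (P := P) (g := gain α ρ gQ gH s) (r := lo + x) h23
      (by rw [hI'.index, h21', h24, hlo]) (hI'.record hS) ?_ ?_ hcur hadd hdisj).mono le_rfl ?_
    · rw [hI'.target, hI'.alpha, hI'.rank]
      rfl
    · intro h1 h2
      obtain ⟨e1, e2⟩ := hsame (c - S.card) (by omega)
      exact (hbest _ (by omega)).congr (fun _ _ => Iff.rfl) e1 e2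
    · rintro m'' - ⟨h1, h2⟩ - -
      refine ⟨fun c' hc' => ?_, h2.congr (fun E _ => ?_) (by simp) (by simp)⟩
      · simp only [Memory.setNat_natArr, Memory.setNat_realArr]
        rw [(h1 c' hc').1, (h1 c' hc').2]
        exact hsame c' hc'
      · constructor
        · rintro (h | ⟨r, S', hr, hr', hrec', hne, hE⟩)
          · exact Or.inl (Or.inl h)
          · by_cases hrx : r = lo + x
            · subst hrx
              rw [hrec'.unique hS] at hne hE
              exact Or.inr ⟨hne, hE⟩
            · exact Or.inl (Or.inr ⟨r, S', hr, by omega, hrec', hne, hE⟩)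
        · rintro ((h | ⟨r, S', hr, hr', h⟩) | ⟨hne, hE⟩)
          · exact Or.inl h
          · exact Or.inr ⟨r, S', hr, by omega, h⟩
          · exact Or.inr ⟨lo + x, S, by omega, by omega, hS, hne, hE⟩
  · have : Program.cost (.setNat 23 (.sub (.var 0) (.var 22))) ≤ 10 := by decide
    omega

theorem knapGroup_spec {m₀ : Memory} {P P' : Finset ℕ → Prop} {j N lo : ℕ}
    (hI : KnapInput α ρ gQ gH s n m₀ m)
    (h21 : m.nat 21 = j) (hlo : m₀.natArr 10 j = lo) (hhi : m₀.natArr 10 (j + 1) = lo + N)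
    (hrec : ∀ r, lo ≤ r → r < lo + N → ∃ S, HoldsRecord gQ gH r S m₀ ∧
      (∀ E, P E → Disjoint E S) ∧
      ∀ E, P E → gain α ρ gQ gH s (E ∪ S) = gain α ρ gQ gH s E + gain α ρ gQ gH s S)
    (hP : ∀ E, P' E ↔ Extends gQ gH m₀ P lo (lo + N) E)
    (hbest : ∀ c ≤ n, BestFor (gain α ρ gQ gH s) P c m) :
    Halts knapGroup m (n * (N * 107 + 22) + 25) fun m' =>
      ∀ c ≤ n, BestFor (gain α ρ gQ gH s) P' c m' := by
  refine Halts.mono (Halts.seq (halts_of_loopFree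
    (.setNat 27 (.sub (.get 10 (.add (.var 21) (.const 1))) (.get 10 (.var 21)))) m)
    fun m₁ f₁ h₁ => Halts.forLoop (x := 22) (y := 0) (p := knapSize) (T := N * 107 + 15)
    (fun t m' => (∀ c ≤ n, n - t < c → BestFor (gain α ρ gQ gH s) P' c m') ∧
      ∀ c ≤ n - t, BestFor (gain α ρ gQ gH s) P c m') (by rw [f₁.nat 0, hI.size]) ?_ ?_) ?_ ?_
  · subst h₁
    refine ⟨fun c h1 h2 => by omega, fun c h => ?_⟩
    exact (hbest c (by omega)).congr (fun _ _ => Iff.rfl) (by simp) (by simp)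
  · rintro t ht m' f h22 ⟨hhigh, hlow⟩
    refine (knapSize_spec (P := P) (c := n - t) (j := j) (N := N) ((hI.of_frame f₁).of_frame f) h22
      rfl (by rw [f.nat 21, f₁.nat 21, h21]) ?_ hlo hrec hlow).mono le_rfl ?_
    · rw [f.nat 27, h₁]
      simp [hI.index, h21, hlo, hhi]
    · rintro m'' - ⟨hsame, hnew⟩ - -
      refine ⟨fun c hc hc' => ?_, fun c hc => ?_⟩
      · by_cases hct : c = n - t
        · subst hct
          exact hnew.congr (fun E _ => hP E) (by simp) (by simp)
        · exact (hhigh c hc (by omega)).congr (fun _ _ => Iff.rfl) (by simpa using (hsame c hct).1)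
            (by simpa using (hsame c hct).2)
      · have hct : c ≠ n - t := by omega
        exact (hlow c (by omega)).congr (fun _ _ => Iff.rfl) (by simpa using (hsame c hct).1)
            (by simpa using (hsame c hct).2)
  · have : Program.cost (.setNat 27 (.sub (.get 10 (.add (.var 21) (.const 1)))
      (.get 10 (.var 21)))) ≤ 20 := by decide
    rw [show N * 107 + 15 + 7 = N * 107 + 22 by rfl]
    omega
  · rintro m' - ⟨hhigh, hlow⟩ c hc
    -- The loop visits sizes `n` down to 1. Size 0 needs no update, because the union with a
    -- nonempty record is never empty.
    rcases Nat.eq_zero_or_pos c with rfl | hc0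
    · refine (hlow 0 (by omega)).congr (fun E hE => ?_) rfl rfl
      rw [hP]
      refine ⟨fun h => h.elim id ?_, Or.inl⟩
      rintro ⟨r, S, -, -, -, hne, E', -, rfl⟩
      have := Finset.card_le_card (Finset.subset_union_right : S ⊆ E' ∪ S)
      have := Finset.card_pos.2 hne
      omega
    · exact hhigh c hc (by omega)

end

end PageRankGame

namespace PageRankGame

/-! ### The knapsack over all components -/

section

variable {n : ℕ} {A : ℕ → ℕ → Prop} {α : ℝ} {q : ℕ → ℝ} {m : Memory} {v k s : ℕ} {ρ : ℝ}
  {gQ gH : Finset ℕ → ℝ} {J : ℕ} {U : ℕ → Finset ℕ}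

open Classical in
-- A set of neighbours in `U (j + 1)` splits into its part in `U j` and its part in the new
-- component; the latter, if not empty, has a record.
theorem HoldsGroups.extends_iff (hG : HoldsGroups n A v k gQ gH J U m) {j : ℕ} (hj : j < J)
    (E : Finset ℕ) :
    E ⊆ (U (j + 1)).filter (A v) ↔ Extends gQ gH m (fun E => E ⊆ (U j).filter (A v))
      (m.natArr 10 j) (m.natArr 10 (j + 1)) E := by
  constructor
  · intro hE
    by_cases hne : (E \ U j).Nonempty
    · obtain ⟨r, hr, hr', hrec⟩ := hG.complete j hj (E \ U j) (by
        intro u hu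
        obtain ⟨h1, h2⟩ := Finset.mem_sdiff.1 hu
        obtain ⟨h3, h4⟩ := Finset.mem_filter.1 (hE h1)
        exact Finset.mem_filter.2 ⟨Finset.mem_sdiff.2 ⟨h3, h2⟩, h4⟩)
      refine Or.inr ⟨r, _, hr, hr', hrec, hne, E ∩ U j, ?_, ?_⟩
      · intro u hu
        obtain ⟨h1, h2⟩ := Finset.mem_inter.1 hu
        exact Finset.mem_filter.2 ⟨h2, (Finset.mem_filter.1 (hE h1)).2⟩
      · rw [Finset.union_comm, Finset.sdiff_union_inter]
    · refine Or.inl fun u hu => Finset.mem_filter.2 ⟨?_, (Finset.mem_filter.1 (hE hu)).2⟩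
      by_contra h
      exact hne ⟨u, Finset.mem_sdiff.2 ⟨hu, h⟩⟩
  · rintro (hE | ⟨r, S, hr, hr', hrec, -, E', hE', rfl⟩)
    · exact hE.trans (Finset.filter_subset_filter _ (hG.mono j hj))
    · obtain ⟨S', hS', hrec'⟩ := hG.sound j hj r hr hr'
      rw [hrec.unique hrec']
      exact Finset.union_subset (hE'.trans (Finset.filter_subset_filter _ (hG.mono j hj)))
        (hS'.trans (Finset.filter_subset_filter _ Finset.sdiff_subset))

open Classical in
-- Each of at most `n` groups combines at most `n` sizes with at most `2 ^ k` records. That the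
-- number of records is bounded for each group separately is what avoids an exponential search over
-- all neighbours.
theorem knapsack_spec (hm : HasInput n A α q m) (hn : 0 < n)
    (hG : HoldsGroups n A v k gQ gH J U m) (hJ : J ≤ n) (h20 : m.nat 20 = s)
    (hρ : m.realArr 11 0 = ρ) (hQ0 : gQ ∅ = 0) (hH0 : gH ∅ = 0)
    (hadd : ∀ j < J, ∀ E ⊆ U j, ∀ S ⊆ U (j + 1) \ U j, gQ (E ∪ S) = gQ E + gQ S ∧
      gH (E ∪ S) = gH E + gH S) :
    Halts knapsack m (300 * 2 ^ k * n ^ 2) fun m' => ∀ c ≤ n,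
      BestFor (gain α ρ gQ gH s) (fun E => E ⊆ (U J).filter (A v)) c m' := by
  have hI : KnapInput α ρ gQ gH s n m m :=
    ⟨hm.size, h20, hm.alpha, hρ, rfl, rfl, rfl, rfl, rfl⟩
  refine Halts.mono (Halts.seq (Halts.forLoop (x := 22) (y := 0) (p := knapClear) (T := 10)
    (fun t m' => ∀ c, 0 < c → c ≤ t → m'.natArr 11 c = 0) hm.size ?_ ?_)
    fun m₁ f₁ h₁ => Halts.seq (halts_of_loopFree knapInit m₁)
    fun m₂ f₂ h₂ => Halts.forLoop (x := 21) (y := 5) (p := knapGroup)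
      (T := n * (2 ^ k * 107 + 22) + 25) (N := J)
    (fun j m' => ∀ c ≤ n, BestFor (gain α ρ gQ gH s) (fun E => E ⊆ (U j).filter (A v)) c m')
    (by rw [f₂.nat 5, f₁.nat 5, hG.groups]) ?_ ?_) ?_ fun _ _ h => h
  · intro c h1 h2
    omega
  · intro t ht m' f hx hI'
    refine Halts.of_exec ?_ (by decide)
    intro _ _ c hc hct
    by_cases h : c = t + 1
    · simp [knapClear, hx, h]
    · simp [knapClear, hx, h, hI' c hc (by omega)]
  · subst h₂
    intro c hc
    rw [hG.start]
    constructor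
    · intro E hE hcE
      have hE : E = ∅ := by simpa using hE
      subst hE
      have hc : c = 0 := by simpa using hcE.symm
      subst hc
      simp [knapInit, gain, hQ0, hH0]
    · intro hK
      have hc0 : c = 0 := by
        by_contra h
        exact hK (by simp [knapInit, h, h₁ c (by omega) hc])
      subst hc0
      exact ⟨∅, by simp, rfl, by simp [knapInit, code_empty], by simp [knapInit, gain, hQ0, hH0]⟩
  · intro j hj m' f h21 hbest
    obtain ⟨N, hN⟩ : ∃ N, m.natArr 10 (j + 1) = m.natArr 10 j + N :=
      ⟨_, (Nat.add_sub_cancel' (hG.index_mono j hj)).symm⟩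
    have hNk : N ≤ 2 ^ k := by
      have := hG.index_le j hj
      omega
    refine (knapGroup_spec (P' := fun E => E ⊆ (U (j + 1)).filter (A v))
      (((hI.of_frame f₁).of_frame f₂).of_frame f) h21 rfl hN ?_ ?_ hbest).mono ?_ ?_
    · intro r hr hr'
      obtain ⟨S, hS, hrec⟩ := hG.sound j hj r hr (by omega)
      have hS' := hS.trans (Finset.filter_subset _ _)
      refine ⟨S, hrec, fun E hE => ?_, fun E hE => ?_⟩
      · refine Finset.disjoint_left.2 fun u hu huS => ?_
        exact (Finset.mem_sdiff.1 (hS' huS)).2 (Finset.mem_filter.1 (hE hu)).1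
      · obtain ⟨h1, h2⟩ := hadd j hj E (hE.trans (Finset.filter_subset _ _)) S hS'
        simp only [gain, h1, h2]
        ring
    · intro E
      rw [← hN]
      exact hG.extends_iff hj E
    · gcongr
    · intro m'' _ h _ _ c hc
      exact (h c hc).congr (fun _ _ => Iff.rfl) (by simp) (by simp)
  · have : knapInit.cost ≤ 15 := by decide
    have hK : 1 ≤ 2 ^ k := Nat.one_le_two_pow
    set K := 2 ^ k
    have e1 : J * (n * (K * 107 + 22) + 25 + 7) ≤ n * (n * (K * 107 + 22) + 25 + 7) :=
      Nat.mul_le_mul_right _ hJ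
    have e2 : n * (n * (K * 107 + 22) + 25 + 7) = 107 * (K * n ^ 2) + 22 * n ^ 2 + 32 * n := by ring
    have e3 : n ≤ n ^ 2 := Nat.le_self_pow (by decide) n
    have e4 : n ^ 2 ≤ K * n ^ 2 := Nat.le_mul_of_pos_left _ (by omega)
    have e5 : 300 * K * n ^ 2 = 300 * (K * n ^ 2) := by ring
    rw [e5]
    omega

/-! # The algorithm -/

/-- The subtraction undoes the shift by 1 in array `11`. -/
def announce : Program :=
  .seq (.setNat 1 (.const 0)) (.seq (.setNat 2 (.var 3))
    (.setNat 13 (.sub (.get 11 (.var 20)) (.const 1))))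

/-- Output the best strategy of the current size if it is improving. -/
def checkSize : Program :=
  .cond (.natEq (.get 11 (.var 20)) (.const 0)) .nop
    (.cond (.realLt (.cast (.const 0))
        (.add (.mul (.cast (.var 20))
          (.sub (.mul (.get 0 (.const 0)) (.get 1 (.var 3))) (.get 11 (.const 0))))
          (.get 6 (.var 20))))
      (.seq announce (decode 1)) .nop)

def tryNextSize : Program :=
  .seq (.setNat 20 (.add (.var 30) (.const 1))) (.seq knapsack checkSize)

/-- The current payoff of the player, from the totals for the full set of neighbours. Without
neighbours the value is meaningless, but then there is no strategy to test. -/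
def setRank : Program :=
  .storeReal 11 (.const 0)
    (.div (.mul (.get 0 (.const 0)) (.add (.get 1 (.var 3)) (.get 9 (.const 0))))
      (.sub (.cast (.const 1)) (.div
        (.mul (.sub (.cast (.const 1)) (.get 0 (.const 0))) (.get 10 (.const 0)))
        (.cast (.var 25)))))

def tryPlayer : Program := .seq gather (.seq setRank (forLoop 30 0 tryNextSize))

/-- Variable `1` starts with the answer "equilibrium", which any discovery overwrites. Variables
`13` and `26` are the running multiple of `n` and power of two, as natural numbers can only be
added. -/
def tableInit : Program :=
  .seq (.setNat 1 (.const 1)) (.seq (.setNat 13 (.const 0)) (.setNat 26 (.const 1)))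

def tableStep : Program :=
  .seq (.storeNat 2 (.var 4) (.var 13)) (.seq (.setNat 13 (.add (.var 13) (.var 0)))
    (.seq (.storeNat 3 (.var 4) (.var 26)) (.setNat 26 (.add (.var 26) (.var 26)))))

/-- Decide whether the input graph is a Nash equilibrium of the deletion-model. -/
def decideNash : Program :=
  .seq tableInit (.seq (forLoop 4 0 tableStep) (forLoop 3 0 tryPlayer))

open Classical in
/-- The neighbours of `v`. -/
noncomputable def neighbours (n : ℕ) (A : ℕ → ℕ → Prop) (v : ℕ) : Finset ℕ :=
  ((Finset.range n).erase v).filter (A v)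

/-- The output is a player together with a strategy `E` such that `B v E`. -/
def Found (n : ℕ) (A : ℕ → ℕ → Prop) (B : ℕ → Finset ℕ → Prop) (m : Memory) : Prop :=
  m.nat 1 = 0 ∧ ∃ v < n, m.nat 2 = v ∧ ∃ E ⊆ neighbours n A v, E.Nonempty ∧ B v E ∧
    ∀ u < n, m.natArr 1 u = if u ∈ E then 1 else 0

/-- Among the strategies that satisfy `Q` there is none with property `B`, unless one has been
found. -/
def Status (n : ℕ) (A : ℕ → ℕ → Prop) (B Q : ℕ → Finset ℕ → Prop) (m : Memory) : Prop :=
  (m.nat 1 = 1 ∧ ∀ v, ∀ E ⊆ neighbours n A v, E.Nonempty → Q v E → ¬ B v E) ∨ Found n A B m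

theorem Status.congr {B Q Q' : ℕ → Finset ℕ → Prop} {m' : Memory} (h : Status n A B Q m)
    (hQ : ∀ v, ∀ E ⊆ neighbours n A v, E.Nonempty → Q' v E → Q v E) (h1 : m'.nat 1 = m.nat 1)
    (h2 : m'.nat 2 = m.nat 2) (h3 : m'.natArr 1 = m.natArr 1) : Status n A B Q' m' := by
  rcases h with ⟨h, h'⟩ | h
  · exact Or.inl ⟨by rw [h1, h], fun v E hE hne hq => h' v E hE hne (hQ v E hE hne hq)⟩
  · right
    unfold Found at h ⊢
    rwa [h1, h2, h3]

theorem mem_neighbours {u : ℕ} : u ∈ neighbours n A v ↔ u < n ∧ u ≠ v ∧ A v u := by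
  simp only [neighbours, Finset.mem_filter, Finset.mem_erase, Finset.mem_range]
  tauto

/-- For a fixed size the criterion is a constant plus the gain, so it suffices to test a set of
largest gain. A later discovery may overwrite an earlier one; the output is valid either way. -/
theorem checkSize_spec (hm : HasInput n A α q m) (hv : m.nat 3 = v) (hvn : v < n)
    {B Q : ℕ → Finset ℕ → Prop} (h20 : m.nat 20 = s) (hs : 0 < s) (hρ : m.realArr 11 0 = ρ)
    (hB : ∀ E, E.card = s → (B v E ↔ 0 < s * (α * q v - ρ) + gain α ρ gQ gH s E))
    (hbest : BestFor (gain α ρ gQ gH s) (fun E => E ⊆ neighbours n A v) s m)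
    (hst : Status n A B Q m) :
    Halts checkSize m (30 * n + 100)
      (Status n A B (fun w E => Q w E ∨ (w = v ∧ E.card = s))) := by
  have none : (∀ E ⊆ neighbours n A v, E.card = s → ¬ B v E) →
      Status n A B (fun w E => Q w E ∨ (w = v ∧ E.card = s)) m := by
    intro h
    rcases hst with ⟨h1, h2⟩ | h'
    · refine Or.inl ⟨h1, fun w E hE hne hq => ?_⟩
      rcases hq with hq | ⟨rfl, hc⟩
      · exact h2 w E hE hne hq
      · exact h E hE hc
    · exact Or.inr h'
  refine Halts.mono (Halts.cond (T := 30 * n + 70) (fun h => ?_) (fun h => Halts.mono (Halts.cond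
    (T := 30 * n + 30) (fun h' => ?_) (fun h' => ?_)) (T' := 30 * n + 70) ?_ fun _ _ h => h)) ?_
    fun _ _ h => h
  · refine Halts.of_exec ?_ (by simp only [Program.cost]; omega)
    refine none fun E hE hc => ?_
    exact absurd (by simpa [h20] using h) (hbest.opt E hE hc).1
  · have hK : m.natArr 11 s ≠ 0 := by simpa [h20] using h
    obtain ⟨E, hE, hc, hcode, hT⟩ := hbest.wit hK
    have hEn : E ⊆ Finset.range n := fun u hu => Finset.mem_range.2 (mem_neighbours.1 (hE hu)).1
    refine Halts.mono (Halts.seq (halts_of_loopFree announce m) fun m₁ f₁ h₁ =>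
      Halts.mono (decode_spec 1 (by decide) (hm.of_frame f₁) hEn ?_) le_rfl fun m₂ f₂ h₂ =>
        show Status n A B (fun w E => Q w E ∨ (w = v ∧ E.card = s)) m₂ from
        Or.inr ⟨?_, v, hvn, ?_, E, hE, Finset.card_pos.1 (by omega), ?_, h₂⟩) ?_ fun _ _ h => h
    · rw [h₁]
      simp [announce, h20, hcode]
    · rw [f₂.nat 1, h₁]
      simp [announce]
    · rw [f₂.nat 2, h₁]
      simp [announce, hv]
    · rw [hB E hc, ← hT]
      simpa [h20, hv, hρ, hm.alpha, hm.weight v hvn] using h'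
    · have : announce.cost ≤ 20 := by decide
      omega
  · refine Halts.of_exec ?_ (by simp only [Program.cost]; omega)
    refine none fun E hE hc hBE => h' ?_
    have h1 := (hbest.opt E hE hc).2
    rw [hB E hc] at hBE
    have h2 := hBE.trans_le (add_le_add_right h1 _)
    simpa [h20, hv, hρ, hm.alpha, hm.weight v hvn] using h2
  · simp only [Test.size, RealExpr.size, NatExpr.size]
    omega
  · simp only [Test.size, NatExpr.size]
    omega

theorem tryNextSize_spec (hm : HasInput n A α q m) (hv : m.nat 3 = v) (hvn : v < n)
    (hG : HoldsGroups n A v k gQ gH J U m) (hJ : J ≤ n) (hU : U J = (Finset.range n).erase v)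
    {B Q : ℕ → Finset ℕ → Prop} {t : ℕ} (ht : t < n) (h30 : m.nat 30 = t)
    (hρ : m.realArr 11 0 = ρ) (hQ0 : gQ ∅ = 0) (hH0 : gH ∅ = 0)
    (hadd : ∀ j < J, ∀ E ⊆ U j, ∀ S ⊆ U (j + 1) \ U j, gQ (E ∪ S) = gQ E + gQ S ∧
      gH (E ∪ S) = gH E + gH S)
    (hB : ∀ E, E.card = t + 1 →
      (B v E ↔ 0 < (t + 1 : ℕ) * (α * q v - ρ) + gain α ρ gQ gH (t + 1) E))
    (hst : Status n A B Q m) :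
    Halts tryNextSize m (500 * 2 ^ k * n ^ 2)
      (Status n A B (fun w E => Q w E ∨ (w = v ∧ E.card = t + 1))) := by
  refine Halts.mono (Halts.seq (halts_of_loopFree (.setNat 20 (.add (.var 30) (.const 1))) m)
    fun m₁ f₁ h₁ => Halts.seq (knapsack_spec (s := t + 1) (ρ := ρ) (hm.of_frame f₁) (by omega)
      (hG.congr (f₁.nat 5) (f₁.nat 6) (f₁.nat 25) (f₁.natArr 8) (f₁.natArr 9) (f₁.natArr 10)
        (f₁.realArr 4) (f₁.realArr 5) (f₁.realArr 9) (f₁.realArr 10)) hJ ?_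
      (by rw [f₁.realArr 11, hρ]) hQ0 hH0 hadd)
    fun m₂ f₂ h₂ => checkSize_spec (Q := Q) (s := t + 1) (ρ := ρ) (gQ := gQ) (gH := gH)
      ((hm.of_frame f₁).of_frame f₂) (by rw [f₂.nat 3, f₁.nat 3, hv]) hvn ?_ (by omega)
      (by rw [f₂.realArr 11, f₁.realArr 11, hρ]) hB ?_ ?_) ?_ fun _ _ h => h
  · rw [h₁]
    simp [h30]
  · rw [f₂.nat 20, h₁]
    simp [h30]
  · have := h₂ (t + 1) (by omega)
    rw [hU] at this
    exact this
  · exact hst.congr (fun _ _ _ _ h => h) (by rw [f₂.nat 1, f₁.nat 1]) (by rw [f₂.nat 2, f₁.nat 2])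
      (by rw [f₂.natArr 1, f₁.natArr 1])
  · have e0 : Program.cost (.setNat 20 (.add (.var 30) (.const 1))) ≤ 10 := by decide
    have hK : 1 ≤ 2 ^ k := Nat.one_le_two_pow
    have e3 : n ≤ n ^ 2 := Nat.le_self_pow (by decide) n
    have e4 : n ^ 2 ≤ 2 ^ k * n ^ 2 := Nat.le_mul_of_pos_left _ (by omega)
    rw [mul_assoc] at *
    rw [mul_assoc]
    omega

/-- The PageRank of `v`, computed from the masses of its set `N` of neighbours. -/
noncomputable def rankFormula (α : ℝ) (q : ℕ → ℝ) (gQ gH : Finset ℕ → ℝ) (v : ℕ) (N : Finset ℕ) :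
    ℝ :=
  α * (q v + gQ N) / (1 - (1 - α) * gH N / N.card)

theorem IsClosedAvoiding.sdiff {U U' : Finset ℕ} (hsymm : ∀ u w, A u w → A w u)
    (h : IsClosedAvoiding A v U) (h' : IsClosedAvoiding A v U') (hv : v ∉ U') :
    IsClosedAvoiding A v (U' \ U) := by
  intro u hu w hA hwv
  obtain ⟨h1, h2⟩ := Finset.mem_sdiff.1 hu
  refine Finset.mem_sdiff.2 ⟨h' u h1 w hA hwv, fun hw => h2 (h w hw u (hsymm _ _ hA) ?_)⟩
  rintro rfl
  exact hv h1

/-- All strategies of `v` are covered by running through the sizes 1 to `n`. The records are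
gathered only once, while the knapsack is repeated for each size. -/
theorem tryPlayer_spec (hm : HasInput n A α q m) (h0 : 0 < α) (h1 : α < 1)
    (hsymm : ∀ u w, A u w → A w u) (hlt : ∀ u w, A u w → w < n) (hvn : v < n)
    (hk : ∀ D : Finset ℕ, (∀ u ∈ D, A v u) →
      (∀ a ∈ D, ∀ b ∈ D, Relation.ReflTransGen (avoidAdj A v) a b) → D.card ≤ k)
    (hv : m.nat 3 = v) {B : ℕ → Finset ℕ → Prop}
    (hgQ : gQ = entryMass A (1 - α) q ((Finset.range n).erase v))
    (hgH : gH = returnMass A (1 - α) ((Finset.range n).erase v))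
    (hρ : ρ = rankFormula α q gQ gH v (neighbours n A v))
    (hB : ∀ E, B v E ↔ 0 < E.card * (α * q v - ρ) + gain α ρ gQ gH E.card E)
    (hst : Status n A B (fun w _ => w < v) m) :
    Halts tryPlayer m (2000 * 2 ^ k * n ^ 3) (Status n A B (fun w _ => w < v + 1)) := by
  have hβ0 : 0 ≤ 1 - α := by linarith
  have hβ1 : 1 - α < 1 := by linarith
  have hvW : v ∉ (Finset.range n).erase v := Finset.notMem_erase _ _
  refine Halts.mono (Halts.seq (gather_spec hm h0 h1 hsymm hlt hvn hk hv)
    fun m₁ f₁ h₁ => ?_ : Halts tryPlayer m (1000 * 2 ^ k * n ^ 3 + (50 +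
      (n * (500 * 2 ^ k * n ^ 2 + 7) + 5))) (Status n A B (fun w _ => w < v + 1))) ?_ fun _ _ h => h
  · obtain ⟨J, U, hJ, hU, hG⟩ := h₁
    rw [← hgQ, ← hgH] at hG
    have hm₁ := hm.of_frame f₁
    have hcost : setRank.cost ≤ 50 := by decide
    refine Halts.mono (Halts.seq (halts_of_loopFree setRank m₁) fun m₂ f₂ h₂ =>
      Halts.mono (Halts.forLoop (x := 30) (y := 0) (p := tryNextSize) (T := 500 * 2 ^ k * n ^ 2)
        (fun t m' => Status n A B (fun w E => w < v ∨ (w = v ∧ E.card ≤ t)) m')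
        (by rw [f₂.nat 0, hm₁.size]) ?_ ?_) le_rfl ?_) (Nat.add_le_add_right hcost _)
        fun _ _ h => h
    · refine hst.congr ?_ (by simp [f₂.nat 1, f₁.nat 1]) (by simp [f₂.nat 2, f₁.nat 2])
        (by simp [f₂.natArr 1, f₁.natArr 1])
      rintro w E - hne (h | ⟨-, h⟩)
      · exact h
      · have := Finset.card_pos.2 hne
        omega
    · intro t ht m' f h30 hst'
      have hG' := (hG.congr (f₂.nat 5) (f₂.nat 6) (f₂.nat 25) (f₂.natArr 8) (f₂.natArr 9)
        (f₂.natArr 10) (f₂.realArr 4) (f₂.realArr 5) (f₂.realArr 9) (f₂.realArr 10)).congr (f.nat 5)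
        (f.nat 6) (f.nat 25) (f.natArr 8) (f.natArr 9)
        (f.natArr 10) (f.realArr 4) (f.realArr 5) (f.realArr 9) (f.realArr 10)
      refine (tryNextSize_spec (ρ := ρ) (Q := fun w E => w < v ∨ (w = v ∧ E.card ≤ t))
        ((hm₁.of_frame f₂).of_frame f) (by rw [f.nat 3, f₂.nat 3, f₁.nat 3, hv]) hvn hG' hJ hU ht
        h30 ?_ ?_ ?_ ?_ ?_ hst').mono le_rfl ?_
      · have e1 := hG.total_entry
        have e2 := hG.total_ret
        have e3 := hG.total_size
        rw [hU] at e1 e2 e3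
        change _ = gQ (neighbours n A v) at e1
        change _ = gH (neighbours n A v) at e2
        change _ = (neighbours n A v).card at e3
        rw [f.realArr 11, h₂, hρ]
        simp [setRank, rankFormula, e1, e2, e3, hm₁.alpha, f₁.nat 3, hv, hm₁.weight v hvn]
      · rw [hgQ]
        simp [entryMass, hit_empty hβ0 hβ1]
      · rw [hgH]
        simp [returnMass]
      · intro j hj E hE S hS
        have c1 := hG.closed j hj.le
        have c2 := hG.closed (j + 1) hj
        have s1 := hG.subset j hj.le
        have s2 := hG.subset (j + 1) hj
        -- Closed sets and their differences are separated parts of the graph without `v`, so both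
        -- masses are additive.
        have p1 := c1.isSeparated hsymm s1 hvW
        have p2 := (c1.sdiff hsymm c2 fun h => hvW (s2 h)).isSeparated hsymm
          (Finset.sdiff_subset.trans s2) hvW
        rw [hgQ, hgH]
        exact ⟨entryMass_union hβ0 hβ1 q p1 p2 Finset.disjoint_sdiff hE hS,
          returnMass_union hβ0 hβ1 p1 p2 Finset.disjoint_sdiff hE hS⟩
      · intro E hE
        rw [hB, hE]
      · intro m'' _ h _ _
        refine h.congr ?_ (by simp) (by simp) (by simp)
        rintro w E - - (h | ⟨h, h'⟩)
        · exact Or.inl (Or.inl h)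
        · rcases Nat.le_succ_iff.1 h' with h' | h'
          · exact Or.inl (Or.inr ⟨h, h'⟩)
          · exact Or.inr ⟨h, h'⟩
    · intro m' _ h
      refine h.congr (fun w E hE _ hw => ?_) rfl rfl rfl
      rcases Nat.lt_succ_iff_lt_or_eq.1 hw with hw | rfl
      · exact Or.inl hw
      · refine Or.inr ⟨rfl, ?_⟩
        have := Finset.card_le_card (t := Finset.range n)
          fun u hu => Finset.mem_range.2 (mem_neighbours.1 (hE hu)).1
        simpa using this
  · have hK : 1 ≤ 2 ^ k := Nat.one_le_two_pow
    set K := 2 ^ k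
    have e3 : n ≤ n ^ 3 := Nat.le_self_pow (by decide) n
    have e4 : n ^ 3 ≤ K * n ^ 3 := Nat.le_mul_of_pos_left _ (by omega)
    have e5 : n * (500 * K * n ^ 2 + 7) = 500 * (K * n ^ 3) + 7 * n := by ring
    have e6 : 1000 * K * n ^ 3 = 1000 * (K * n ^ 3) := by ring
    have e7 : 2000 * K * n ^ 3 = 2000 * (K * n ^ 3) := by ring
    rw [e5, e6, e7]
    omega

theorem tableStep_spec {i : ℕ} (h0 : m.nat 0 = n) (h4 : m.nat 4 = i) (h13 : m.nat 13 = i * n)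
    (h26 : m.nat 26 = 2 ^ i) (h2 : ∀ u < i, m.natArr 2 u = u * n)
    (h3 : ∀ u < i, m.natArr 3 u = 2 ^ u) :
    Halts tableStep m 30 fun m' => m'.nat 13 = (i + 1) * n ∧ m'.nat 26 = 2 ^ (i + 1) ∧
      (∀ u < i + 1, m'.natArr 2 u = u * n) ∧ ∀ u < i + 1, m'.natArr 3 u = 2 ^ u := by
  refine Halts.of_exec ⟨?_, ?_, ?_, ?_⟩ (by decide)
  · simp [tableStep, h0, h13]
    ring
  · simp [tableStep, h26]
    ring
  · intro u hu
    by_cases h : u = i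
    · simp [tableStep, h, h4, h13]
    · simp [tableStep, h, h4, h2 u (by omega)]
  · intro u hu
    by_cases h : u = i
    · simp [tableStep, h, h4, h26]
    · simp [tableStep, h, h4, h3 u (by omega)]

open Classical in
-- The graph theory enters only through `hk`, `hρ` and `hB`; the rest concerns the program alone.
theorem decideNash_spec (hn : 0 < n) (h0 : 0 < α) (h1 : α < 1) (hsize : m.nat 0 = n)
    (hadj : ∀ u < n, ∀ w < n, m.natArr 0 (u * n + w) = if A u w then 1 else 0)
    (hα : m.realArr 0 0 = α) (hq : ∀ u < n, m.realArr 1 u = q u)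
    (hsymm : ∀ u w, A u w → A w u) (hlt : ∀ u w, A u w → w < n)
    (hk : ∀ v < n, ∀ D : Finset ℕ, (∀ u ∈ D, A v u) →
      (∀ a ∈ D, ∀ b ∈ D, Relation.ReflTransGen (avoidAdj A v) a b) → D.card ≤ k)
    {B : ℕ → Finset ℕ → Prop} {ρ : ℕ → ℝ}
    (hρ : ∀ v < n, ρ v = rankFormula α q (entryMass A (1 - α) q ((Finset.range n).erase v))
      (returnMass A (1 - α) ((Finset.range n).erase v)) v (neighbours n A v))
    (hB : ∀ v < n, ∀ E, B v E ↔ 0 < E.card * (α * q v - ρ v) + gain α (ρ v)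
      (entryMass A (1 - α) q ((Finset.range n).erase v))
      (returnMass A (1 - α) ((Finset.range n).erase v)) E.card E) :
    Halts decideNash m (3000 * 2 ^ k * n ^ 4) (Status n A B (fun w _ => w < n)) := by
  refine Halts.mono (Halts.seq (halts_of_loopFree tableInit m) fun m₁ f₁ h₁ =>
    Halts.seq (Halts.forLoop (x := 4) (y := 0) (p := tableStep) (T := 30) (N := n)
      (fun i m' => m'.nat 13 = i * n ∧ m'.nat 26 = 2 ^ i ∧ (∀ u < i, m'.natArr 2 u = u * n) ∧
        ∀ u < i, m'.natArr 3 u = 2 ^ u) (by rw [f₁.nat 0, hsize]) ?_ ?_)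
    fun m₂ f₂ h₂ => Halts.forLoop (x := 3) (y := 0) (p := tryPlayer) (T := 2000 * 2 ^ k * n ^ 3)
      (fun v m' => Status n A B (fun w _ => w < v) m') (by rw [f₂.nat 0, f₁.nat 0, hsize]) ?_ ?_)
    ?_ fun _ _ h => h
  · subst h₁
    simp [tableInit]
  · rintro i hi m' f h4 ⟨h13, h26, h2, h3⟩
    refine (tableStep_spec (by rw [f.nat 0, f₁.nat 0, hsize]) h4 h13 h26 h2 h3).mono le_rfl ?_
    rintro m'' - ⟨h13, h26, h2, h3⟩ - -
    exact ⟨by simpa using h13, by simpa using h26, by simpa using h2, by simpa using h3⟩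
  · refine Or.inl ⟨?_, fun v E _ _ h => by omega⟩
    simp only [Memory.setNat_nat]
    rw [f₂.nat 1, h₁]
    simp [tableInit]
  · intro v hv m' f h3 hst
    obtain ⟨-, -, hmul, hpow⟩ := h₂
    have hm₂ : HasInput n A α q m₂ :=
      ⟨by rw [f₂.nat 0, f₁.nat 0, hsize], by rw [f₂.natArr 0, f₁.natArr 0]; exact hadj, hmul, hpow,
        by rw [f₂.realArr 0, f₁.realArr 0, hα], by rw [f₂.realArr 1, f₁.realArr 1]; exact hq⟩
    refine (tryPlayer_spec (ρ := ρ v) (hm₂.of_frame f) h0 h1 hsymm hlt hv (hk v hv) h3 rfl rfl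
      (hρ v hv) (hB v hv) hst).mono le_rfl ?_
    rintro m'' - h - -
    exact h.congr (fun _ _ _ _ h => h) (by simp) (by simp) (by simp)
  · have hK : 1 ≤ 2 ^ k := Nat.one_le_two_pow
    have hc : tableInit.cost ≤ 10 := by decide
    set K := 2 ^ k
    have e3 : n ≤ n ^ 4 := Nat.le_self_pow (by decide) n
    have e4 : n ^ 4 ≤ K * n ^ 4 := Nat.le_mul_of_pos_left _ (by omega)
    have e5 : n * (2000 * K * n ^ 3 + 7) = 2000 * (K * n ^ 4) + 7 * n := by ring
    have e7 : 3000 * K * n ^ 4 = 3000 * (K * n ^ 4) := by ring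
    rw [e5, e7]
    omega

end

end PageRankGame

namespace PageRankGame

/-! # The nodes as natural numbers -/

section Transfer

variable {n : ℕ} {G : SimpleGraph (Fin n)} {α : ℝ} {q : Fin n → ℝ}

/-- The adjacency relation of `G` on natural numbers. -/
def natAdj (G : SimpleGraph (Fin n)) (u w : ℕ) : Prop :=
  ∃ (hu : u < n) (hw : w < n), G.Adj ⟨u, hu⟩ ⟨w, hw⟩

/-- The weights on natural numbers. -/
def natWeight (q : Fin n → ℝ) (u : ℕ) : ℝ := if h : u < n then q ⟨u, h⟩ else 0

@[simp] theorem natAdj_val (u w : Fin n) : natAdj G u w ↔ G.Adj u w :=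
  ⟨fun ⟨_, _, h⟩ => h, fun h => ⟨u.2, w.2, h⟩⟩

@[simp] theorem natWeight_val (u : Fin n) : natWeight q u = q u := by simp [natWeight]

theorem natAdj_symm {u w : ℕ} (h : natAdj G u w) : natAdj G w u :=
  ⟨h.2.1, h.1, h.2.2.symm⟩

theorem natAdj_ne {u w : ℕ} (h : natAdj G u w) : u ≠ w := by
  rintro rfl
  exact h.2.2.ne rfl

theorem range_erase_eq_map (v : Fin n) :
    (Finset.range n).erase v = (Finset.univ.erase v).map Fin.valEmbedding := by
  ext u
  simp only [Finset.mem_erase, Finset.mem_range, Finset.mem_map, Finset.mem_univ, and_true,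
    Fin.valEmbedding_apply]
  constructor
  · rintro ⟨h1, h2⟩
    exact ⟨⟨u, h2⟩, fun h => h1 (by rw [← h]), rfl⟩
  · rintro ⟨w, h, rfl⟩
    exact ⟨fun h' => h (Fin.ext h'), w.2⟩

open Classical in
/-- The elements of a set of natural numbers, as nodes. -/
noncomputable def finPart (n : ℕ) (D : Finset ℕ) : Finset (Fin n) :=
  Finset.univ.filter fun u => (u : ℕ) ∈ D

@[simp] theorem mem_finPart {D : Finset ℕ} {u : Fin n} : u ∈ finPart n D ↔ (u : ℕ) ∈ D := by
  simp [finPart]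

theorem map_finPart {D : Finset ℕ} (hD : ∀ u ∈ D, u < n) :
    (finPart n D).map Fin.valEmbedding = D := by
  ext u
  simp only [Finset.mem_map, mem_finPart, Fin.valEmbedding_apply]
  constructor
  · rintro ⟨w, h, rfl⟩
    exact h
  · exact fun h => ⟨⟨u, hD u h⟩, h, rfl⟩

theorem entryMass_map (h0 : 0 < α) (h1 : α < 1) (C E : Finset (Fin n)) :
    entryMass (natAdj G) (1 - α) (natWeight q) (C.map Fin.valEmbedding) (E.map Fin.valEmbedding)
      = entryMass G.Adj (1 - α) q C E := by
  unfold entryMass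
  rw [Finset.sum_map]
  refine Finset.sum_congr rfl fun u _ => ?_
  rw [hit_map (A := G.Adj) (by linarith) (by linarith) Fin.valEmbedding fun u w => natAdj_val u w]
  simp

theorem returnMass_map (h0 : 0 < α) (h1 : α < 1) (C E : Finset (Fin n)) :
    returnMass (natAdj G) (1 - α) (C.map Fin.valEmbedding) (E.map Fin.valEmbedding)
      = returnMass G.Adj (1 - α) C E := by
  unfold returnMass
  rw [Finset.sum_map]
  refine Finset.sum_congr rfl fun u _ => ?_
  rw [hit_map (A := G.Adj) (by linarith) (by linarith) Fin.valEmbedding fun u w => natAdj_val u w]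

/-- Turns the reachability recorded by the search into a walk of `G` that misses the player, as
`card_le_blockDegree` requires. -/
theorem exists_walk_avoiding {v : Fin n} {a b : ℕ} (ha : a < n) (hav : a ≠ v)
    (h : Relation.ReflTransGen (avoidAdj (natAdj G) v) a b) :
    ∃ (hb : b < n) (p : G.Walk ⟨a, ha⟩ ⟨b, hb⟩), v ∉ p.support := by
  induction h with
  | refl => exact ⟨ha, .nil, by simpa using fun h : v = ⟨a, ha⟩ => hav (by rw [h])⟩
  | tail _ h ih =>
    obtain ⟨hb, p, hp⟩ := ih
    obtain ⟨⟨_, hc, hadj⟩, -, hcv⟩ := h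
    refine ⟨hc, p.concat hadj, ?_⟩
    rw [SimpleGraph.Walk.support_concat]
    simp only [List.mem_append, List.mem_singleton, not_or]
    exact ⟨hp, fun h => hcv (by rw [h])⟩

theorem card_le_blockDegree_of_natAdj {v : ℕ} (hv : v < n) {D : Finset ℕ}
    (hD : ∀ u ∈ D, natAdj G v u)
    (hconn : ∀ a ∈ D, ∀ b ∈ D, Relation.ReflTransGen (avoidAdj (natAdj G) v) a b) :
    D.card ≤ blockDegree G := by
  rw [← map_finPart fun u hu => (hD u hu).2.1, Finset.card_map]
  refine card_le_blockDegree G (v := ⟨v, hv⟩) (fun u hu => ?_) fun a ha b hb => ?_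
  · exact (hD u (mem_finPart.1 hu)).2.2
  · obtain ⟨_, p, hp⟩ := exists_walk_avoiding (v := ⟨v, hv⟩) a.2
      (natAdj_ne (hD a (mem_finPart.1 ha))).symm
      (hconn a (mem_finPart.1 ha) b (mem_finPart.1 hb))
    exact ⟨p, hp⟩

/-- The PageRank of `v`, if `v` has a neighbour. -/
noncomputable def natRank (G : SimpleGraph (Fin n)) (α : ℝ) (q : Fin n → ℝ) (v : ℕ) : ℝ :=
  rankFormula α (natWeight q) (entryMass (natAdj G) (1 - α) (natWeight q) ((Finset.range n).erase v))
    (returnMass (natAdj G) (1 - α) ((Finset.range n).erase v)) v (neighbours n (natAdj G) v)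

/-- The criterion for `E` to be an improving strategy of `v`. -/
def Improves (G : SimpleGraph (Fin n)) (α : ℝ) (q : Fin n → ℝ) (v : ℕ) (E : Finset ℕ) : Prop :=
  0 < E.card * (α * natWeight q v - natRank G α q v) + gain α (natRank G α q v)
    (entryMass (natAdj G) (1 - α) (natWeight q) ((Finset.range n).erase v))
    (returnMass (natAdj G) (1 - α) ((Finset.range n).erase v)) E.card E

open Classical in
theorem neighbours_eq_map (v : Fin n) :
    neighbours n (natAdj G) v = (Finset.univ.filter (G.Adj v)).map Fin.valEmbedding := by
  ext u
  simp only [mem_neighbours, Finset.mem_map, Finset.mem_filter, Finset.mem_univ, true_and,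
    Fin.valEmbedding_apply]
  constructor
  · rintro ⟨hu, -, h⟩
    exact ⟨⟨u, hu⟩, h.2.2, rfl⟩
  · rintro ⟨w, h, rfl⟩
    exact ⟨w.2, fun h' => h.ne (Fin.ext h').symm, (natAdj_val v w).2 h⟩

theorem improves_iff (h0 : 0 < α) (h1 : α < 1) (hq : IsDistribution q) {v : Fin n}
    {E : Finset (Fin n)} (hE : ∀ u ∈ E, G.Adj v u) (hne : E.Nonempty) :
    Improves G α q v (E.map Fin.valEmbedding) ↔
      pageRank G α q v < pageRank (retain G v E) α q v := by
  classical
  -- The formula for the rank needs a neighbour of `v`; the nonempty strategy `E` provides one.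
  have hrank : natRank G α q v = pageRank G α q v := by
    rw [pageRank_eq_div (E := Finset.univ.filter (G.Adj v)) G h0 h1 hq (by simp)
      (hne.mono fun u hu => by simpa using hE u hu)]
    unfold natRank rankFormula
    rw [neighbours_eq_map, range_erase_eq_map, entryMass_map h0 h1, returnMass_map h0 h1,
      natWeight_val, Finset.card_map]
  rw [lt_pageRank_retain_iff G h0 h1 hq hE hne]
  unfold Improves gain
  rw [hrank, range_erase_eq_map, entryMass_map h0 h1, returnMass_map h0 h1, natWeight_val,
    Finset.card_map]

theorem correctOutput_of_status (h0 : 0 < α) (h1 : α < 1) (hq : IsDistribution q) {m : Memory}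
    (h : Status n (natAdj G) (Improves G α q) (fun w _ => w < n) m) :
    CorrectOutput n G α q m := by
  rcases h with ⟨h, h'⟩ | ⟨h, v, hv, h2, E, hE, hne, hB, hout⟩
  · have hN : IsNash G α q := by
      intro v E hE
      refine not_lt.1 fun hlt => ?_
      have hfin := Set.toFinite E
      have hadj : ∀ u ∈ hfin.toFinset, G.Adj v u := fun u hu => hE.1 (hfin.mem_toFinset.1 hu)
      have hne : hfin.toFinset.Nonempty := hfin.toFinset_nonempty.2 hE.2
      refine h' v (hfin.toFinset.map Fin.valEmbedding) ?_ (by simpa using hE.2) v.2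
        ((improves_iff h0 h1 hq hadj hne).2 (by simpa using hlt))
      rw [neighbours_eq_map, Finset.map_subset_map]
      exact fun u hu => by simpa using hadj u hu
    exact ⟨fun _ => h, fun h => absurd hN h⟩
  · have hmap := map_finPart fun u hu => (mem_neighbours.1 (hE hu)).1
    have hne' : (finPart n E).Nonempty := by
      rw [← hmap] at hne
      simpa using hne
    have hadj : ∀ u ∈ finPart n E, G.Adj ⟨v, hv⟩ u := fun u hu =>
      (mem_neighbours.1 (hE (mem_finPart.1 hu))).2.2.2.2
    have hset : outputStrategy n m = finPart n E := by
      ext u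
      simp [outputStrategy, hout u u.2]
    have himp : IsImproving G α q ⟨v, hv⟩ (outputStrategy n m) := by
      rw [hset]
      refine ⟨⟨fun u hu => hadj u hu, hne'⟩, (improves_iff h0 h1 hq hadj hne').1 ?_⟩
      rwa [hmap]
    exact ⟨fun hN => absurd (hN _ _ himp.1) (not_le.2 himp.2), fun _ => ⟨h, ⟨v, hv⟩, h2, himp⟩⟩

open Classical in
theorem decideNash_correct (h0 : 0 < α) (h1 : α < 1) (hq : IsDistribution q) :
    Halts decideNash (inputMemory n G α q) (3000 * 2 ^ blockDegree G * n ^ 4)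
      (CorrectOutput n G α q) := by
  -- There is no probability distribution on the empty set of nodes.
  have hn : 0 < n := by
    rcases Nat.eq_zero_or_pos n with rfl | h
    · simpa using hq.2
    · exact h
  refine (decideNash_spec (A := natAdj G) (q := natWeight q) (B := Improves G α q)
    (ρ := natRank G α q) hn h0 h1 (by simp [inputMemory]) ?_ (by simp [inputMemory]) ?_
    (fun _ _ => natAdj_symm) (fun _ _ h => h.2.1)
    (fun v hv D => card_le_blockDegree_of_natAdj hv) (fun _ _ => rfl) (fun _ _ _ => Iff.rfl)).mono
    le_rfl fun m _ h => correctOutput_of_status h0 h1 hq h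
  · intro u hu w hw
    simp only [inputMemory, true_and]
    refine if_congr ⟨?_, ?_⟩ rfl rfl
    · rintro ⟨i, j, h, hadj⟩
      obtain ⟨rfl, rfl⟩ := (index_inj hw j.2).1 h
      exact (natAdj_val i j).2 hadj
    · rintro ⟨_, _, h⟩
      exact ⟨_, _, rfl, h⟩
  · intro u hu
    simp [inputMemory, natWeight, hu]

end Transfer

end PageRankGame

/-! ### The theorem -/

theorem theorem3p2 :
    ∃ (P : PageRankGame.Program) (C : ℕ),
      ∀ (n : ℕ) (G : SimpleGraph (Fin n)) (α : ℝ) (q : Fin n → ℝ),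
        0 < α → α < 1 → PageRankGame.IsDistribution q →
        ∃ (t : ℕ) (m : PageRankGame.Memory),
          PageRankGame.Runs P (PageRankGame.inputMemory n G α q) t m ∧
          t ≤ C * (2 ^ PageRankGame.blockDegree G * n ^ 4) ∧
          PageRankGame.CorrectOutput n G α q m := by
  refine ⟨PageRankGame.decideNash, 3000, fun n G α q h0 h1 hq => ?_⟩
  obtain ⟨t, m, hr, ht, hc⟩ := PageRankGame.decideNash_correct (G := G) h0 h1 hq
  exact ⟨t, m, hr, by rwa [← mul_assoc], hc⟩
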